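/- A hypergraph $H=(V,E)$ on $V=[n]$ (unweighted, without repeated hyperedges) is identified with its characteristic vector $x_H\in\{0,1\}^{2^{[n]}}$. For $k\in[2,n]$, a $k$-cut is a partition of $V$ into $k$ non-empty parts $V_1,\dots,V_k$; a hyperedge crosses it if it is not contained in any single $V_i$. A $(1\pm\varepsilon)$-cut sparsifier of $H$ is a subset of the hyperedges of $H$ with non-negative weights such that, for every $2$-cut, the total weight of the crossing hyperedges is between $(1-\varepsilon)$ and $(1+\varepsilon)$ times the number of hyperedges of $H$ that cross it. A randomized linear sketch consists of a random integer matrix $M_\omega$ (whose distribution does not depend on $H$, and with public randomness $\omega$, which is not counted in the size), with $2^n$ columns and a fixed number of rows, together with a recovery procedure that sees only $\omega$ and the vector $M_\omega x_H$. It has size $B$ bits if each row $j$ can be given a fixed number $b_j$ of bits so that $|(M_\omega x_H)_j|<2^{b_j}$ for every $\omega$ and every admissible input $H$, and $\sum_j (b_j+1)= B$ (one bit is for the sign). Theorem. There are universal constants $C>0$ and $c\in\mathbb N$ such that the following holds for all integers $n, r\ge 0$ and $m\ge 2$ and every $\varepsilon\in(0,1)$. With $X=nr\log(m)/\varepsilon^2$,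 there is a randomized linear sketch of size at most $C\,X\,\log^c(2+X)$ bits, i.e. $\widetilde O(nr\log(m)/\varepsilon^2)$ bits, such that for every $n$-vertex unweighted hypergraph $H$ with at most $m$ hyperedges, each of arity (number of vertices) at most $r$, the following holds with probability at least $1-4n^{-8}$ over $\omega$ (for $n=0$: with probability $1$): the recovery procedure outputs a $(1\pm\varepsilon)$-cut sparsifier of $H$, and this sparsifier in fact preserves, simultaneously for every $k\in[2,n]$ and every $k$-cut, the (weighted) number of crossing hyperedges up to a factor $1\pm\varepsilon$. -/

import Mathlib

noncomputable section

namespace HypergraphSketch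

/-! Unweighted hypergraphs, `k`-cuts and sparsifiers. -/

open scoped Classical in
/-- The finite set of hyperedges of a hypergraph on (a subset of) the vertices `Fin n`. -/
def edges {n : ℕ} (H : Hypergraph (Fin n)) : Finset (Finset (Fin n)) :=
  Finset.univ.filter fun e => (e : Set (Fin n)) ∈ H.edgeSet

/-- `H` has vertex set `Fin n`, at most `m` hyperedges, and each hyperedge has arity
(number of vertices) at most `r`. -/
def IsBounded {n : ℕ} (m r : ℕ) (H : Hypergraph (Fin n)) : Prop :=
  H.vertexSet = Set.univ ∧ (edges H).card ≤ m ∧ ∀ e ∈ edges H, e.card ≤ r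

/-- The characteristic vector in `{0,1}^(2^n)` of an unweighted hypergraph. -/
def toVec {n : ℕ} (H : Hypergraph (Fin n)) : Finset (Fin n) → ℤ :=
  fun e => if e ∈ edges H then 1 else 0

/-- A partition of the vertices into `k` labelled parts `V i = f ⁻¹' {i}` is given by its
labelling `f : Fin n → Fin k`; all parts are non-empty iff `f` is surjective.
A hyperedge crosses the partition if it is not contained in any single part. -/
def Crosses {n k : ℕ} (f : Fin n → Fin k) (e : Finset (Fin n)) : Prop :=
  ∀ i : Fin k, ¬ ∀ v ∈ e, f v = i

instance {n k : ℕ} (f : Fin n → Fin k) : DecidablePred (Crosses f) := fun e => by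
  unfold Crosses; infer_instance

/-- The un-normalized size of a `k`-cut in an unweighted hypergraph: the number of hyperedges
crossing it. -/
def cutSize {n k : ℕ} (H : Hypergraph (Fin n)) (f : Fin n → Fin k) : ℕ :=
  ((edges H).filter (Crosses f)).card

/-- The total weight of the hyperedges crossing a `k`-cut in the weighted hypergraph in which
the hyperedge `e` has weight `w e` (weight `0` meaning that `e` is absent). -/
def cutWeight {n k : ℕ} (w : Finset (Fin n) → ℝ) (f : Fin n → Fin k) : ℝ :=
  ∑ e : Finset (Fin n) with Crosses f e, w e

/-- `w` is a re-weighted subhypergraph of `H`. -/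
def IsReweightedSubhypergraph {n : ℕ} (H : Hypergraph (Fin n)) (w : Finset (Fin n) → ℝ) : Prop :=
  (∀ e, 0 ≤ w e) ∧ ∀ e, w e ≠ 0 → e ∈ edges H

/-- `w` preserves the weight of every `k`-cut of `H` up to a factor `1 ± ε`. -/
def PreservesCuts {n : ℕ} (k : ℕ) (ε : ℝ) (H : Hypergraph (Fin n)) (w : Finset (Fin n) → ℝ) : Prop :=
  ∀ f : Fin n → Fin k, Function.Surjective f →
    (1 - ε) * (cutSize H f : ℝ) ≤ cutWeight w f ∧ cutWeight w f ≤ (1 + ε) * (cutSize H f : ℝ)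

/-- `w` is a `(1 ± ε)`-cut-sparsifier of `H`: ordinary cuts are the `2`-cuts. -/
def IsCutSparsifier {n : ℕ} (ε : ℝ) (H : Hypergraph (Fin n)) (w : Finset (Fin n) → ℝ) : Prop :=
  IsReweightedSubhypergraph H w ∧ PreservesCuts 2 ε H w

/-! Linear sketches. -/

/-- A randomized linear sketch for hypergraphs on `n` vertices, with its recovery procedure.
The (public) randomness is a random `seed`; it determines an integer matrix with one column for
each of the `2^n` possible hyperedges. The `j`-th measurement is stored in a register of
`width j` bits for the magnitude and one bit for the sign. The recovery procedure sees
only the seed and the measurements. -/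
structure RandomizedLinearSketch (n : ℕ) where
  Seed : Type
  law : PMF Seed
  rows : ℕ
  matrix : Seed → Matrix (Fin rows) (Finset (Fin n)) ℤ
  width : Fin rows → ℕ
  recover : Seed → (Fin rows → ℤ) → (Finset (Fin n) → ℝ)

namespace RandomizedLinearSketch

variable {n : ℕ} (S : RandomizedLinearSketch n)

/-- The linear measurement of `H`: the matrix times the characteristic vector. -/
def sketch (ω : S.Seed) (H : Hypergraph (Fin n)) : Fin S.rows → ℤ :=
  (S.matrix ω).mulVec (toVec H)

/-- The size of the sketch in bits. -/
def bits : ℕ := ∑ j, (S.width j + 1)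

/-- For every seed, all measurements of `H` fit into their registers. -/
def Fits (H : Hypergraph (Fin n)) : Prop :=
  ∀ ω j, |S.sketch ω H j| < 2 ^ S.width j

/-- The weighted hypergraph recovered from the seed and the sketch of `H`. -/
def output (ω : S.Seed) (H : Hypergraph (Fin n)) : Finset (Fin n) → ℝ :=
  S.recover ω (S.sketch ω H)

/-- The probability, over the random seed, that the output on `H` satisfies `good`. -/
def successProb (H : Hypergraph (Fin n)) (good : (Finset (Fin n) → ℝ) → Prop) : ℝ :=
  (S.law.toOuterMeasure {ω | good (S.output ω H)}).toReal

end RandomizedLinearSketch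

/-- `C * X * log(2 + X)^c`: with `C`, `c` universal constants, this is the bound `Õ(X)`. -/
def softO (C : ℝ) (c : ℕ) (X : ℝ) : ℝ := C * X * Real.log (2 + X) ^ c

end HypergraphSketch

end

/-! The argument lives in the lattice of partitions of the vertex set, ordered by refinement.
`SparseOn` bounds from above the edges swallowed per class lost when classes are merged;
`StrongOver` bounds from below the edges exposed per class gained when classes are split. Minimising
(crossing edges) - θ (number of classes) over the coarsenings of a partition gives one with both
properties, `strongPartition`. Supermodularity of the class count, `numClasses_sup_add_inf`, forces
strong partitions to refine strictly sparse ones (`StrongOver.le_of_strictSparse`); this is how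
partitions computed from different samples are compared.

Sparsification: if every edge is kept with probability at least about log n / (ε² · strength) and
weighted by the inverse probability, all cuts survive (`pr_exists_bad_cut_le`). The union bound over
cuts rests on a Karger-style generating function, bounded by contracting random edges
(`sum_cutFamily_le`). It applies because the inverse strengths of the edges crossing a partition
dominate the number of classes to be merged (`numClasses_sub_le_sum_invStrength`). The bound covers
all partitions, hence all k-cuts at once.

Finding the strengths: edges are sampled at rates 2^t / 2^N. At level t the current partition has
density at most 4κ 2^N / 2^t. A block of `J` rounds, each merging the strong components of a fresh
sample at slowly rising thresholds, halves this density and never merges beyond the components of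
strength κ 2^N / 2^(t+1). This works since each round at least halves the number of merges still
missing (`mergeChain_invariant`). An edge is finally output at the rate belonging to the last level
partition it crosses.

Recovery from linear measurements: each edge spreads random coefficients mod q, adding up to zero,
over its vertices. Summing the measurements over a class cancels every edge inside the class, so
only edges crossing the known partition remain, and the sample is sparse there. If two sparse
candidates differ in a set y, the class sums of y form a random vector in a group of size at least
q^(|y|/K). Hence `K` independent measurements agree with probability at most q^(-|y|), and the sum
over all y is small (`pr_exists_compatible_le`). This takes nK registers of O(r log n) bits for each
of O(log m · log n) samples. -/

noncomputable section

namespace HypergraphSketch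

open scoped Classical
open Finset

/-! ### Partitions, class counts, and sparse and strong partitions. -/

section Partitions

variable {V : Type}

/-- The number of classes of a partition, given as an equivalence relation. -/
def numClasses (s : Setoid V) : ℕ := Nat.card (Quotient s)

/-- The finest partition in which the vertices of `e` are in the same class. -/
def contract (e : Finset V) : Setoid V := Relation.EqvGen.setoid fun x y => x ∈ e ∧ y ∈ e

/-- The edge `e` is not contained in a class of the partition `s`. -/
def Cuts (s : Setoid V) (e : Finset V) : Prop := ¬ contract e ≤ s

/-- The finest partition identifying `x` and `y`. -/
def pairSetoid (p : V × V) : Setoid V := Relation.EqvGen.setoid fun a b => a = p.1 ∧ b = p.2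

theorem contract_le_iff {e : Finset V} {s : Setoid V} :
    contract e ≤ s ↔ ∀ x ∈ e, ∀ y ∈ e, s x y := by
  constructor
  · intro h x hx y hy
    exact h (Relation.EqvGen.rel x y ⟨hx, hy⟩)
  · intro h
    exact Setoid.eqvGen_le fun x y hxy => h x hxy.1 y hxy.2

theorem pairSetoid_le_iff {p : V × V} {s : Setoid V} : pairSetoid p ≤ s ↔ s p.1 p.2 := by
  constructor
  · intro h
    exact h (Relation.EqvGen.rel p.1 p.2 ⟨rfl, rfl⟩)
  · intro h
    refine Setoid.eqvGen_le fun x y hxy => ?_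
    rw [hxy.1, hxy.2]; exact h

theorem Cuts.mono {s t : Setoid V} (h : s ≤ t) {e : Finset V} (he : Cuts t e) : Cuts s e :=
  fun h' => he (h'.trans h)

theorem cuts_inf {s t : Setoid V} {e : Finset V} : Cuts (s ⊓ t) e ↔ Cuts s e ∨ Cuts t e := by
  simp only [Cuts, le_inf_iff]; tauto

/-- The edges of `G` that cross `s` but not `t`. -/
def between (G : Finset (Finset V)) (s t : Setoid V) : Finset (Finset V) :=
  G.filter fun e => Cuts s e ∧ ¬ Cuts t e

/-- The edges of `G` that cross `s`. -/
def cutEdges (G : Finset (Finset V)) (s : Setoid V) : Finset (Finset V) :=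
  G.filter fun e => Cuts s e

theorem card_between_add (G : Finset (Finset V)) {s t : Setoid V} (h : s ≤ t) :
    (between G s t).card + (cutEdges G t).card = (cutEdges G s).card := by
  rw [← Finset.card_union_of_disjoint]
  · congr 1
    ext e
    simp only [between, cutEdges, Finset.mem_union, Finset.mem_filter]
    have := Cuts.mono h (e := e)
    tauto
  · rw [Finset.disjoint_left]
    intro e he he'
    exact (Finset.mem_filter.1 he).2.2 (Finset.mem_filter.1 he').2

variable [Fintype V]

instance : Finite (Setoid V) :=
  Finite.of_injective (fun s : Setoid V => (s : V → V → Prop)) fun _ _ h =>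
    Setoid.eq_iff_rel_eq.2 h

instance : Fintype (Setoid V) := Fintype.ofFinite _

theorem numClasses_le_card (s : Setoid V) : numClasses s ≤ Fintype.card V := by
  rw [numClasses, ← Nat.card_eq_fintype_card]
  exact Nat.card_le_card_of_surjective _ (Quotient.mk_surjective (s := s))

theorem numClasses_bot : numClasses (⊥ : Setoid V) = Fintype.card V := by
  rw [numClasses, ← Nat.card_eq_fintype_card]
  exact Nat.card_congr Setoid.quotientBotEquiv

theorem numClasses_anti {s t : Setoid V} (h : s ≤ t) : numClasses t ≤ numClasses s := by
  refine Nat.card_le_card_of_surjective (Setoid.map_of_le h) ?_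
  intro q
  induction q using Quotient.inductionOn with
  | h a => exact ⟨Quotient.mk s a, rfl⟩

theorem numClasses_lt {s t : Setoid V} (h : s < t) : numClasses t < numClasses s := by
  refine lt_of_le_of_ne (numClasses_anti h.le) fun heq => h.not_ge ?_
  have hsurj : Function.Surjective (Setoid.map_of_le h.le) := by
    intro q
    induction q using Quotient.inductionOn with
    | h a => exact ⟨Quotient.mk s a, rfl⟩
  have hb : Function.Bijective (Setoid.map_of_le h.le) :=
    (Nat.bijective_iff_surjective_and_card _).2 ⟨hsurj, heq.symm⟩
  rw [Setoid.le_def]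
  intro x y hxy
  have : (Quotient.mk s x) = Quotient.mk s y := hb.1 (Quotient.sound (s := t) hxy)
  exact Quotient.exact this

theorem eq_of_numClasses_le {s t : Setoid V} (h : s ≤ t) (hc : numClasses s ≤ numClasses t) :
    s = t := by
  by_contra hne
  exact absurd (numClasses_lt (lt_of_le_of_ne h hne)) (not_lt.2 hc)

/-- Gluing the class of x to that of y is already an equivalence relation, written down as `s'`.
Sending the class of x to `none` makes the remaining projection injective, so only one class is
lost. -/
theorem numClasses_le_sup_pair (s : Setoid V) (p : V × V) :
    numClasses s ≤ numClasses (s ⊔ pairSetoid p) + 1 := by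
  obtain ⟨x, y⟩ := p
  let s' : Setoid V :=
    { r := fun a b => s a b ∨ ((s x a ∨ s y a) ∧ (s x b ∨ s y b))
      iseqv := by
        refine ⟨fun a => Or.inl (s.refl' a), ?_, ?_⟩
        · rintro a b (h | h)
          · exact Or.inl (s.symm' h)
          · exact Or.inr ⟨h.2, h.1⟩
        · rintro a b c (h | h) (h' | h')
          · exact Or.inl (s.trans' h h')
          · refine Or.inr ⟨?_, h'.2⟩
            rcases h'.1 with h1 | h1
            · exact Or.inl (s.trans' h1 (s.symm' h))
            · exact Or.inr (s.trans' h1 (s.symm' h))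
          · refine Or.inr ⟨h.1, ?_⟩
            rcases h.2 with h1 | h1
            · exact Or.inl (s.trans' h1 h')
            · exact Or.inr (s.trans' h1 h')
          · exact Or.inr ⟨h.1, h'.2⟩ }
  have hle : s ⊔ pairSetoid (x, y) ≤ s' := by
    refine sup_le (fun a b h => Or.inl h) (pairSetoid_le_iff.2 ?_)
    exact Or.inr ⟨Or.inl (s.refl' x), Or.inr (s.refl' y)⟩
  refine le_trans ?_ (Nat.add_le_add_right (numClasses_anti hle) 1)
  have hss : s ≤ s' := fun a b h => Or.inl h
  let φ : Quotient s → Option (Quotient s') := fun q =>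
    if q = Quotient.mk s x then none else some (Setoid.map_of_le hss q)
  have hφ : Function.Injective φ := by
    intro q₁ q₂
    induction q₁ using Quotient.inductionOn with
    | h a =>
    induction q₂ using Quotient.inductionOn with
    | h b =>
    intro hab
    by_cases ha : Quotient.mk s a = Quotient.mk s x <;>
      by_cases hb : Quotient.mk s b = Quotient.mk s x
    · rw [ha, hb]
    · simp [φ, ha, hb] at hab
    · simp [φ, ha, hb] at hab
    · simp only [φ, ha, hb, if_false, Option.some.injEq] at hab
      have h' : s' a b := Quotient.exact (s := s') hab
      have hxa : ¬ s x a := fun h => ha (Quotient.sound (s.symm' h))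
      have hxb : ¬ s x b := fun h => hb (Quotient.sound (s.symm' h))
      rcases h' with h | ⟨h1, h2⟩
      · exact Quotient.sound h
      · exact Quotient.sound (s.trans' (s.symm' (h1.resolve_left hxa)) (h2.resolve_left hxb))
  have := Nat.card_le_card_of_injective φ hφ
  rwa [Finite.card_option] at this

/-- The coarsening of `s` that identifies the pairs `f i`. -/
def mergePairs (s : Setoid V) {k : ℕ} (f : Fin k → V × V) : Setoid V := s ⊔ ⨆ i, pairSetoid (f i)

theorem numClasses_le_mergePairs (s : Setoid V) {k : ℕ} (f : Fin k → V × V) :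
    numClasses s ≤ numClasses (mergePairs s f) + k := by
  induction k generalizing s with
  | zero => simp [mergePairs]
  | succ k ih =>
    have h1 := numClasses_le_sup_pair s (f 0)
    have h2 := ih (s ⊔ pairSetoid (f 0)) (fun i => f i.succ)
    have h3 : mergePairs (s ⊔ pairSetoid (f 0)) (fun i => f i.succ) = mergePairs s f := by
      simp only [mergePairs]
      rw [sup_assoc]
      congr 1
      apply le_antisymm
      · exact sup_le (le_iSup (fun i => pairSetoid (f i)) 0)
          (iSup_le fun i => le_iSup (fun i => pairSetoid (f i)) i.succ)
      · refine iSup_le fun i => ?_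
        refine Fin.cases ?_ (fun i => ?_) i
        · exact le_sup_left
        · exact le_trans (le_iSup (fun i : Fin k => pairSetoid (f i.succ)) i) le_sup_right
    rw [h3] at h2
    omega

/-- Each pair related by t but not yet by s reduces the class count, so k pairs suffice; unneeded
slots are filled with a trivial pair (v, v). This encoding underlies all counting of partitions. -/
theorem exists_mergePairs [Nonempty V] {s t : Setoid V} (h : s ≤ t) (k : ℕ)
    (hk : numClasses s ≤ numClasses t + k) : ∃ f : Fin k → V × V, mergePairs s f = t := by
  induction k generalizing s with
  | zero =>
    refine ⟨Fin.elim0, ?_⟩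
    rw [← eq_of_numClasses_le h (by simpa using hk)]
    simp [mergePairs]
  | succ k ih =>
    by_cases hst : s = t
    · subst hst
      obtain ⟨v⟩ := ‹Nonempty V›
      exact ⟨fun _ => (v, v), le_antisymm
        (sup_le le_rfl (iSup_le fun i => pairSetoid_le_iff.2 (s.refl' _))) le_sup_left⟩
    · have hlt : s < t := lt_of_le_of_ne h hst
      have : ∃ x y, t x y ∧ ¬ s x y := by
        by_contra hcon
        push Not at hcon
        exact hlt.not_ge fun x y hxy => hcon x y hxy
      obtain ⟨x, y, hxy, hnxy⟩ := this
      have hle : s ⊔ pairSetoid (x, y) ≤ t := sup_le h (pairSetoid_le_iff.2 hxy)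
      have hlt' : s < s ⊔ pairSetoid (x, y) := by
        refine lt_of_le_of_ne le_sup_left fun heq => hnxy ?_
        rw [heq]; exact pairSetoid_le_iff.1 (le_sup_right : pairSetoid (x, y) ≤ _)
      have := numClasses_lt hlt'
      obtain ⟨f, hf⟩ := ih hle (by omega)
      refine ⟨Fin.cons (x, y) f, ?_⟩
      rw [← hf]
      simp only [mergePairs]
      rw [sup_assoc]
      congr 1
      apply le_antisymm
      · refine iSup_le fun i => ?_
        refine Fin.cases ?_ (fun i => ?_) i
        · exact le_sup_left
        · exact le_trans (le_iSup (fun i : Fin k => pairSetoid (f i)) i) le_sup_right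
      · exact sup_le (le_iSup_of_le (0 : Fin (k + 1)) (by simp))
          (iSup_le fun i => le_iSup_of_le i.succ (by simp))

/-- The merges leading from s ⊓ t to t also lead from s to s ⊔ t, and each of them costs at most one
class there. -/
theorem numClasses_sup_add_inf [Nonempty V] (s t : Setoid V) :
    numClasses s + numClasses t ≤ numClasses (s ⊔ t) + numClasses (s ⊓ t) := by
  have hle : s ⊓ t ≤ t := inf_le_right
  have hc := numClasses_anti hle
  obtain ⟨f, hf⟩ := exists_mergePairs hle (numClasses (s ⊓ t) - numClasses t) (by omega)
  have h1 := numClasses_le_mergePairs s f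
  have h2 : mergePairs s f = s ⊔ t := by
    calc mergePairs s f = s ⊔ mergePairs (s ⊓ t) f := by
          simp only [mergePairs]
          rw [← sup_assoc, sup_inf_self]
      _ = s ⊔ t := by rw [hf]
  rw [h2] at h1
  omega

theorem card_coarsenings_le [Nonempty V] (s : Setoid V) (k : ℕ) (F : Finset (Setoid V))
    (hF : ∀ t ∈ F, s ≤ t ∧ numClasses s ≤ numClasses t + k) :
    F.card ≤ Fintype.card V ^ (2 * k) := by
  have hsub : F ⊆ Finset.univ.image (fun f : Fin k → V × V => mergePairs s f) := by
    intro t ht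
    obtain ⟨f, hf⟩ := exists_mergePairs (hF t ht).1 k (hF t ht).2
    exact Finset.mem_image.2 ⟨f, Finset.mem_univ _, hf⟩
  refine (Finset.card_le_card hsub).trans (Finset.card_image_le.trans ?_)
  simp [pow_mul, sq]

theorem card_intervals_le [Nonempty V] {s u : Setoid V} (hsu : s ≤ u)
    (F : Finset (Setoid V × Setoid V))
    (hF : ∀ p ∈ F, s ≤ p.1 ∧ p.1 ≤ p.2 ∧ p.2 ≤ u) :
    F.card ≤ Fintype.card V ^ (4 * (numClasses s - numClasses u)) := by
  have hk := numClasses_anti hsu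
  have hsub : F ⊆ (F.image Prod.fst) ×ˢ (F.image Prod.snd) := by
    intro p hp
    exact Finset.mem_product.2 ⟨Finset.mem_image_of_mem _ hp, Finset.mem_image_of_mem _ hp⟩
  have h1 := card_coarsenings_le s (numClasses s - numClasses u) (F.image Prod.fst) (by
    intro t ht
    obtain ⟨p, hp, rfl⟩ := Finset.mem_image.1 ht
    obtain ⟨a, b, c⟩ := hF p hp
    have := numClasses_anti (b.trans c)
    exact ⟨a, by omega⟩)
  have h2 := card_coarsenings_le s (numClasses s - numClasses u) (F.image Prod.snd) (by
    intro t ht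
    obtain ⟨p, hp, rfl⟩ := Finset.mem_image.1 ht
    obtain ⟨a, b, c⟩ := hF p hp
    have := numClasses_anti c
    exact ⟨a.trans b, by omega⟩)
  calc F.card ≤ _ := Finset.card_le_card hsub
    _ = (F.image Prod.fst).card * (F.image Prod.snd).card := Finset.card_product _ _
    _ ≤ _ := Nat.mul_le_mul h1 h2
    _ = _ := by rw [← pow_add]; congr 1; ring

/-- Every set of classes of `s` spans at most `θ` edges of `G` per merged class. -/
def SparseOn (G : Finset (Finset V)) (θ : ℝ) (s : Setoid V) : Prop :=
  ∀ t, s ≤ t → ((between G s t).card : ℝ) ≤ θ * ((numClasses s : ℝ) - numClasses t)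

/-- Strict version of `SparseOn`. -/
def StrictSparseOn (G : Finset (Finset V)) (θ : ℝ) (s : Setoid V) : Prop :=
  ∀ t, s < t → ((between G s t).card : ℝ) < θ * ((numClasses s : ℝ) - numClasses t)

theorem SparseOn.strict {G : Finset (Finset V)} {θ θ' : ℝ} {s : Setoid V} (h : SparseOn G θ s)
    (hlt : θ < θ') : StrictSparseOn G θ' s := by
  intro t hst
  refine (h t hst.le).trans_lt (mul_lt_mul_of_pos_right hlt ?_)
  have := numClasses_lt hst
  rw [sub_pos]
  exact_mod_cast this

/-- The classes of `u`, as unions of classes of `s`, are strong: splitting them costs at least `θ`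
edges for each new class. -/
def StrongOver (G : Finset (Finset V)) (θ : ℝ) (s u : Setoid V) : Prop :=
  s ≤ u ∧ ∀ t, s ≤ t → t ≤ u →
    θ * ((numClasses t : ℝ) - numClasses u) ≤ ((between G t u).card : ℝ)

/-- Comparing the minimiser with coarser partitions gives sparsity, comparing it with finer ones
gives strength. -/
theorem exists_strongPartition (θ : ℝ) (G : Finset (Finset V)) (s : Setoid V) :
    ∃ u, s ≤ u ∧ ∀ t, s ≤ t → ((cutEdges G u).card : ℝ) - θ * numClasses u ≤
      ((cutEdges G t).card : ℝ) - θ * numClasses t := by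
  obtain ⟨u, hu, hmin⟩ := Finset.exists_min_image (Finset.univ.filter fun t : Setoid V => s ≤ t)
    (fun t => ((cutEdges G t).card : ℝ) - θ * numClasses t) ⟨s, by simp⟩
  exact ⟨u, by simpa using hu, fun t ht => hmin t (by simpa using ht)⟩

/-- A coarsening of `s` whose classes are `θ`-strong over `s`, while `G` is sparse on it. -/
def strongPartition (θ : ℝ) (G : Finset (Finset V)) (s : Setoid V) : Setoid V :=
  Classical.choose (exists_strongPartition θ G s)

theorem le_strongPartition (θ : ℝ) (G : Finset (Finset V)) (s : Setoid V) :
    s ≤ strongPartition θ G s := (Classical.choose_spec (exists_strongPartition θ G s)).1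

theorem sparseOn_strongPartition (θ : ℝ) (G : Finset (Finset V)) (s : Setoid V) :
    SparseOn G θ (strongPartition θ G s) := by
  intro t ht
  have h := (Classical.choose_spec (exists_strongPartition θ G s)).2 t
    ((le_strongPartition θ G s).trans ht)
  rw [← strongPartition] at h
  have h' : ((between G (strongPartition θ G s) t).card : ℝ) + (cutEdges G t).card =
      (cutEdges G (strongPartition θ G s)).card := by exact_mod_cast card_between_add G ht
  linarith

theorem strongOver_strongPartition (θ : ℝ) (G : Finset (Finset V)) (s : Setoid V) :
    StrongOver G θ s (strongPartition θ G s) := by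
  refine ⟨le_strongPartition θ G s, fun t hst ht => ?_⟩
  have h := (Classical.choose_spec (exists_strongPartition θ G s)).2 t hst
  rw [← strongPartition] at h
  have h' : ((between G t (strongPartition θ G s)).card : ℝ) +
      (cutEdges G (strongPartition θ G s)).card = (cutEdges G t).card := by
    exact_mod_cast card_between_add G ht
  linarith

/-- The minimisation sees only edges crossing s, and the choice depends only on the defining
predicate. The decoder, which knows just those edges, therefore picks the very same partition. -/
theorem strongPartition_congr {θ : ℝ} {G G' : Finset (Finset V)} {s : Setoid V}
    (h : cutEdges G s = cutEdges G' s) : strongPartition θ G s = strongPartition θ G' s := by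
  have key : ∀ t, s ≤ t → cutEdges G t = cutEdges G' t := by
    intro t ht
    have : ∀ G'' : Finset (Finset V), cutEdges G'' t = (cutEdges G'' s).filter fun e => Cuts t e := by
      intro G''
      ext e
      simp only [cutEdges, Finset.mem_filter]
      have := Cuts.mono ht (e := e)
      tauto
    rw [this G, this G', h]
  have : (fun u => s ≤ u ∧ ∀ t, s ≤ t → ((cutEdges G u).card : ℝ) - θ * numClasses u ≤
      ((cutEdges G t).card : ℝ) - θ * numClasses t) =
      (fun u => s ≤ u ∧ ∀ t, s ≤ t → ((cutEdges G' u).card : ℝ) - θ * numClasses u ≤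
      ((cutEdges G' t).card : ℝ) - θ * numClasses t) := by
    funext u
    apply propext
    constructor
    · rintro ⟨h1, h2⟩
      refine ⟨h1, fun t ht => ?_⟩
      have := h2 t ht
      rwa [key u h1, key t ht] at this
    · rintro ⟨h1, h2⟩
      refine ⟨h1, fun t ht => ?_⟩
      have := h2 t ht
      rwa [key u h1, key t ht]
  simp only [strongPartition]
  congr 1

/-- A strong partition refines every partition on which the graph is strictly sparse. -/
theorem StrongOver.le_of_strictSparse [Nonempty V] {G : Finset (Finset V)} {θ : ℝ} (hθ : 0 ≤ θ)
    {s u m : Setoid V} (hu : StrongOver G θ s u) (hsm : s ≤ m) (hm : StrictSparseOn G θ m) :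
    u ≤ m := by
  by_contra hnot
  have hlt : m < u ⊔ m := by
    refine lt_of_le_of_ne le_sup_right fun heq => hnot ?_
    rw [heq]; exact le_sup_left
  have h1 := hm _ hlt
  have h2 := hu.2 (u ⊓ m) (le_inf hu.1 hsm) inf_le_left
  -- An edge inside a class of u that crosses u ⊓ m must cross m, and it lies inside a class of u ⊔
  -- m.
  have h3 : between G (u ⊓ m) u ⊆ between G m (u ⊔ m) := by
    intro e he
    simp only [between, Finset.mem_filter, cuts_inf] at he ⊢
    exact ⟨he.1, he.2.1.resolve_left he.2.2, fun h => he.2.2 (h.mono le_sup_left)⟩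
  have h4 : ((between G (u ⊓ m) u).card : ℝ) ≤ (between G m (u ⊔ m)).card := by
    exact_mod_cast Finset.card_le_card h3
  have h5 : ((numClasses u : ℝ) + numClasses m) ≤ numClasses (u ⊔ m) + numClasses (u ⊓ m) := by
    exact_mod_cast numClasses_sup_add_inf u m
  have h6 : θ * ((numClasses m : ℝ) - numClasses (u ⊔ m)) ≤
      θ * ((numClasses (u ⊓ m) : ℝ) - numClasses u) :=
    mul_le_mul_of_nonneg_left (by linarith) hθ
  linarith

end Partitions

/-! ### Finite uniform probability, independence and Chernoff bounds. -/

section Probability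

variable {Ω A B : Type} [Fintype Ω] [Fintype A] [Fintype B]

/-- The probability of an event under the uniform distribution on a finite type. -/
def pr (P : Ω → Prop) : ℝ := ((univ.filter P).card : ℝ) / Fintype.card Ω

/-- The expectation of a function under the uniform distribution on a finite type. -/
def expect (f : Ω → ℝ) : ℝ := (∑ ω, f ω) / Fintype.card Ω

theorem pr_nonneg (P : Ω → Prop) : 0 ≤ pr P := by unfold pr; positivity

theorem pr_eq_expect (P : Ω → Prop) : pr P = expect fun ω => if P ω then (1 : ℝ) else 0 := by
  simp [pr, expect]

theorem expect_mono {f g : Ω → ℝ} (h : ∀ ω, f ω ≤ g ω) : expect f ≤ expect g :=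
  div_le_div_of_nonneg_right (Finset.sum_le_sum fun ω _ => h ω) (Nat.cast_nonneg _)

theorem expect_const [Nonempty Ω] (c : ℝ) : expect (fun _ : Ω => c) = c := by
  have : (Fintype.card Ω : ℝ) ≠ 0 := by exact_mod_cast Fintype.card_ne_zero
  simp [expect, this]

theorem pr_mono {P Q : Ω → Prop} (h : ∀ ω, P ω → Q ω) : pr P ≤ pr Q := by
  unfold pr
  refine div_le_div_of_nonneg_right ?_ (Nat.cast_nonneg _)
  exact_mod_cast Finset.card_le_card (Finset.monotone_filter_right _ (fun ω _ => h ω))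

theorem pr_eq_zero {P : Ω → Prop} (h : ∀ ω, ¬ P ω) : pr P = 0 := by simp [pr, h]

theorem pr_or_le (P Q : Ω → Prop) : pr (fun ω => P ω ∨ Q ω) ≤ pr P + pr Q := by
  unfold pr
  rw [← add_div]
  refine div_le_div_of_nonneg_right ?_ (Nat.cast_nonneg _)
  refine le_trans (Nat.cast_le.2 (Finset.card_le_card (t := univ.filter P ∪ univ.filter Q) ?_))
    (by exact_mod_cast Finset.card_union_le _ _)
  intro ω
  simp

theorem pr_exists_le {ι : Type} (F : Finset ι) (P : ι → Ω → Prop) :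
    pr (fun ω => ∃ i ∈ F, P i ω) ≤ ∑ i ∈ F, pr (P i) := by
  induction F using Finset.induction_on with
  | empty => simp [pr]
  | insert a F ha ih =>
    rw [Finset.sum_insert ha]
    refine le_trans (pr_mono ?_) ((pr_or_le (P a) fun ω => ∃ i ∈ F, P i ω).trans
      (add_le_add_right ih _))
    rintro ω ⟨i, hi, hP⟩
    rcases Finset.mem_insert.1 hi with rfl | hi
    · exact Or.inl hP
    · exact Or.inr ⟨i, hi, hP⟩

theorem pr_add_pr_not [Nonempty Ω] (P : Ω → Prop) : pr P + pr (fun ω => ¬ P ω) = 1 := by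
  unfold pr
  rw [← add_div]
  have := Finset.card_filter_add_card_filter_not (s := (univ : Finset Ω)) P
  rw [div_eq_one_iff_eq (by exact_mod_cast Fintype.card_ne_zero)]
  rw [Finset.card_univ] at this
  rw [← this]
  push_cast
  congr!

theorem pr_le_expect {P : Ω → Prop} {f : Ω → ℝ} (hf : ∀ ω, 0 ≤ f ω) (h : ∀ ω, P ω → 1 ≤ f ω) :
    pr P ≤ expect f := by
  rw [pr_eq_expect]
  refine expect_mono fun ω => ?_
  split_ifs with hP
  · exact h ω hP
  · exact hf ω

theorem expect_prod (f : A × B → ℝ) : expect f = expect fun a => expect fun b => f (a, b) := by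
  simp only [expect, Fintype.card_prod, Fintype.sum_prod_type, Nat.cast_mul]
  rw [Finset.sum_div, Finset.sum_div]
  refine Finset.sum_congr rfl fun a _ => ?_
  rw [div_div, mul_comm]

theorem expect_equiv (e : A ≃ B) (f : B → ℝ) : expect (fun a => f (e a)) = expect f := by
  simp only [expect, Fintype.card_congr e, Equiv.sum_comp e f]

theorem expect_le_of_forall {f : Ω → ℝ} {c : ℝ} (hc : 0 ≤ c) (h : ∀ ω, f ω ≤ c) :
    expect f ≤ c := by
  rcases isEmpty_or_nonempty Ω with hΩ | hΩ
  · simpa [expect] using hc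
  · exact (expect_mono h).trans (expect_const c).le

theorem pr_prod_le {P : A × B → Prop} {δ : ℝ} (hδ : 0 ≤ δ)
    (h : ∀ a, pr (fun b => P (a, b)) ≤ δ) : pr P ≤ δ := by
  rw [pr_eq_expect, expect_prod]
  exact expect_le_of_forall hδ fun a => by rw [← pr_eq_expect]; exact h a

theorem pr_equiv (e : A ≃ B) (P : B → Prop) : pr (fun a => P (e a)) = pr P := by
  rw [pr_eq_expect, pr_eq_expect]
  exact expect_equiv e fun b => if P b then (1 : ℝ) else 0

theorem pr_prod_le' {P : A × B → Prop} {δ : ℝ} (hδ : 0 ≤ δ)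
    (h : ∀ b, pr (fun a => P (a, b)) ≤ δ) : pr P ≤ δ := by
  rw [← pr_equiv (Equiv.prodComm B A)]
  exact pr_prod_le hδ h

/-- Resampling one coordinate. -/
theorem pr_pi_le {ι α : Type} [Fintype ι] [DecidableEq ι] [Fintype α] (i : ι) {P : (ι → α) → Prop} {δ : ℝ}
    (hδ : 0 ≤ δ) (h : ∀ ω, pr (fun x => P (Function.update ω i x)) ≤ δ) : pr P ≤ δ := by
  rw [← pr_equiv (Equiv.funSplitAt i α).symm]
  refine pr_prod_le' hδ fun b => ?_
  rcases isEmpty_or_nonempty α with hα | hα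
  · simpa [pr] using hδ
  · refine le_trans (pr_mono fun x hx => ?_) (h ((Equiv.funSplitAt i α).symm (hα.some, b)))
    convert hx using 1
    funext j
    by_cases hj : j = i
    · subst hj; simp [Equiv.funSplitAt, Equiv.piSplitAt]
    · simp [Equiv.funSplitAt, Equiv.piSplitAt, hj]

theorem expect_pi_prod {ι : Type} {α : ι → Type} [Fintype ι] [DecidableEq ι] [∀ i, Fintype (α i)]
    (g : ∀ i, α i → ℝ) :
    expect (fun ω : ∀ i, α i => ∏ i, g i (ω i)) = ∏ i, expect (g i) := by
  simp only [expect]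
  rw [Finset.prod_div_distrib, Finset.prod_univ_sum, Fintype.card_pi, Nat.cast_prod,
    Fintype.piFinset_univ]

theorem pr_pi_forall {ι α : Type} [Fintype ι] [DecidableEq ι] [Fintype α] (P : α → Prop) :
    pr (fun ω : ι → α => ∀ i, P (ω i)) = pr P ^ Fintype.card ι := by
  rw [pr_eq_expect, pr_eq_expect]
  have := expect_pi_prod (ι := ι) (α := fun _ => α) (fun _ a => if P a then (1 : ℝ) else 0)
  rw [Finset.prod_const, Finset.card_univ] at this
  rw [← this]
  congr 1
  funext ω
  rw [Finset.prod_ite_zero]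
  simp

section Sampling

variable {ι α : Type} [Fintype ι] [DecidableEq ι] [Fintype α] [Nonempty α]

theorem expect_exp_sum_le (X : Finset ι) (g : ι → α → ℝ) (b : ι → ℝ)
    (h : ∀ i ∈ X, expect (fun a => Real.exp (g i a)) ≤ Real.exp (b i)) :
    expect (fun ω : ι → α => Real.exp (∑ i ∈ X, g i (ω i))) ≤ Real.exp (∑ i ∈ X, b i) := by
  have h1 : (fun ω : ι → α => Real.exp (∑ i ∈ X, g i (ω i))) =
      fun ω => ∏ i, (fun i a => if i ∈ X then Real.exp (g i a) else 1) i (ω i) := by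
    funext ω
    rw [Real.exp_sum, Finset.prod_ite_mem, Finset.univ_inter]
  rw [h1, Real.exp_sum]
  refine (expect_pi_prod (α := fun _ : ι => α)
    (fun i a => if i ∈ X then Real.exp (g i a) else 1)).trans_le ?_
  calc _ = ∏ i, (if i ∈ X then expect (fun a => Real.exp (g i a)) else 1) := by
        refine Finset.prod_congr rfl fun i _ => ?_
        split_ifs
        · rfl
        · exact expect_const 1
    _ = ∏ i ∈ X, expect (fun a => Real.exp (g i a)) := by
        rw [Finset.prod_ite_mem, Finset.univ_inter]
    _ ≤ _ := by
        refine Finset.prod_le_prod (fun i _ => ?_) h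
        exact div_nonneg (Finset.sum_nonneg fun _ _ => (Real.exp_pos _).le) (Nat.cast_nonneg _)

theorem expect_ite (S : α → Prop) (u v : ℝ) :
    expect (fun a => if S a then u else v) = v + pr S * (u - v) := by
  have hc : (Fintype.card α : ℝ) ≠ 0 := by exact_mod_cast Fintype.card_ne_zero
  have h1 : (fun a => if S a then u else v) = fun a => v + (if S a then (1:ℝ) else 0) * (u - v) := by
    funext a; split_ifs <;> ring
  rw [h1]
  simp only [expect, pr, Finset.sum_add_distrib, ← Finset.sum_mul, Finset.sum_const,
    Finset.card_univ, nsmul_eq_mul, Finset.sum_boole]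
  field_simp

/-- The Chernoff bound for the number of sampled elements of `X`, for both tails: `y` may be
negative. -/
theorem pr_count_le (S : α → Prop) (X : Finset ι) (y a : ℝ) :
    pr (fun ω : ι → α => y * a ≤ y * ((X.filter fun i => S (ω i)).card : ℝ)) ≤
      Real.exp (pr S * X.card * (Real.exp y - 1) - y * a) := by
  have h1 := expect_exp_sum_le X (fun _ a => if S a then y else 0)
    (fun _ : ι => pr S * (Real.exp y - 1)) (by
      intro i _
      have : (fun a => Real.exp (if S a then y else 0)) =
          fun a => if S a then Real.exp y else 1 := by
        funext a; split_ifs <;> simp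
      rw [this, expect_ite]
      have := Real.add_one_le_exp (pr S * (Real.exp y - 1))
      linarith)
  refine (pr_le_expect (f := fun ω : ι → α =>
    Real.exp (-(y * a)) * Real.exp (∑ i ∈ X, if S (ω i) then y else 0))
    (fun ω => by positivity) ?_).trans ?_
  · intro ω hω
    rw [← Real.exp_add]
    refine Real.one_le_exp ?_
    rw [← Finset.sum_filter, Finset.sum_const, nsmul_eq_mul]
    linarith
  · have h2 : expect (fun ω : ι → α =>
        Real.exp (-(y * a)) * Real.exp (∑ i ∈ X, if S (ω i) then y else 0)) =
        Real.exp (-(y * a)) * expect (fun ω : ι → α =>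
          Real.exp (∑ i ∈ X, if S (ω i) then y else 0)) := by
      simp only [expect, ← Finset.mul_sum, mul_div_assoc]
    rw [h2]
    refine (mul_le_mul_of_nonneg_left h1 (Real.exp_pos _).le).trans ?_
    rw [← Real.exp_add, Finset.sum_const, nsmul_eq_mul]
    refine Real.exp_le_exp.2 (le_of_eq ?_)
    ring

end Sampling

end Probability

/-! ### Union bounds over coarsenings, and densities of a random sample. -/

section Rounds

variable {V Ω α : Type} [Fintype V] [Nonempty V] [Fintype Ω] [Fintype α] [Nonempty α]

/-- At most e^(2Lk) coarsenings lose exactly k classes, so they contribute at most e^((2L-β)k) ≤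
e^(-A); there are at most |V| values of k. -/
theorem sum_coarsenings_le (s : Setoid V) {L A β : ℝ} (hL : (Fintype.card V : ℝ) ≤ Real.exp L)
    (hA : 0 ≤ A) (hβ : 2 * L + A ≤ β) :
    ∑ t ∈ univ.filter (fun t => s < t),
      Real.exp (-β * ((numClasses s : ℝ) - numClasses t)) ≤ Fintype.card V * Real.exp (-A) := by
  have hmaps : ∀ t ∈ univ.filter (fun t => s < t),
      numClasses s - numClasses t ∈ Finset.Icc 1 (Fintype.card V) := by
    intro t ht
    have h1 := numClasses_lt (Finset.mem_filter.1 ht).2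
    have h2 := numClasses_le_card s
    rw [Finset.mem_Icc]; omega
  rw [← Finset.sum_fiberwise_of_maps_to hmaps]
  have hk : ∀ k ∈ Finset.Icc 1 (Fintype.card V),
      ∑ t ∈ (univ.filter (fun t => s < t)).filter (fun t => numClasses s - numClasses t = k),
        Real.exp (-β * ((numClasses s : ℝ) - numClasses t)) ≤ Real.exp (-A) := by
    intro k hk
    have hk1 : (1 : ℝ) ≤ k := by exact_mod_cast (Finset.mem_Icc.1 hk).1
    have hval : ∀ t ∈ (univ.filter (fun t => s < t)).filter
        (fun t => numClasses s - numClasses t = k),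
        Real.exp (-β * ((numClasses s : ℝ) - numClasses t)) = Real.exp (-β * k) := by
      intro t ht
      obtain ⟨ht1, ht2⟩ := Finset.mem_filter.1 ht
      have := numClasses_lt (Finset.mem_filter.1 ht1).2
      rw [← ht2, Nat.cast_sub this.le]
    rw [Finset.sum_congr rfl hval, Finset.sum_const, nsmul_eq_mul]
    have hcard := card_coarsenings_le s k ((univ.filter (fun t => s < t)).filter
        (fun t => numClasses s - numClasses t = k)) (by
      intro t ht
      obtain ⟨ht1, ht2⟩ := Finset.mem_filter.1 ht
      have := (Finset.mem_filter.1 ht1).2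
      exact ⟨this.le, by omega⟩)
    calc _ ≤ ((Fintype.card V : ℝ) ^ (2 * k)) * Real.exp (-β * k) := by
          refine mul_le_mul_of_nonneg_right ?_ (Real.exp_pos _).le
          exact_mod_cast hcard
      _ ≤ (Real.exp L) ^ (2 * k) * Real.exp (-β * k) := by gcongr
      _ = Real.exp ((2 * L - β) * k) := by
          rw [← Real.exp_nat_mul, ← Real.exp_add]
          congr 1; push_cast; ring
      _ ≤ Real.exp (-A) := by
          refine Real.exp_le_exp.2 ?_
          nlinarith
  calc _ ≤ ∑ k ∈ Finset.Icc 1 (Fintype.card V), Real.exp (-A) := Finset.sum_le_sum hk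
    _ = _ := by simp

theorem pr_exists_coarsening_le (s : Setoid V) {L A β : ℝ}
    (hL : (Fintype.card V : ℝ) ≤ Real.exp L) (hA : 0 ≤ A) (hβ : 2 * L + A ≤ β)
    (P : Setoid V → Ω → Prop)
    (hP : ∀ t, s < t → pr (P t) ≤ Real.exp (-β * ((numClasses s : ℝ) - numClasses t))) :
    pr (fun ω => ∃ t, s < t ∧ P t ω) ≤ Fintype.card V * Real.exp (-A) := by
  refine le_trans (pr_mono ?_) ((pr_exists_le (univ.filter (fun t => s < t)) P).trans
    (le_trans (Finset.sum_le_sum fun t ht => hP t (Finset.mem_filter.1 ht).2)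
      (sum_coarsenings_le s hL hA hβ)))
  rintro ω ⟨t, ht, h⟩
  exact ⟨t, by simpa using ht, h⟩

/-- The edges of `E` whose seed satisfies `S`. -/
def sample (E : Finset (Finset V)) (S : α → Prop) (ω : Finset V → α) : Finset (Finset V) :=
  E.filter fun e => S (ω e)

theorem between_sample (E : Finset (Finset V)) (S : α → Prop) (ω : Finset V → α) (s t : Setoid V) :
    between (sample E S ω) s t = (between E s t).filter fun e => S (ω e) := by
  simp only [between, sample, Finset.filter_filter]
  congr 1; funext e; apply propext; tauto

/-- The upper Chernoff tail with parameter y is applied to every coarsening of s; the last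
hypothesis says that its exponent is at most -β per merged class. -/
theorem pr_not_strictSparseOn_sample_le (E : Finset (Finset V)) (S : α → Prop) (s : Setoid V)
    {L A β lam θ y : ℝ} (hL : (Fintype.card V : ℝ) ≤ Real.exp L) (hA : 0 ≤ A)
    (hβ : 2 * L + A ≤ β) (hs : SparseOn E lam s) (hy : 0 ≤ y)
    (h : pr S * lam * (Real.exp y - 1) - y * θ ≤ -β) :
    pr (fun ω => ¬ StrictSparseOn (sample E S ω) θ s) ≤ Fintype.card V * Real.exp (-A) := by
  refine le_trans (pr_mono ?_) (pr_exists_coarsening_le s hL hA hβ (fun t ω =>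
    y * (θ * ((numClasses s : ℝ) - numClasses t)) ≤
      y * (((between E s t).filter fun e => S (ω e)).card : ℝ)) ?_)
  · intro ω hω
    simp only [StrictSparseOn, not_forall, not_lt] at hω
    obtain ⟨t, ht, hle⟩ := hω
    rw [between_sample] at hle
    exact ⟨t, ht, mul_le_mul_of_nonneg_left hle hy⟩
  · intro t ht
    refine (pr_count_le S (between E s t) y _).trans (Real.exp_le_exp.2 ?_)
    have hv : (0 : ℝ) ≤ (numClasses s : ℝ) - numClasses t := by
      have := (numClasses_lt ht).le
      rw [sub_nonneg]; exact_mod_cast this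
    have h1 := hs t ht.le
    have h2 : 0 ≤ Real.exp y - 1 := by linarith [Real.one_le_exp hy]
    have h3 : pr S * (between E s t).card * (Real.exp y - 1) ≤
        pr S * (lam * ((numClasses s : ℝ) - numClasses t)) * (Real.exp y - 1) :=
      mul_le_mul_of_nonneg_right (mul_le_mul_of_nonneg_left h1 (pr_nonneg S)) h2
    nlinarith

/-- A fixed pair of partitions: with high probability, no interval of partitions between them that
makes up more than half of the merges and has density `lam` in `E` has density at most `θ` in the
sample. -/
theorem pr_exists_interval_le (E : Finset (Finset V)) (S : α → Prop) {s u : Setoid V}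
    (hsu : s ≤ u) {L A β lam θ y : ℝ} (hL : (Fintype.card V : ℝ) ≤ Real.exp L) (hA : 0 ≤ A)
    (hβ : 8 * L + 2 * A ≤ β) (hy : 0 ≤ y)
    (h : y * θ - pr S * lam * (1 - Real.exp (-y)) ≤ -β) :
    pr (fun ω => ∃ p : Setoid V × Setoid V, (s ≤ p.1 ∧ p.1 ≤ p.2 ∧ p.2 ≤ u) ∧
      numClasses s + 2 * numClasses p.2 < numClasses u + 2 * numClasses p.1 ∧
      lam * ((numClasses p.1 : ℝ) - numClasses p.2) ≤ (between E p.1 p.2).card ∧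
      ((between (sample E S ω) p.1 p.2).card : ℝ) ≤
        θ * ((numClasses p.1 : ℝ) - numClasses p.2)) ≤ Real.exp (-A) := by
  set F : Finset (Setoid V × Setoid V) := univ.filter fun p => (s ≤ p.1 ∧ p.1 ≤ p.2 ∧ p.2 ≤ u) ∧
      numClasses s + 2 * numClasses p.2 < numClasses u + 2 * numClasses p.1 ∧
      lam * ((numClasses p.1 : ℝ) - numClasses p.2) ≤ (between E p.1 p.2).card with hF
  set v := numClasses s - numClasses u with hv
  have hcu := numClasses_anti hsu
  have hL0 : 0 ≤ L := by
    rw [← Real.one_le_exp_iff]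
    refine le_trans ?_ hL
    exact_mod_cast Fintype.card_pos
  have hFcard : (F.card : ℝ) ≤ Real.exp (4 * L * v) := by
    have := card_intervals_le hsu F (fun p hp => (Finset.mem_filter.1 hp).2.1)
    calc (F.card : ℝ) ≤ (Fintype.card V : ℝ) ^ (4 * v) := by exact_mod_cast this
      _ ≤ Real.exp L ^ (4 * v) := by gcongr
      _ = _ := by rw [← Real.exp_nat_mul]; congr 1; push_cast; ring
  have hp : ∀ p ∈ F, pr (fun ω => ((between (sample E S ω) p.1 p.2).card : ℝ) ≤
        θ * ((numClasses p.1 : ℝ) - numClasses p.2)) ≤ Real.exp (-(β / 2) * v) := by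
    intro p hp
    obtain ⟨⟨h1, h2, h3⟩, h4, h5⟩ := (Finset.mem_filter.1 hp).2
    refine le_trans (pr_mono ?_) ((pr_count_le S (between E p.1 p.2) (-y)
      (θ * ((numClasses p.1 : ℝ) - numClasses p.2))).trans (Real.exp_le_exp.2 ?_))
    · intro ω hω
      rw [between_sample] at hω
      nlinarith
    · have hc : (0 : ℝ) ≤ (numClasses p.1 : ℝ) - numClasses p.2 := by
        have := numClasses_anti h2
        rw [sub_nonneg]; exact_mod_cast this
      -- Here "more than half of the merges" is used: a failure probability exponential in v, rather
      -- than in the length of the interval, is needed against up to |V|^(4v) intervals.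
      have hv2 : (v : ℝ) ≤ 2 * ((numClasses p.1 : ℝ) - numClasses p.2) := by
        have h4' : ((numClasses s : ℝ) + 2 * numClasses p.2) ≤ numClasses u + 2 * numClasses p.1 := by
          exact_mod_cast h4.le
        rw [hv, Nat.cast_sub hcu]; linarith
      have he : 0 ≤ 1 - Real.exp (-y) := by
        have : Real.exp (-y) ≤ 1 := Real.exp_le_one_iff.2 (by linarith)
        linarith
      have h6 : pr S * (lam * ((numClasses p.1 : ℝ) - numClasses p.2)) * (1 - Real.exp (-y)) ≤
          pr S * (between E p.1 p.2).card * (1 - Real.exp (-y)) :=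
        mul_le_mul_of_nonneg_right (mul_le_mul_of_nonneg_left h5 (pr_nonneg S)) he
      have hβ0 : 0 ≤ β := by linarith
      nlinarith
  rcases F.eq_empty_or_nonempty with hFe | ⟨p, hpF⟩
  · refine le_trans (le_of_eq (pr_eq_zero ?_)) (Real.exp_pos _).le
    rintro ω ⟨p, h1, h2, h3, -⟩
    have : p ∈ F := Finset.mem_filter.2 ⟨Finset.mem_univ _, h1, h2, h3⟩
    rw [hFe] at this
    simp at this
  have hv1 : (1 : ℝ) ≤ v := by
    obtain ⟨⟨h1, h2, h3⟩, h4, -⟩ := (Finset.mem_filter.1 hpF).2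
    have := numClasses_anti h1
    have := numClasses_anti h2
    have := numClasses_anti h3
    have : 1 ≤ v := by omega
    exact_mod_cast this
  calc _ ≤ pr (fun ω => ∃ p ∈ F, ((between (sample E S ω) p.1 p.2).card : ℝ) ≤
        θ * ((numClasses p.1 : ℝ) - numClasses p.2)) := by
        refine pr_mono ?_
        rintro ω ⟨p, h1, h2, h3, h4⟩
        exact ⟨p, Finset.mem_filter.2 ⟨Finset.mem_univ _, h1, h2, h3⟩, h4⟩
    _ ≤ ∑ p ∈ F, Real.exp (-(β / 2) * v) := (pr_exists_le F _).trans (Finset.sum_le_sum hp)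
    _ = F.card * Real.exp (-(β / 2) * v) := by rw [Finset.sum_const, nsmul_eq_mul]
    _ ≤ Real.exp (4 * L * v) * Real.exp (-(β / 2) * v) := by gcongr
    _ = Real.exp (-(β / 2 - 4 * L) * v) := by rw [← Real.exp_add]; congr 1; ring
    _ ≤ Real.exp (-A) := Real.exp_le_exp.2 (by nlinarith)

end Rounds

/-! ### Counting weighted cuts by random contraction. -/

section CutCounting

variable {V : Type} [Fintype V] [Nonempty V]

/-- The edge sets of the form "edges of `G` crossing `t`", for `t` a coarsening of `s`. -/
def cutFamily (G : Finset (Finset V)) (s : Setoid V) : Finset (Finset (Finset V)) :=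
  (univ.filter fun t => s ≤ t).image fun t => cutEdges G t

/-- No edge of G crosses m, so t and t ⊓ m cut the same edges, and only coarsenings of s below m
need counting. -/
theorem card_cutFamily_le (G : Finset (Finset V)) {s m : Setoid V} (hsm : s ≤ m)
    (hG : ∀ e ∈ G, ¬ Cuts m e) :
    (cutFamily G s).card ≤ Fintype.card V ^ (2 * (numClasses s - numClasses m)) := by
  set F : Finset (Setoid V) := univ.filter fun t => s ≤ t ∧ t ≤ m
  have hsub : cutFamily G s ⊆ F.image fun t => cutEdges G t := by
    intro Y hY
    obtain ⟨t, ht, rfl⟩ := Finset.mem_image.1 hY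
    refine Finset.mem_image.2 ⟨t ⊓ m, ?_, ?_⟩
    · have : s ≤ t := by simpa using ht
      simp [F, this, hsm]
    · simp only [cutEdges]
      refine Finset.filter_congr fun e he => ?_
      rw [cuts_inf]
      have := hG e he
      tauto
  refine (Finset.card_le_card hsub).trans (Finset.card_image_le.trans
    (card_coarsenings_le s _ F fun t ht => ?_))
  obtain ⟨h1, h2⟩ := (Finset.mem_filter.1 ht).2
  have := numClasses_anti h2
  exact ⟨h1, by omega⟩

theorem one_sub_ge_exp {x : ℝ} (h0 : 0 ≤ x) (h1 : x ≤ 1 / 2) : Real.exp (-(2 * x)) ≤ 1 - x := by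
  have h := Real.add_one_le_exp (2 * x)
  have hp := Real.exp_pos (-(2 * x))
  have hm : Real.exp (-(2 * x)) * Real.exp (2 * x) = 1 := by rw [← Real.exp_add]; simp
  nlinarith [mul_le_mul_of_nonneg_left h hp.le]

/-- Partial sums of the harmonic series. -/
def harm (t : ℕ) : ℝ := ∑ i ∈ range t, 1 / ((i : ℝ) + 1)

theorem harm_mono {a b : ℕ} (h : a ≤ b) : harm a ≤ harm b :=
  Finset.sum_le_sum_of_subset_of_nonneg (Finset.range_mono h) fun i _ _ => by positivity

theorem harm_nonneg (t : ℕ) : 0 ≤ harm t := Finset.sum_nonneg fun i _ => by positivity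

theorem harm_le_one_add_log (t : ℕ) : harm t ≤ 1 + Real.log t := by
  have := harmonic_le_one_add_log t
  refine le_trans (le_of_eq ?_) this
  simp [harm, harmonic]

/-- The generating function of the weighted cut sizes, by contracting random edges. -/
theorem sum_cutFamily_le (G : Finset (Finset V)) (μ : Finset V → ℝ) (m : Setoid V)
    {L A β : ℝ} (hL : (Fintype.card V : ℝ) ≤ Real.exp L) (hA : 0 ≤ A) (hβ : 4 * L + 2 * A ≤ β)
    (hμ0 : ∀ e ∈ G, 0 ≤ μ e) (hG : ∀ e ∈ G, ¬ Cuts m e)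
    (hμ : ∀ z, z ≤ m → (numClasses z : ℝ) - numClasses m ≤ ∑ e ∈ cutEdges G z, μ e)
    (t : ℕ) : ∀ z, z ≤ m → numClasses z = numClasses m + t →
    ∑ Y ∈ cutFamily G z, Real.exp (-(β + 2 * harm t) * ∑ e ∈ Y, μ e) ≤
      1 + t * Real.exp (-A) := by
  have hL0 : 0 ≤ L := by
    rw [← Real.one_le_exp_iff]
    refine le_trans ?_ hL
    exact_mod_cast Fintype.card_pos
  induction t using Nat.strong_induction_on with
  | _ t ih =>
  intro z hz ht
  have hsubG : ∀ z, ∀ Y ∈ cutFamily G z, Y ⊆ cutEdges G z := by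
    intro z Y hY
    obtain ⟨t, ht, rfl⟩ := Finset.mem_image.1 hY
    intro e he
    simp only [cutEdges, Finset.mem_filter, Finset.mem_univ, true_and] at he ht ⊢
    exact ⟨he.1, he.2.mono ht⟩
  have hnn : ∀ z, ∀ Y ∈ cutFamily G z, 0 ≤ ∑ e ∈ Y, μ e := fun z Y hY =>
    Finset.sum_nonneg fun e he => hμ0 e (Finset.mem_filter.1 (hsubG z Y hY he)).1
  rcases Nat.eq_zero_or_pos t with rfl | htpos
  · have hzm : z = m := eq_of_numClasses_le hz (by omega)
    subst hzm
    have hcut : cutEdges G z = ∅ := Finset.filter_eq_empty_iff.2 hG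
    have : cutFamily G z ⊆ {∅} := by
      intro Y hY
      have := hsubG z Y hY
      rw [hcut] at this
      simpa using this
    calc _ ≤ ∑ Y ∈ ({∅} : Finset (Finset (Finset V))),
          Real.exp (-(β + 2 * harm 0) * ∑ e ∈ Y, μ e) :=
          Finset.sum_le_sum_of_subset_of_nonneg this fun _ _ _ => (Real.exp_pos _).le
      _ ≤ _ := by simp
  obtain ⟨k, rfl⟩ : ∃ k, t = k + 1 := ⟨t - 1, by omega⟩
  set W := ∑ e ∈ cutEdges G z, μ e with hW
  set b := β + 2 * harm k with hb
  have hWt : ((k + 1 : ℕ) : ℝ) ≤ W := by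
    have := hμ z hz
    rw [ht] at this
    push_cast at this ⊢
    linarith
  have hk0 : (0 : ℝ) < ((k + 1 : ℕ) : ℝ) := by positivity
  have hW0 : 0 < W := hk0.trans_le hWt
  have hbt : β + 2 * harm (k + 1) = b + 2 / ((k + 1 : ℕ) : ℝ) := by
    rw [hb, harm, Finset.sum_range_succ, ← harm]; push_cast; ring
  -- A cut of weight x ≤ (k+1)/2 is avoided by a μ-random edge with probability at least 1 - x/(k+1)
  -- ≥ e^(-2x/(k+1)), which is exactly the harmonic increment in the exponent. Heavier cuts are
  -- bounded by the second, crude term.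
  have hterm : ∀ Y ∈ cutFamily G z, Real.exp (-(β + 2 * harm (k + 1)) * ∑ e ∈ Y, μ e) ≤
      (∑ e ∈ (cutEdges G z).filter (fun e => e ∉ Y), μ e * Real.exp (-b * ∑ e ∈ Y, μ e)) / W +
        Real.exp (-b * (((k + 1 : ℕ) : ℝ) / 2)) := by
    intro Y hY
    set x := ∑ e ∈ Y, μ e with hx
    have hx0 : 0 ≤ x := hnn z Y hY
    have hsplit : x + ∑ e ∈ (cutEdges G z).filter (fun e => e ∉ Y), μ e = W := by
      rw [hW, ← Finset.sum_filter_add_sum_filter_not (cutEdges G z) (fun e => e ∈ Y)]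
      congr 1
      rw [Finset.filter_mem_eq_inter, Finset.inter_eq_right.2 (hsubG z Y hY)]
    have hsum0 : 0 ≤ ∑ e ∈ (cutEdges G z).filter (fun e => e ∉ Y), μ e :=
      Finset.sum_nonneg fun e he => hμ0 e (Finset.mem_filter.1 (Finset.mem_filter.1 he).1).1
    rw [← Finset.sum_mul, hbt]
    by_cases hxs : x ≤ ((k + 1 : ℕ) : ℝ) / 2
    · have h1 := one_sub_ge_exp (x := x / ((k + 1 : ℕ) : ℝ)) (by positivity)
        (by rw [div_le_iff₀ hk0]; linarith)
      have h2 : 1 - x / ((k + 1 : ℕ) : ℝ) ≤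
          (∑ e ∈ (cutEdges G z).filter (fun e => e ∉ Y), μ e) / W := by
        rw [← hsplit, le_div_iff₀ (by linarith), hsplit]
        have : x / ((k + 1 : ℕ) : ℝ) * W ≥ x := by
          rw [ge_iff_le, div_mul_eq_mul_div, le_div_iff₀ hk0]
          exact mul_le_mul_of_nonneg_left hWt hx0
        linarith
      have h3 : Real.exp (-(b + 2 / ((k + 1 : ℕ) : ℝ)) * x) =
          Real.exp (-(2 * (x / ((k + 1 : ℕ) : ℝ)))) * Real.exp (-b * x) := by
        rw [← Real.exp_add]; congr 1; ring
      rw [h3, mul_div_right_comm]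
      have := mul_le_mul_of_nonneg_right (h1.trans h2) (Real.exp_pos (-b * x)).le
      linarith [Real.exp_pos (-b * (((k + 1 : ℕ) : ℝ) / 2))]
    · push Not at hxs
      have hb0 : 0 ≤ b := by have := harm_nonneg k; linarith
      have h1 : Real.exp (-(b + 2 / ((k + 1 : ℕ) : ℝ)) * x) ≤
          Real.exp (-b * (((k + 1 : ℕ) : ℝ) / 2)) := by
        refine Real.exp_le_exp.2 ?_
        have h2 : 0 ≤ 2 / ((k + 1 : ℕ) : ℝ) * x := by positivity
        nlinarith
      have h2 : 0 ≤ (∑ e ∈ (cutEdges G z).filter (fun e => e ∉ Y), μ e) *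
          Real.exp (-b * x) / W := by positivity
      linarith
  refine (Finset.sum_le_sum hterm).trans ?_
  rw [Finset.sum_add_distrib, ← Finset.sum_div]
  have hfirst : ∑ Y ∈ cutFamily G z, ∑ e ∈ (cutEdges G z).filter (fun e => e ∉ Y),
      μ e * Real.exp (-b * ∑ e ∈ Y, μ e) ≤ W * (1 + k * Real.exp (-A)) := by
    -- After the exchange, the cuts avoiding e are cuts of the contraction z ⊔ `contract e`. A
    -- hyperedge may remove several classes at once, hence the strong induction.
    have hswap : ∑ Y ∈ cutFamily G z, ∑ e ∈ (cutEdges G z).filter (fun e => e ∉ Y),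
        μ e * Real.exp (-b * ∑ e ∈ Y, μ e) = ∑ e ∈ cutEdges G z, μ e *
          ∑ Y ∈ (cutFamily G z).filter (fun Y => e ∉ Y), Real.exp (-b * ∑ e ∈ Y, μ e) := by
      simp only [Finset.sum_filter, Finset.mul_sum]
      rw [Finset.sum_comm]
      refine Finset.sum_congr rfl fun e _ => Finset.sum_congr rfl fun Y _ => ?_
      split_ifs <;> simp
    rw [hswap, hW, Finset.sum_mul]
    refine Finset.sum_le_sum fun e he => mul_le_mul_of_nonneg_left ?_
      (hμ0 e (Finset.mem_filter.1 he).1)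
    obtain ⟨heG, hez⟩ := Finset.mem_filter.1 he
    set z' := z ⊔ contract e with hz'
    have hz'm : z' ≤ m := sup_le hz (not_not.1 (hG e heG))
    have hlt : z < z' := by
      refine lt_of_le_of_ne le_sup_left fun heq => hez ?_
      rw [heq]; exact le_sup_right
    have hlt' := numClasses_lt hlt
    have hanti := numClasses_anti hz'm
    obtain ⟨t', ht'⟩ : ∃ t', numClasses z' = numClasses m + t' :=
      ⟨numClasses z' - numClasses m, by omega⟩
    have ht'k : t' ≤ k := by omega
    have hsub : (cutFamily G z).filter (fun Y => e ∉ Y) ⊆ cutFamily G z' := by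
      intro Y hY
      obtain ⟨hY, heY⟩ := Finset.mem_filter.1 hY
      obtain ⟨s, hs, rfl⟩ := Finset.mem_image.1 hY
      refine Finset.mem_image.2 ⟨s, ?_, rfl⟩
      have hzs : z ≤ s := by simpa using hs
      have : contract e ≤ s := by
        by_contra hcon
        exact heY (Finset.mem_filter.2 ⟨heG, hcon⟩)
      simpa [hz'] using ⟨hzs, this⟩
    calc _ ≤ ∑ Y ∈ cutFamily G z', Real.exp (-b * ∑ e ∈ Y, μ e) :=
          Finset.sum_le_sum_of_subset_of_nonneg hsub fun _ _ _ => (Real.exp_pos _).le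
      _ ≤ ∑ Y ∈ cutFamily G z', Real.exp (-(β + 2 * harm t') * ∑ e ∈ Y, μ e) := by
          refine Finset.sum_le_sum fun Y hY => Real.exp_le_exp.2 ?_
          have := hnn z' Y hY
          have := harm_mono ht'k
          rw [hb]
          nlinarith
      _ ≤ 1 + t' * Real.exp (-A) := ih t' (by omega) z' hz'm ht'
      _ ≤ 1 + k * Real.exp (-A) := by gcongr
  have hsecond : ∑ Y ∈ cutFamily G z, Real.exp (-b * (((k + 1 : ℕ) : ℝ) / 2)) ≤
      Real.exp (-A) := by
    rw [Finset.sum_const, nsmul_eq_mul]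
    have hcard := card_cutFamily_le G hz hG
    rw [show numClasses z - numClasses m = k + 1 by omega] at hcard
    calc _ ≤ ((Fintype.card V : ℝ) ^ (2 * (k + 1))) * Real.exp (-b * (((k + 1 : ℕ) : ℝ) / 2)) := by
          gcongr
          exact_mod_cast hcard
      _ ≤ (Real.exp L) ^ (2 * (k + 1)) * Real.exp (-b * (((k + 1 : ℕ) : ℝ) / 2)) := by gcongr
      _ = Real.exp ((2 * L - b / 2) * ((k + 1 : ℕ) : ℝ)) := by
          rw [← Real.exp_nat_mul, ← Real.exp_add]
          congr 1; push_cast; ring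
      _ ≤ Real.exp (-A) := by
          refine Real.exp_le_exp.2 ?_
          have h1 : (1 : ℝ) ≤ ((k + 1 : ℕ) : ℝ) := by exact_mod_cast Nat.succ_le_succ (Nat.zero_le k)
          have := harm_nonneg k
          have h2 : 2 * L - b / 2 ≤ -A := by rw [hb]; linarith
          nlinarith
  calc _ ≤ W * (1 + k * Real.exp (-A)) / W + Real.exp (-A) :=
        add_le_add (div_le_div_of_nonneg_right hfirst hW0.le) hsecond
    _ = _ := by rw [mul_div_cancel_left₀ _ hW0.ne']; push_cast; ring

/-- The leading 1 of the generating function is the term of the empty cut; removing it leaves the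
error. The harmonic sum is at most 1 + L, which accounts for the extra 2L + 2 in the condition on β.
-/
theorem sum_nonempty_cuts_le (G : Finset (Finset V)) (μ : Finset V → ℝ) (m : Setoid V)
    {L A β : ℝ} (hL : (Fintype.card V : ℝ) ≤ Real.exp L) (hA : 0 ≤ A)
    (hβ : 6 * L + 2 * A + 2 ≤ β)
    (hμ0 : ∀ e ∈ G, 0 ≤ μ e) (hG : ∀ e ∈ G, ¬ Cuts m e)
    (hμ : ∀ z, z ≤ m → (numClasses z : ℝ) - numClasses m ≤ ∑ e ∈ cutEdges G z, μ e) :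
    ∑ Y ∈ (cutFamily G ⊥).erase ∅, Real.exp (-β * ∑ e ∈ Y, μ e) ≤
      Fintype.card V * Real.exp (-A) := by
  have hanti := numClasses_anti (bot_le : ⊥ ≤ m)
  rw [numClasses_bot] at hanti
  set t := Fintype.card V - numClasses m with ht
  have h1 := sum_cutFamily_le G μ m hL hA le_rfl hμ0 hG hμ t ⊥ bot_le
    (by rw [numClasses_bot]; omega)
  have hV : (0 : ℝ) < Fintype.card V := by exact_mod_cast Fintype.card_pos
  have hharm : 4 * L + 2 * A + 2 * harm t ≤ β := by
    have h2 : harm t ≤ harm (Fintype.card V) := harm_mono (by omega)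
    have h3 := harm_le_one_add_log (Fintype.card V)
    have h4 : Real.log (Fintype.card V) ≤ L := by
      rw [Real.log_le_iff_le_exp hV]; exact hL
    linarith
  have hempty : ∅ ∈ cutFamily G ⊥ := by
    refine Finset.mem_image.2 ⟨m, by simp, ?_⟩
    exact Finset.filter_eq_empty_iff.2 hG
  have hnn : ∀ Y ∈ cutFamily G ⊥, 0 ≤ ∑ e ∈ Y, μ e := by
    intro Y hY
    obtain ⟨s, -, rfl⟩ := Finset.mem_image.1 hY
    exact Finset.sum_nonneg fun e he => hμ0 e (Finset.mem_filter.1 he).1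
  have h2 : ∑ Y ∈ cutFamily G ⊥, Real.exp (-β * ∑ e ∈ Y, μ e) ≤ 1 + t * Real.exp (-A) := by
    refine le_trans (Finset.sum_le_sum fun Y hY => Real.exp_le_exp.2 ?_) h1
    have := hnn Y hY
    nlinarith
  rw [← Finset.add_sum_erase _ _ hempty] at h2
  simp only [Finset.sum_empty, mul_zero, Real.exp_zero] at h2
  have h3 : (t : ℝ) * Real.exp (-A) ≤ Fintype.card V * Real.exp (-A) := by
    gcongr
    omega
  linarith

end CutCounting

/-! ### Strong components at geometrically decreasing strengths. -/

section Strength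

variable {V : Type} [Fintype V] [Nonempty V]

/-- The partitions into strong components of `E`, for geometrically decreasing strengths. -/
def strongChain (c : ℝ) (E : Finset (Finset V)) (t : ℕ) : Setoid V :=
  strongPartition (c / 2 ^ t) E ⊥

theorem strongChain_mono {c : ℝ} (hc : 0 < c) (E : Finset (Finset V)) :
    Monotone (strongChain c E) := by
  refine monotone_nat_of_le_succ fun t => ?_
  refine (strongOver_strongPartition (c / 2 ^ t) E ⊥).le_of_strictSparse (by positivity) bot_le
    ((sparseOn_strongPartition _ E ⊥).strict ?_)
  rw [pow_succ]
  exact div_lt_div_of_pos_left hc (by positivity)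
    (by have : (0 : ℝ) < 2 ^ t := by positivity
        linarith)

/-- The first level at which `e` is contained in a strong component. -/
def strongLevel (c : ℝ) (E : Finset (Finset V)) (e : Finset V) : ℕ :=
  sInf {t | ¬ Cuts (strongChain c E t) e}

theorem strongLevel_le {c : ℝ} {E : Finset (Finset V)} {e : Finset V} {t : ℕ}
    (h : ¬ Cuts (strongChain c E t) e) : strongLevel c E e ≤ t := Nat.sInf_le h

theorem not_cuts_strongLevel {c : ℝ} {E : Finset (Finset V)} {e : Finset V} {t : ℕ}
    (h : ¬ Cuts (strongChain c E t) e) : ¬ Cuts (strongChain c E (strongLevel c E e)) e :=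
  Nat.sInf_mem (s := {t | ¬ Cuts (strongChain c E t) e}) ⟨t, h⟩

/-- The edges contained in a component of strength `c / 2 ^ t`. -/
def strongEdges (c : ℝ) (E : Finset (Finset V)) (t : ℕ) : Finset (Finset V) :=
  E.filter fun e => ¬ Cuts (strongChain c E t) e

/-- The inverse strength of an edge. -/
def invStrength (c : ℝ) (E : Finset (Finset V)) (e : Finset V) : ℝ := 2 ^ strongLevel c E e / c

/-- Supermodularity splits the merging of z at level t + 1 into a part from z ⊓ m to m, handled by
induction, and a part from z ⊔ m to m'. The edges of the latter first become strong at this level,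
so each has inverse strength 2^(t+1)/c and strength of m' provides enough of them. The two edge sets
are disjoint. -/
theorem numClasses_sub_le_sum_invStrength {c : ℝ} (hc : 0 < c) (E : Finset (Finset V)) (t : ℕ) :
    ∀ z, z ≤ strongChain c E t → (numClasses z : ℝ) - numClasses (strongChain c E t) ≤
      ∑ e ∈ cutEdges (strongEdges c E t) z, invStrength c E e := by
  have hbetween : ∀ t z, z ≤ strongChain c E t →
      (numClasses z : ℝ) - numClasses (strongChain c E t) ≤
        (between E z (strongChain c E t)).card * (2 ^ t / c) := by
    intro t z hz
    have h := (strongOver_strongPartition (c / 2 ^ t) E ⊥).2 z bot_le hz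
    have h2 : (c / 2 ^ t) * (2 ^ t / c) = 1 := by field_simp
    have h3 : (0 : ℝ) ≤ 2 ^ t / c := by positivity
    have h4 := mul_le_mul_of_nonneg_right h h3
    rw [mul_right_comm, h2, one_mul] at h4
    exact h4
  induction t with
  | zero =>
    intro z hz
    refine (hbetween 0 z hz).trans ?_
    rw [← nsmul_eq_mul, ← Finset.sum_const]
    have hset : between E z (strongChain c E 0) = cutEdges (strongEdges c E 0) z := by
      ext e
      simp only [between, cutEdges, strongEdges, Finset.mem_filter]
      tauto
    rw [hset]
    refine Finset.sum_le_sum fun e he => ?_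
    have h1 := strongLevel_le (Finset.mem_filter.1 (Finset.mem_filter.1 he).1).2
    rw [Nat.le_zero] at h1
    rw [invStrength, h1]
  | succ t ih =>
    intro z hz
    set m := strongChain c E t with hm
    set m' := strongChain c E (t + 1) with hm'
    have hmm : m ≤ m' := strongChain_mono hc E (Nat.le_succ t)
    have h1 := ih (z ⊓ m) inf_le_right
    have h2 := hbetween (t + 1) (z ⊔ m) (sup_le hz hmm)
    have h3 : (numClasses z : ℝ) + numClasses m ≤ numClasses (z ⊔ m) + numClasses (z ⊓ m) := by
      exact_mod_cast numClasses_sup_add_inf z m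
    have hset1 : cutEdges (strongEdges c E t) (z ⊓ m) ⊆ cutEdges (strongEdges c E (t + 1)) z := by
      intro e he
      simp only [cutEdges, strongEdges, Finset.mem_filter, cuts_inf] at he ⊢
      exact ⟨⟨he.1.1, fun h => he.1.2 (h.mono hmm)⟩, he.2.resolve_right he.1.2⟩
    have hset2 : between E (z ⊔ m) m' ⊆ cutEdges (strongEdges c E (t + 1)) z := by
      intro e he
      simp only [cutEdges, strongEdges, between, Finset.mem_filter] at he ⊢
      exact ⟨⟨he.1, he.2.2⟩, he.2.1.mono le_sup_left⟩
    have hdisj : Disjoint (cutEdges (strongEdges c E t) (z ⊓ m)) (between E (z ⊔ m) m') := by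
      rw [Finset.disjoint_left]
      intro e he he'
      simp only [cutEdges, strongEdges, between, Finset.mem_filter] at he he'
      exact he.1.2 (he'.2.1.mono le_sup_right)
    have h4 : ((between E (z ⊔ m) m').card : ℝ) * (2 ^ (t + 1) / c) =
        ∑ e ∈ between E (z ⊔ m) m', invStrength c E e := by
      rw [← nsmul_eq_mul, ← Finset.sum_const]
      refine Finset.sum_congr rfl fun e he => ?_
      simp only [between, Finset.mem_filter] at he
      have h5 := strongLevel_le he.2.2
      have h6 : strongLevel c E e = t + 1 := by
        by_contra hne
        have h7 : strongLevel c E e ≤ t := by omega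
        have h8 := not_cuts_strongLevel he.2.2
        exact h8 ((he.2.1.mono le_sup_right).mono (strongChain_mono hc E h7))
      rw [invStrength, h6]
    calc _ ≤ ((numClasses (z ⊓ m) : ℝ) - numClasses m) +
          ((numClasses (z ⊔ m) : ℝ) - numClasses m') := by linarith
      _ ≤ _ := add_le_add h1 (h2.trans h4.le)
      _ = ∑ e ∈ cutEdges (strongEdges c E t) (z ⊓ m) ∪ between E (z ⊔ m) m',
            invStrength c E e := (Finset.sum_union hdisj).symm
      _ ≤ _ := Finset.sum_le_sum_of_subset_of_nonneg (Finset.union_subset hset1 hset2)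
          fun e _ _ => by rw [invStrength]; positivity

end Strength

/-! ### Sampling by strength preserves all cuts. -/

section Sparsifier

variable {V α : Type} [Fintype V] [Nonempty V] [Fintype α] [Nonempty α]

/-- The inverse-probability weight of an edge. -/
def sampleWeight (S : Finset V → α → Prop) (ω : Finset V → α) (e : Finset V) : ℝ :=
  if S e (ω e) then (pr (S e))⁻¹ else 0

/-- The centred weight has variance at most R; e^x ≤ 1 + x + x² for |x| ≤ 1 turns this into the
sub-Gaussian bound. -/
theorem expect_exp_weight_le (S : α → Prop) (hS : 0 < pr S) {y R : ℝ} (hR : (pr S)⁻¹ ≤ R)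
    (hy : |y| * R ≤ 1) :
    expect (fun a => Real.exp (y * ((if S a then (pr S)⁻¹ else 0) - 1))) ≤
      Real.exp (y ^ 2 * R) := by
  have h1 : (fun a => Real.exp (y * ((if S a then (pr S)⁻¹ else 0) - 1))) =
      fun a => if S a then Real.exp (y * ((pr S)⁻¹ - 1)) else Real.exp (-y) := by
    funext a; split_ifs
    · rfl
    · congr 1; ring
  rw [h1, expect_ite]
  set p := pr S
  have hp : 0 < p⁻¹ := inv_pos.2 hS
  have habs : |y * p⁻¹| ≤ 1 := by
    rw [abs_mul, abs_of_pos hp]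
    exact (mul_le_mul_of_nonneg_left hR (abs_nonneg y)).trans hy
  have h2 := (abs_le.1 (Real.abs_exp_sub_one_sub_id_le habs)).2
  have h3 : Real.exp (y * (p⁻¹ - 1)) = Real.exp (-y) * Real.exp (y * p⁻¹) := by
    rw [← Real.exp_add]; congr 1; ring
  have hpp : p * p⁻¹ = 1 := mul_inv_cancel₀ hS.ne'
  have h4 : Real.exp (-y) + p * (Real.exp (y * (p⁻¹ - 1)) - Real.exp (-y)) ≤
      Real.exp (-y) * (1 + y + y ^ 2 * p⁻¹) := by
    rw [h3]
    have h5 : p * (Real.exp (y * p⁻¹) - 1) ≤ y + y ^ 2 * p⁻¹ := by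
      have : p * (Real.exp (y * p⁻¹) - 1) ≤ p * (y * p⁻¹ + (y * p⁻¹) ^ 2) :=
        mul_le_mul_of_nonneg_left (by linarith) hS.le
      refine this.trans (le_of_eq ?_)
      calc p * (y * p⁻¹ + (y * p⁻¹) ^ 2) = (p * p⁻¹) * y + (p * p⁻¹) * (y ^ 2 * p⁻¹) := by ring
        _ = _ := by rw [hpp]; ring
    have := mul_le_mul_of_nonneg_left h5 (Real.exp_pos (-y)).le
    linarith
  refine h4.trans ?_
  have h6 : 1 + y + y ^ 2 * p⁻¹ ≤ Real.exp (y + y ^ 2 * R) := by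
    have h7 := Real.add_one_le_exp (y + y ^ 2 * R)
    have h8 : y ^ 2 * p⁻¹ ≤ y ^ 2 * R := mul_le_mul_of_nonneg_left hR (sq_nonneg y)
    linarith
  refine (mul_le_mul_of_nonneg_left h6 (Real.exp_pos (-y)).le).trans (le_of_eq ?_)
  rw [← Real.exp_add]; congr 1; ring

/-- Concentration of the total weight of the sampled edges in `X`. -/
theorem pr_abs_sum_weight_le (S : Finset V → α → Prop) (X : Finset (Finset V)) {R ε g : ℝ}
    (hS : ∀ e ∈ X, 0 < pr (S e)) (hR : ∀ e ∈ X, (pr (S e))⁻¹ ≤ R) (hR0 : 0 < R)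
    (hg : (X.card : ℝ) ≤ g) (hε : 0 < ε) (hε1 : ε ≤ 1) :
    pr (fun ω : Finset V → α => ε / 2 * g < |∑ e ∈ X, (sampleWeight S ω e - 1)|) ≤
      2 * Real.exp (-(ε ^ 2 / 16) * (g / R)) := by
  -- For this |y| the gain |y|εg/2 = ε²g/(8R) is twice the loss y²Rg = ε²g/(16R). The two signs of y
  -- give the two tails.
  have key : ∀ y : ℝ, |y| = ε / (4 * R) →
      pr (fun ω : Finset V → α => |y| * (ε / 2 * g) ≤ y * ∑ e ∈ X, (sampleWeight S ω e - 1)) ≤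
      Real.exp (-(ε ^ 2 / 16) * (g / R)) := by
    intro y hy
    have hyR : |y| * R ≤ 1 := by
      rw [hy]
      have : ε / (4 * R) * R = ε / 4 := by field_simp
      rw [this]; linarith
    have h1 := expect_exp_sum_le (α := α) X
      (fun e a => y * ((if S e a then (pr (S e))⁻¹ else 0) - 1)) (fun _ => y ^ 2 * R)
      (fun e he => expect_exp_weight_le (S e) (hS e he) (hR e he) hyR)
    refine (pr_le_expect (f := fun ω : Finset V → α => Real.exp (-(|y| * (ε / 2 * g))) *
      Real.exp (∑ e ∈ X, y * ((if S e (ω e) then (pr (S e))⁻¹ else 0) - 1)))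
      (fun ω => by positivity) ?_).trans ?_
    · intro ω hω
      rw [← Real.exp_add]
      refine Real.one_le_exp ?_
      rw [← Finset.mul_sum]
      simp only [sampleWeight] at hω
      linarith
    · have h2 : expect (fun ω : Finset V → α => Real.exp (-(|y| * (ε / 2 * g))) *
          Real.exp (∑ e ∈ X, y * ((if S e (ω e) then (pr (S e))⁻¹ else 0) - 1))) =
          Real.exp (-(|y| * (ε / 2 * g))) * expect (fun ω : Finset V → α =>
          Real.exp (∑ e ∈ X, y * ((if S e (ω e) then (pr (S e))⁻¹ else 0) - 1))) := by
        simp only [expect, ← Finset.mul_sum, mul_div_assoc]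
      rw [h2]
      refine (mul_le_mul_of_nonneg_left h1 (Real.exp_pos _).le).trans ?_
      rw [← Real.exp_add, Finset.sum_const, nsmul_eq_mul, ← sq_abs y, hy]
      refine Real.exp_le_exp.2 ?_
      have h3 : (ε / (4 * R)) ^ 2 * R = ε ^ 2 / 16 / R := by field_simp; norm_num
      rw [h3]
      have h4 : (X.card : ℝ) * (ε ^ 2 / 16 / R) ≤ g * (ε ^ 2 / 16 / R) := by gcongr
      have h5 : ε / (4 * R) * (ε / 2 * g) = 2 * (g * (ε ^ 2 / 16 / R)) := by field_simp; ring
      have h6 : -(ε ^ 2 / 16) * (g / R) = -(g * (ε ^ 2 / 16 / R)) := by ring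
      rw [h5, h6]
      linarith
  have hy0 : 0 < ε / (4 * R) := by positivity
  have hk1 := key (ε / (4 * R)) (abs_of_pos hy0)
  have hk2 := key (-(ε / (4 * R))) (by rw [abs_neg, abs_of_pos hy0])
  rw [abs_neg] at hk2
  rw [abs_of_pos hy0] at hk1 hk2
  refine le_trans (pr_mono ?_) ((pr_or_le _ _).trans (le_trans (add_le_add hk1 hk2) (by linarith)))
  intro ω hω
  rcases lt_abs.1 hω with h | h
  · left; gcongr
  · right
    have := mul_lt_mul_of_pos_left h hy0
    linarith

/-- Sampling each edge with probability inversely proportional to its strength preserves all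
cuts. -/
theorem pr_exists_bad_cut_le (E : Finset (Finset V)) (S : Finset V → α → Prop) {c R ε L A : ℝ}
    (N : ℕ) (hc : 0 < c) (hR : 0 < R) (hε : 0 < ε) (hε1 : ε ≤ 1)
    (hL : (Fintype.card V : ℝ) ≤ Real.exp L) (hA : 0 ≤ A)
    (hβ : 6 * L + 2 * A + 2 ≤ ε ^ 2 / 16 * (c / R))
    (hS : ∀ e ∈ E, Cuts ⊥ e → (∀ a, S e a) ∨ ∃ t ≤ N, ¬ Cuts (strongChain c E t) e ∧
      0 < pr (S e) ∧ (pr (S e))⁻¹ ≤ R / 2 ^ t) :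
    pr (fun ω : Finset V → α => ∃ s : Setoid V, ε * (cutEdges E s).card <
      |∑ e ∈ cutEdges E s, (sampleWeight S ω e - 1)|) ≤
      (N + 1) * (2 * (Fintype.card V * Real.exp (-A))) := by
  -- the edges handled at level `t`
  set D : ℕ → Finset (Finset V) := fun t =>
    E.filter fun e => strongLevel c E e = t ∧ ¬ Cuts (strongChain c E t) e ∧
      0 < pr (S e) ∧ (pr (S e))⁻¹ ≤ R / 2 ^ t with hD
  -- The error at level t is charged to all crossing edges that are strong at that level, not only
  -- to those in `D t`, since cut counting applies to `strongEdges`.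
  set g : ℕ → Finset (Finset V) → ℝ := fun t Y => c / 2 ^ t * ∑ e ∈ Y, invStrength c E e with hg
  have hinv : ∀ e, 0 ≤ invStrength c E e := fun e => by rw [invStrength]; positivity
  have hlevel : ∀ t, pr (fun ω : Finset V → α => ∃ s : Setoid V,
      ε / 2 * g t (cutEdges (strongEdges c E t) s) <
        |∑ e ∈ cutEdges (D t) s, (sampleWeight S ω e - 1)|) ≤
      2 * (Fintype.card V * Real.exp (-A)) := by
    intro t
    have hDsub : D t ⊆ strongEdges c E t := by
      intro e he
      simp only [hD, strongEdges, Finset.mem_filter] at he ⊢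
      exact ⟨he.1, he.2.2.1⟩
    have hcut : ∀ s, cutEdges (D t) s = (cutEdges (strongEdges c E t) s) ∩ D t := by
      intro s
      ext e
      simp only [cutEdges, Finset.mem_inter, Finset.mem_filter]
      constructor
      · rintro ⟨h1, h2⟩; exact ⟨⟨hDsub h1, h2⟩, h1⟩
      · rintro ⟨⟨h1, h2⟩, h3⟩; exact ⟨h3, h2⟩
    have hsum := sum_nonempty_cuts_le (strongEdges c E t) (invStrength c E) (strongChain c E t)
      hL hA hβ (fun e _ => hinv e) (fun e he => (Finset.mem_filter.1 he).2)
      (numClasses_sub_le_sum_invStrength hc E t)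
    calc _ ≤ pr (fun ω : Finset V → α => ∃ Y ∈ (cutFamily (strongEdges c E t) ⊥).erase ∅,
          ε / 2 * g t Y < |∑ e ∈ Y ∩ D t, (sampleWeight S ω e - 1)|) := by
          refine pr_mono ?_
          rintro ω ⟨s, hs⟩
          rw [hcut] at hs
          refine ⟨_, Finset.mem_erase.2 ⟨?_, Finset.mem_image.2 ⟨s, by simp, rfl⟩⟩, hs⟩
          intro hempty
          rw [hempty] at hs
          simp [hg] at hs
      _ ≤ ∑ Y ∈ (cutFamily (strongEdges c E t) ⊥).erase ∅,
          2 * Real.exp (-(ε ^ 2 / 16) * (g t Y / (R / 2 ^ t))) := by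
          refine (pr_exists_le _ _).trans (Finset.sum_le_sum fun Y hY => ?_)
          have hYsub : Y ⊆ strongEdges c E t := by
            obtain ⟨s, -, rfl⟩ := Finset.mem_image.1 (Finset.mem_erase.1 hY).2
            exact Finset.filter_subset _ _
          refine pr_abs_sum_weight_le S (Y ∩ D t) (fun e he => ?_) (fun e he => ?_)
            (by positivity) ?_ hε hε1
          · exact (Finset.mem_filter.1 (Finset.mem_inter.1 he).2).2.2.2.1
          · exact (Finset.mem_filter.1 (Finset.mem_inter.1 he).2).2.2.2.2
          · have h1 : ((Y ∩ D t).card : ℝ) = c / 2 ^ t * ∑ e ∈ Y ∩ D t, invStrength c E e := by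
              have h2 : ∑ e ∈ Y ∩ D t, invStrength c E e = ∑ e ∈ Y ∩ D t, 2 ^ t / c := by
                refine Finset.sum_congr rfl fun e he => ?_
                rw [invStrength, (Finset.mem_filter.1 (Finset.mem_inter.1 he).2).2.1]
              rw [h2, Finset.sum_const, nsmul_eq_mul]
              field_simp
            rw [h1]
            refine mul_le_mul_of_nonneg_left ?_ (by positivity)
            exact Finset.sum_le_sum_of_subset_of_nonneg Finset.inter_subset_left
              fun e _ _ => hinv e
      _ = 2 * ∑ Y ∈ (cutFamily (strongEdges c E t) ⊥).erase ∅,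
          Real.exp (-(ε ^ 2 / 16 * (c / R)) * ∑ e ∈ Y, invStrength c E e) := by
          rw [Finset.mul_sum]
          refine Finset.sum_congr rfl fun Y _ => ?_
          congr 2
          simp only [hg]
          field_simp
      _ ≤ _ := by linarith
  refine le_trans (pr_mono ?_) ((pr_exists_le (Finset.range (N + 1)) _).trans
    ((Finset.sum_le_sum fun t _ => hlevel t).trans (le_of_eq (by simp))))
  rintro ω ⟨s, hs⟩
  by_contra hcon
  push Not at hcon
  refine absurd hs (not_lt.2 ?_)
  have hdecomp : ∑ e ∈ cutEdges E s, (sampleWeight S ω e - 1) =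
      ∑ t ∈ Finset.range (N + 1), ∑ e ∈ cutEdges (D t) s, (sampleWeight S ω e - 1) := by
    have hcutD : ∀ t, cutEdges (D t) s = (cutEdges E s).filter fun e => e ∈ D t := by
      intro t
      ext e
      simp only [cutEdges, hD, Finset.mem_filter]
      tauto
    simp only [hcutD, Finset.sum_filter]
    rw [Finset.sum_comm]
    refine Finset.sum_congr rfl fun e he => ?_
    obtain ⟨heE, hes⟩ := Finset.mem_filter.1 he
    by_cases hall : ∀ a, S e a
    -- Edges kept with certainty have weight one and contribute no error, so they need no level.
    · have hp : pr (S e) = 1 := by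
        simp [pr, hall]
      have hz : sampleWeight S ω e - 1 = 0 := by
        simp [sampleWeight, hall, hp]
      simp [hz]
    · obtain ⟨t, htN, ht, hp, hpR⟩ := (hS e heE (hes.mono bot_le)).resolve_left hall
      have hle := strongLevel_le ht
      -- The guaranteed t may exceed the strong level of e; passing down to that level only weakens
      -- the probability requirement.
      have hmem : e ∈ D (strongLevel c E e) := by
        refine Finset.mem_filter.2 ⟨heE, rfl, not_cuts_strongLevel ht, hp, hpR.trans ?_⟩
        exact div_le_div_of_nonneg_left hR.le (by positivity)
          (pow_le_pow_right₀ (by norm_num) hle)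
      rw [Finset.sum_eq_single (strongLevel c E e)]
      · rw [if_pos hmem]
      · intro t' _ hne
        rw [if_neg]
        intro hmem'
        exact hne (Finset.mem_filter.1 hmem').2.1.symm
      · intro hnot
        exact absurd (Finset.mem_range.2 (by omega)) hnot
  rw [hdecomp]
  calc _ ≤ ∑ t ∈ Finset.range (N + 1),
        |∑ e ∈ cutEdges (D t) s, (sampleWeight S ω e - 1)| := Finset.abs_sum_le_sum_abs _ _
    _ ≤ ∑ t ∈ Finset.range (N + 1), ε / 2 * g t (cutEdges (strongEdges c E t) s) :=
        Finset.sum_le_sum fun t ht => hcon t ht s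
    _ = ε / 2 * ∑ e ∈ cutEdges E s, ∑ t ∈ Finset.range (N + 1),
          if ¬ Cuts (strongChain c E t) e then (2 : ℝ) ^ strongLevel c E e / 2 ^ t else 0 := by
        rw [← Finset.mul_sum]
        congr 1
        rw [Finset.sum_comm]
        refine Finset.sum_congr rfl fun t _ => ?_
        have hcutG : cutEdges (strongEdges c E t) s =
            (cutEdges E s).filter fun e => ¬ Cuts (strongChain c E t) e := by
          ext e
          simp only [cutEdges, strongEdges, Finset.mem_filter]
          tauto
        simp only [hg, hcutG, Finset.mul_sum, Finset.sum_filter]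
        refine Finset.sum_congr rfl fun e _ => ?_
        split_ifs
        · rfl
        · rw [invStrength]; field_simp
    -- An edge of strong level u is charged at most 2^(u-t) at each level t ≥ u, a geometric series
    -- of total at most 2.
    _ ≤ ε / 2 * ∑ e ∈ cutEdges E s, 2 := by
        gcongr with e he
        set u := strongLevel c E e
        calc _ ≤ ∑ t ∈ Finset.range (N + 1), if u ≤ t then (1 / 2 : ℝ) ^ (t - u) else 0 := by
              refine Finset.sum_le_sum fun t _ => ?_
              by_cases h : Cuts (strongChain c E t) e
              · rw [if_neg (not_not.2 h)]
                split_ifs <;> positivity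
              · have hle : u ≤ t := strongLevel_le h
                rw [if_pos h, if_pos hle, div_pow, one_pow, div_le_div_iff₀ (by positivity)
                  (by positivity), ← pow_add, one_mul]
                rw [show u + (t - u) = t by omega]
          _ ≤ ∑ t ∈ Finset.Ico u (u + (N + 1)), (1 / 2 : ℝ) ^ (t - u) := by
              rw [← Finset.sum_filter]
              refine Finset.sum_le_sum_of_subset_of_nonneg ?_ fun _ _ _ => by positivity
              intro t ht
              simp only [Finset.mem_filter, Finset.mem_range, Finset.mem_Ico] at ht ⊢
              omega
          _ = ∑ i ∈ Finset.range (N + 1), (1 / 2 : ℝ) ^ i := by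
              rw [Finset.sum_Ico_eq_sum_range]
              simp
          _ ≤ 2 := sum_geometric_two_le _
    _ = ε * (cutEdges E s).card := by rw [Finset.sum_const, nsmul_eq_mul]; ring

end Sparsifier

/-! ### Zero-sum edge codes and unique decoding of sparse crossing sets. -/

section Code

variable {V : Type} [Fintype V] [Nonempty V]

/-- A vertex of `e`, when `e` is nonempty. -/
def rootVertex (e : Finset V) : V := if h : e.Nonempty then h.choose else Classical.arbitrary V

theorem rootVertex_mem {e : Finset V} {x : V} (h : x ∈ e) : rootVertex e ∈ e := by
  have h' : e.Nonempty := ⟨x, h⟩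
  rw [rootVertex, dif_pos h']; exact h'.choose_spec

variable {q : ℕ}

/-- Coefficients of the edge `e` at its vertices, adding up to zero, from free coefficients `u`. -/
def coeff (u : Finset V → V → ZMod q) (e : Finset V) (v : V) : ZMod q :=
  (if v ∈ e then u e v else 0) - if v = rootVertex e then ∑ x ∈ e, u e x else 0

/-- The sum of a vertex labelling over a class of `s`. -/
def classSum (s : Setoid V) (f : V → ZMod q) (b : Quotient s) : ZMod q :=
  ∑ v, if Quotient.mk s v = b then f v else 0

theorem classSum_sum {ι : Type} (s : Setoid V) (F : Finset ι) (f : ι → V → ZMod q) (b : Quotient s) :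
    classSum s (fun v => ∑ i ∈ F, f i v) b = ∑ i ∈ F, classSum s (f i) b := by
  simp only [classSum]
  rw [Finset.sum_comm]
  refine Finset.sum_congr rfl fun v _ => ?_
  split_ifs <;> simp

theorem classSum_coeff (s : Setoid V) (u : Finset V → V → ZMod q) (e : Finset V) (b : Quotient s) :
    classSum s (coeff u e) b = ∑ x ∈ e, ((if Quotient.mk s x = b then u e x else 0) -
      if Quotient.mk s (rootVertex e) = b then u e x else 0) := by
  rw [Finset.sum_sub_distrib]
  have h1 : ∀ v, (if Quotient.mk s v = b then coeff u e v else 0) =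
      (if v ∈ e then (if Quotient.mk s v = b then u e v else 0) else 0) -
      if v = rootVertex e then (if Quotient.mk s (rootVertex e) = b then ∑ x ∈ e, u e x else 0)
        else 0 := by
    intro v
    by_cases hv : v = rootVertex e
    · subst hv; simp only [coeff]; split_ifs <;> simp
    · simp only [coeff, if_neg hv]; split_ifs <;> simp
  simp only [classSum, h1]
  rw [Finset.sum_sub_distrib]
  congr 1
  · rw [Finset.sum_ite_mem, Finset.univ_inter]
  · rw [Finset.sum_ite_eq' Finset.univ (rootVertex e)]
    simp only [Finset.mem_univ, if_true]
    split_ifs <;> simp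

theorem classSum_coeff_eq_zero {s : Setoid V} {e : Finset V} (h : ¬ Cuts s e)
    (u : Finset V → V → ZMod q) (b : Quotient s) : classSum s (coeff u e) b = 0 := by
  rw [classSum_coeff]
  refine Finset.sum_eq_zero fun x hx => ?_
  have h' := contract_le_iff.1 (not_not.1 h) x hx _ (rootVertex_mem hx)
  rw [Quotient.sound (s := s) h', sub_self]

/-- The class sums of a combination of edges, as a function of the free coefficients. -/
def classHom (s : Setoid V) (y : Finset V → ZMod q) :
    (Finset V → V → ZMod q) →+ (Quotient s → ZMod q) where
  toFun u b := ∑ e, y e * classSum s (coeff u e) b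
  map_zero' := by
    funext b
    simp [classSum_coeff]
  map_add' u u' := by
    funext b
    simp only [Pi.add_apply]
    rw [← Finset.sum_add_distrib]
    refine Finset.sum_congr rfl fun e _ => ?_
    rw [← mul_add]
    congr 1
    rw [classSum_coeff, classSum_coeff, classSum_coeff, ← Finset.sum_add_distrib]
    refine Finset.sum_congr rfl fun x _ => ?_
    simp only [Pi.add_apply]
    split_ifs <;> ring

theorem classHom_single (s : Setoid V) (y : Finset V → ZMod q) {e : Finset V} (x : V) (hx : x ∈ e)
    (a : ZMod q) :
    classHom s y (Pi.single e (Pi.single x a)) =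
      Pi.single (Quotient.mk s x) (y e * a) - Pi.single (Quotient.mk s (rootVertex e)) (y e * a) := by
  funext b
  simp only [classHom, AddMonoidHom.coe_mk, ZeroHom.coe_mk, Pi.sub_apply]
  rw [Finset.sum_eq_single e]
  · rw [classSum_coeff, Pi.single_eq_same, Finset.sum_eq_single x]
    · simp only [Pi.single_eq_same, Pi.single_apply, eq_comm (a := b)]
      split_ifs <;> simp
    · intro x' _ hne
      rw [Pi.single_eq_of_ne hne]; simp
    · exact fun h => absurd hx h
  · intro e' _ hne
    rw [classSum_coeff]
    simp [Pi.single_eq_of_ne hne]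
  · exact fun h => absurd (Finset.mem_univ _) h

/-- The partition obtained from `s` by contracting the edges in `y`. -/
def contractAll (s : Setoid V) (y : Finset (Finset V)) : Setoid V := s ⊔ y.sup contract

theorem le_contractAll (s : Setoid V) (y : Finset (Finset V)) : s ≤ contractAll s y := le_sup_left

theorem not_cuts_contractAll (s : Setoid V) {y : Finset (Finset V)} {e : Finset V} (he : e ∈ y) :
    ¬ Cuts (contractAll s y) e :=
  not_not.2 ((Finset.le_sup (f := contract) he).trans le_sup_right)

/-- Membership of all these differences in the range is an equivalence relation on vertices. It
contains s and joins each vertex of an edge of Y to the root, because the free coefficients are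
arbitrary and y e is its own inverse. -/
theorem single_sub_single_mem_range (s : Setoid V) (Y : Finset (Finset V)) (y : Finset V → ZMod q)
    (hy : ∀ e ∈ Y, y e * y e = 1) {v w : V} (h : contractAll s Y v w) (a : ZMod q) :
    (Pi.single (Quotient.mk s v) a - Pi.single (Quotient.mk s w) a : Quotient s → ZMod q) ∈
      (classHom s y).range := by
  let R : Setoid V :=
    { r := fun v w => ∀ a : ZMod q,
        (Pi.single (Quotient.mk s v) a - Pi.single (Quotient.mk s w) a : Quotient s → ZMod q) ∈
          (classHom s y).range
      iseqv := by
        refine ⟨fun v a => ?_, fun {v w} h a => ?_, fun {v w x} h h' a => ?_⟩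
        · rw [sub_self]; exact AddSubgroup.zero_mem _
        · rw [← neg_sub]; exact AddSubgroup.neg_mem _ (h a)
        · have := AddSubgroup.add_mem _ (h a) (h' a)
          rwa [sub_add_sub_cancel] at this }
  have hroot : ∀ e ∈ Y, ∀ x ∈ e, R x (rootVertex e) := by
    intro e he x hx a
    refine ⟨Pi.single e (Pi.single x (y e * a)), ?_⟩
    rw [classHom_single s y x hx, ← mul_assoc, hy e he, one_mul]
  have hle : contractAll s Y ≤ R := by
    refine sup_le ?_ (Finset.sup_le fun e he => contract_le_iff.2 fun x hx x' hx' => ?_)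
    · intro v w hvw a
      rw [Quotient.sound (s := s) hvw, sub_self]
      exact AddSubgroup.zero_mem _
    · exact R.trans' (hroot e he x hx) (R.symm' (hroot e he x' hx'))
  exact hle h a

/-- Choose a representative class σ inside each merged class. The values at the non-representative
classes can be prescribed freely, with the representatives absorbing the compensation. -/
theorem card_range_classHom_ge [NeZero q] (s : Setoid V) (Y : Finset (Finset V))
    (y : Finset V → ZMod q) (hy : ∀ e ∈ Y, y e * y e = 1) :
    q ^ (numClasses s - numClasses (contractAll s Y)) ≤ Nat.card (classHom s y).range := by
  set t := contractAll s Y with ht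
  set π : Quotient s → Quotient t := Setoid.map_of_le (le_contractAll s Y) with hπ
  have hπs : Function.Surjective π := by
    intro c
    induction c using Quotient.inductionOn with
    | h v => exact ⟨Quotient.mk s v, rfl⟩
  set σ := Function.surjInv hπs with hσ
  have hσr : ∀ c, π (σ c) = c := Function.surjInv_eq hπs
  have hcard : Nat.card {b : Quotient s // σ (π b) ≠ b} = numClasses s - numClasses t := by
    have h1 : Nat.card {b : Quotient s // σ (π b) = b} = numClasses t := by
      refine Nat.card_congr ⟨fun b => π b.1, fun c => ⟨σ c, by rw [hσr]⟩, fun b => ?_, fun c => ?_⟩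
      · exact Subtype.ext b.2
      · exact hσr c
    have h2 := Fintype.card_subtype_compl (fun b : Quotient s => σ (π b) = b)
    rw [← Nat.card_eq_fintype_card, ← Nat.card_eq_fintype_card, ← Nat.card_eq_fintype_card, h1]
      at h2
    exact h2
  let Ψ : ({b : Quotient s // σ (π b) ≠ b} → ZMod q) → (classHom s y).range := fun g =>
    ⟨∑ b : {b : Quotient s // σ (π b) ≠ b}, (Pi.single b.1 (g b) - Pi.single (σ (π b.1)) (g b)), by
      refine AddSubgroup.sum_mem _ fun b _ => ?_
      obtain ⟨v, hv⟩ := Quotient.exists_rep b.1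
      obtain ⟨w, hw⟩ := Quotient.exists_rep (σ (π b.1))
      rw [← hw, ← hv]
      refine single_sub_single_mem_range s Y y hy ?_ _
      have h1 : π (Quotient.mk s v) = π (Quotient.mk s w) := by rw [hw, hσr, hv]
      exact Quotient.exact (s := t) h1⟩
  have hΨ : Function.Injective Ψ := by
    intro g g' hgg
    have hval : ∀ g : {b : Quotient s // σ (π b) ≠ b} → ZMod q, ∀ b, (Ψ g).1 b.1 = g b := by
      intro g b
      simp only [Ψ, Finset.sum_apply, Pi.sub_apply]
      rw [Finset.sum_eq_single b]
      · rw [Pi.single_eq_same, Pi.single_eq_of_ne b.2.symm, sub_zero]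
      · intro b' _ hne
        rw [Pi.single_eq_of_ne (fun h => hne (Subtype.ext h.symm)), Pi.single_eq_of_ne, sub_zero]
        intro h
        apply b.2
        rw [h, hσr]
      · exact fun h => absurd (Finset.mem_univ _) h
    funext b
    rw [← hval g b, ← hval g' b, hgg]
  have := Nat.card_le_card_of_injective Ψ hΨ
  rwa [Nat.card_fun, Nat.card_zmod, hcard] at this

/-- The probability is |kernel| / |domain|, that is 1 / |range|. -/
theorem pr_classHom_eq_zero_le [NeZero q] (s : Setoid V) (Y : Finset (Finset V))
    (y : Finset V → ZMod q) (hy : ∀ e ∈ Y, y e * y e = 1) :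
    pr (fun u : Finset V → V → ZMod q => classHom s y u = 0) ≤
      ((q : ℝ)⁻¹) ^ (numClasses s - numClasses (contractAll s Y)) := by
  have h1 : ∀ P : (Finset V → V → ZMod q) → Prop, (∀ u, P u ↔ classHom s y u = 0) →
      (univ.filter P).card = Nat.card (classHom s y).ker := by
    intro P hP
    rw [Nat.card_eq_fintype_card, Fintype.card_subtype]
    congr 1
    ext u
    simp [hP, AddMonoidHom.mem_ker]
  have h2 : Nat.card (classHom s y).ker * Nat.card (classHom s y).range =
      Fintype.card (Finset V → V → ZMod q) := by
    rw [← AddSubgroup.index_ker, AddSubgroup.card_mul_index, Nat.card_eq_fintype_card]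
  have h3 := card_range_classHom_ge s Y y hy
  have hk : (0 : ℝ) < Nat.card (classHom s y).ker := by exact_mod_cast Nat.card_pos
  have hq : (0 : ℝ) < q := by exact_mod_cast NeZero.pos q
  unfold pr
  rw [h1 _ fun _ => Iff.rfl, ← h2, Nat.cast_mul, inv_pow, div_mul_eq_div_div, div_self hk.ne', one_div]
  refine inv_anti₀ (by positivity) ?_
  exact_mod_cast h3

/-- `z` is a set of edges of the universe `U` crossing `s`, sparse on `s`. -/
def IsSparseCut (U : Finset (Finset V)) (θ : ℝ) (s : Setoid V) (z : Finset (Finset V)) : Prop :=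
  z ⊆ U ∧ (∀ e ∈ z, Cuts s e) ∧ SparseOn z θ s

/-- `z` is compatible with the measurements `Y` of the vertices, aggregated over the classes
of `s`. -/
def Compatible {K : ℕ} (s : Setoid V) (u : Fin K → Finset V → V → ZMod q) (Y : Fin K → V → ZMod q)
    (z : Finset (Finset V)) : Prop :=
  ∀ i b, ∑ e ∈ z, classSum s (coeff (u i) e) b = classSum s (Y i) b

theorem one_add_inv_pow_sub_one_le {N : ℕ} {x : ℝ} (hx : 0 ≤ x) (hNx : N * x ≤ 1) :
    (x + 1) ^ N - 1 ≤ 2 * (N * x) := by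
  have h1 : (x + 1) ^ N ≤ Real.exp (N * x) := by
    rw [Real.exp_nat_mul]
    exact pow_le_pow_left₀ (by positivity) (Real.add_one_le_exp x) N
  have h0 : 0 ≤ N * x := by positivity
  have h2 := (abs_le.1 (Real.abs_exp_sub_one_sub_id_le (x := N * x)
    (by rw [abs_of_nonneg h0]; exact hNx))).2
  nlinarith

/-- A sparse set of crossing edges is determined by its measurements, with high probability. -/
theorem pr_exists_compatible_le [NeZero q] {K : ℕ} (U : Finset (Finset V)) {θ : ℝ} (s : Setoid V)
    (z : Finset (Finset V)) (hz : IsSparseCut U θ s z) (hK : 2 * θ ≤ K) (hq : U.card ≤ q) :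
    pr (fun u : Fin K → Finset V → V → ZMod q => ∃ z', z' ≠ z ∧ IsSparseCut U θ s z' ∧
      ∀ i b, ∑ e ∈ z', classSum s (coeff (u i) e) b = ∑ e ∈ z, classSum s (coeff (u i) e) b) ≤
      2 * (U.card / q) := by
  have hq0 : (0 : ℝ) < q := by exact_mod_cast NeZero.pos q
  -- These signs express the difference of two candidates through their symmetric difference alone,
  -- as a map fixed by y and z.
  set c : Finset (Finset V) → Finset V → ZMod q := fun y e =>
    if e ∈ y then (if e ∈ z then -1 else 1) else 0 with hc
  have hc2 : ∀ y, ∀ e ∈ y, c y e * c y e = 1 := by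
    intro y e he
    simp only [hc, he, if_true]
    split_ifs <;> simp
  set F := (U.powerset.erase ∅).filter fun y =>
    y.card ≤ K * (numClasses s - numClasses (contractAll s y)) with hF
  have hterm : ∀ y ∈ F, pr (fun u : Fin K → Finset V → V → ZMod q =>
      ∀ i, classHom s (c y) (u i) = 0) ≤ ((q : ℝ)⁻¹) ^ y.card := by
    intro y hy
    rw [pr_pi_forall (ι := Fin K) (fun u => classHom s (c y) u = 0), Fintype.card_fin]
    refine (pow_le_pow_left₀ (pr_nonneg _) (pr_classHom_eq_zero_le s y (c y) (hc2 y)) K).trans ?_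
    rw [← pow_mul]
    refine pow_le_pow_of_le_one (by positivity) ?_ ?_
    · exact inv_le_one_of_one_le₀ (by exact_mod_cast NeZero.pos q)
    · rw [mul_comm]; exact (Finset.mem_filter.1 hy).2
  calc _ ≤ pr (fun u : Fin K → Finset V → V → ZMod q =>
        ∃ y ∈ F, ∀ i, classHom s (c y) (u i) = 0) := by
        refine pr_mono ?_
        rintro u ⟨z', hne, hz', heq⟩
        set y := symmDiff z' z with hy
        refine ⟨y, ?_, fun i => ?_⟩
        · refine Finset.mem_filter.2 ⟨Finset.mem_erase.2 ⟨?_, Finset.mem_powerset.2 ?_⟩, ?_⟩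
          · intro h
            exact hne (symmDiff_eq_bot.1 h)
          · intro e he
            rcases Finset.mem_symmDiff.1 he with h | h
            · exact hz'.1 h.1
            · exact hz.1 h.1
          -- Contracting y loses some number d of classes. Both candidates are sparse, so |y| ≤ 2θd
          -- ≤ Kd, and q^(-Kd) ≤ q^(-|y|).
          · have hle := le_contractAll s y
            have hsub : y ⊆ between z' s (contractAll s y) ∪ between z s (contractAll s y) := by
              intro e he
              have hnc := not_cuts_contractAll s he
              rcases Finset.mem_symmDiff.1 he with h | h
              · exact Finset.mem_union_left _
                  (Finset.mem_filter.2 ⟨h.1, hz'.2.1 e h.1, hnc⟩)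
              · exact Finset.mem_union_right _
                  (Finset.mem_filter.2 ⟨h.1, hz.2.1 e h.1, hnc⟩)
            have h1 := (Finset.card_le_card hsub).trans (Finset.card_union_le _ _)
            have h2 := hz'.2.2 _ hle
            have h3 := hz.2.2 _ hle
            have hanti := numClasses_anti hle
            have h4 : (y.card : ℝ) ≤ (between z' s (contractAll s y)).card +
                (between z s (contractAll s y)).card := by exact_mod_cast h1
            have h5 : (0 : ℝ) ≤ (numClasses s : ℝ) - numClasses (contractAll s y) := by
              rw [sub_nonneg]; exact_mod_cast hanti
            have h6 : (y.card : ℝ) ≤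
                ((K * (numClasses s - numClasses (contractAll s y)) : ℕ) : ℝ) := by
              rw [Nat.cast_mul, Nat.cast_sub hanti]
              nlinarith
            exact_mod_cast h6
        · funext b
          simp only [classHom, AddMonoidHom.coe_mk, ZeroHom.coe_mk, Pi.zero_apply]
          have h1 := heq i b
          rw [← sub_eq_zero] at h1
          rw [← h1, ← Finset.univ_inter z', ← Finset.univ_inter z, ← Finset.sum_ite_mem,
            ← Finset.sum_ite_mem, ← Finset.sum_sub_distrib]
          refine Finset.sum_congr rfl fun e _ => ?_
          simp only [hc, hy, Finset.mem_symmDiff]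
          by_cases h1 : e ∈ z' <;> by_cases h2 : e ∈ z <;> simp [h1, h2]
    _ ≤ ∑ y ∈ F, ((q : ℝ)⁻¹) ^ y.card := (pr_exists_le F _).trans (Finset.sum_le_sum hterm)
    _ ≤ ∑ y ∈ U.powerset.erase ∅, ((q : ℝ)⁻¹) ^ y.card :=
        Finset.sum_le_sum_of_subset_of_nonneg (Finset.filter_subset _ _) fun _ _ _ => by positivity
    _ = ((q : ℝ)⁻¹ + 1) ^ U.card - 1 := by
        have h1 := Finset.sum_pow_mul_eq_add_pow ((q : ℝ)⁻¹) 1 U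
        simp only [one_pow, mul_one] at h1
        rw [← h1, ← Finset.add_sum_erase _ _ (Finset.empty_mem_powerset U)]
        simp
    _ ≤ 2 * (U.card / q) := by
        rw [div_eq_mul_inv]
        refine one_add_inv_pow_sub_one_le (by positivity) ?_
        rw [← div_eq_mul_inv, div_le_one hq0]
        exact_mod_cast hq

end Code

/-! ### The adaptive chain of merged partitions and its thresholds. -/

section Chain

variable {V : Type} [Fintype V]

/-- Repeatedly merge the strong components of the graphs `T k`, at thresholds `θ k`. -/
def mergeChain (θ : ℕ → ℝ) (T : ℕ → Finset (Finset V)) : ℕ → Setoid V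
  | 0 => ⊥
  | k + 1 => strongPartition (θ k) (T k) (mergeChain θ T k)

theorem mergeChain_mono (θ : ℕ → ℝ) (T : ℕ → Finset (Finset V)) : Monotone (mergeChain θ T) :=
  monotone_nat_of_le_succ fun k => le_strongPartition (θ k) (T k) _

theorem mergeChain_congr (θ : ℕ → ℝ) {T T' : ℕ → Finset (Finset V)} {k : ℕ}
    (h : ∀ i < k, T i = T' i) : mergeChain θ T k = mergeChain θ T' k := by
  induction k with
  | zero => rfl
  | succ k ih =>
    simp only [mergeChain]
    rw [ih fun i hi => h i (by omega), h k (by omega)]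

theorem StrictSparseOn.sparse {G : Finset (Finset V)} {θ : ℝ} {s : Setoid V}
    (h : StrictSparseOn G θ s) : SparseOn G θ s := by
  intro t hst
  rcases eq_or_lt_of_le hst with rfl | hlt
  · have : between G s s = ∅ := Finset.filter_eq_empty_iff.2 fun e _ h => h.2 h.1
    simp [this]
  · exact (h t hlt).le

theorem sparseOn_of_card_le {G : Finset (Finset V)} {θ : ℝ} (h : (G.card : ℝ) ≤ θ)
    (s : Setoid V) : SparseOn G θ s := by
  intro t hst
  rcases eq_or_lt_of_le hst with rfl | hlt
  · have : between G s s = ∅ := Finset.filter_eq_empty_iff.2 fun e _ h => h.2 h.1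
    simp [this]
  · have h1 : ((between G s t).card : ℝ) ≤ G.card := by
      exact_mod_cast Finset.card_le_card (Finset.filter_subset _ _)
    have h2 : (1 : ℝ) ≤ (numClasses s : ℝ) - numClasses t := by
      have := numClasses_lt hlt
      have : (numClasses t : ℝ) + 1 ≤ numClasses s := by exact_mod_cast this
      linarith
    have h3 : 0 ≤ θ := (Nat.cast_nonneg _).trans h
    nlinarith

end Chain

/-- The merging threshold of round `k`; a level consists of `J` rounds. -/
def mergeThreshold (κ : ℝ) (J k : ℕ) : ℝ := κ * (1 + (2 * (k % J : ℕ) + 1) / (2 * J))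

/-- The density of the graph before (`i = 0`) and after (`i = 1`) round `k`. -/
def roundDensity (κ : ℝ) (N J k i : ℕ) : ℝ :=
  κ * (2 ^ N / 2 ^ (k / J)) * (1 + ((k % J : ℕ) + i : ℝ) / J)

/-! ### Deterministic analysis of the merging rounds. -/

section Rounds

variable {V : Type} [Fintype V] [Nonempty V]

/-- In round `k`, the graph `T` treats the current partition `P` as it should. -/
def RoundGood (κ : ℝ) (N J : ℕ) (E T : Finset (Finset V)) (k : ℕ) (P : Setoid V) : Prop :=
  StrictSparseOn T (mergeThreshold κ J k) (strongPartition (roundDensity κ N J k 0) E P) ∧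
  ¬ ∃ p : Setoid V × Setoid V,
    (P ≤ p.1 ∧ p.1 ≤ p.2 ∧ p.2 ≤ strongPartition (roundDensity κ N J k 0) E P) ∧
    numClasses P + 2 * numClasses p.2 <
      numClasses (strongPartition (roundDensity κ N J k 0) E P) + 2 * numClasses p.1 ∧
    roundDensity κ N J k 1 * ((numClasses p.1 : ℝ) - numClasses p.2) ≤
      (between E p.1 p.2).card ∧
    ((between T p.1 p.2).card : ℝ) ≤
      mergeThreshold κ J k * ((numClasses p.1 : ℝ) - numClasses p.2)

/-- Three invariants run together: nothing is merged outside strong components of E, the merges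
missing from the target U shrink by half in each round, and E is sparse at the start of each level.
Sparsity of the sample on U gives P (k + 1) ≤ U, and the target U' of the next density refines U.
Since 2^J > |V|, after `J` rounds no merge is missing. The index (k - 1) / J makes the partition
ending level t refer to the strength of level t, not t + 1. -/
theorem mergeChain_invariant {κ : ℝ} (hκ : 0 < κ) {N J : ℕ} (hJ : Fintype.card V < 2 ^ J)
    {E : Finset (Finset V)} (hE : (E.card : ℝ) ≤ 4 * κ * 2 ^ N) (T : ℕ → Finset (Finset V)) {M : ℕ}
    (hgood : ∀ k < M, RoundGood κ N J E (T k) k (mergeChain (mergeThreshold κ J) T k)) :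
    ∀ k ≤ M,
      mergeChain (mergeThreshold κ J) T k ≤ strongChain (κ * 2 ^ N / 2) E ((k - 1) / J) ∧
      (numClasses (mergeChain (mergeThreshold κ J) T k) - numClasses
        (strongPartition (roundDensity κ N J k 0) E (mergeChain (mergeThreshold κ J) T k))) *
          2 ^ (k % J) ≤ Fintype.card V ∧
      (k % J = 0 → SparseOn E (4 * (κ * (2 ^ N / 2 ^ (k / J))))
        (mergeChain (mergeThreshold κ J) T k)) := by
  have hJ0 : 0 < J := by
    rcases Nat.eq_zero_or_pos J with rfl | h
    · have := Fintype.card_pos (α := V); omega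
    · exact h
  have hJr : (0 : ℝ) < J := by exact_mod_cast hJ0
  have hc : 0 < κ * 2 ^ N / 2 := by positivity
  set P := mergeChain (mergeThreshold κ J) T with hP
  intro k
  induction k with
  | zero =>
    intro _
    refine ⟨bot_le, ?_, fun _ => sparseOn_of_card_le (le_trans hE ?_) _⟩
    · have := numClasses_le_card (P 0)
      simp only [Nat.zero_mod, pow_zero, mul_one]
      omega
    · simp only [Nat.zero_div, pow_zero, div_one]; linarith
  | succ k ih =>
    intro hk
    obtain ⟨ih1, ih2, -⟩ := ih (by omega)
    obtain ⟨hg1, hg2⟩ := hgood k (by omega)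
    set t := k / J with ht
    set j := k % J with hj
    have hkt : k = J * t + j := (Nat.div_add_mod k J).symm
    have hjJ : j < J := Nat.mod_lt _ hJ0
    set U := strongPartition (roundDensity κ N J k 0) E (P k) with hU
    set U' := strongPartition (roundDensity κ N J k 1) E (P (k + 1)) with hU'
    have hPs : P (k + 1) = strongPartition (mergeThreshold κ J k) (T k) (P k) := rfl
    have hPM : P k ≤ strongChain (κ * 2 ^ N / 2) E t :=
      ih1.trans (strongChain_mono hc E (Nat.div_le_div_right (Nat.sub_le k 1)))
    have hd0 : 0 ≤ roundDensity κ N J k 0 := by unfold roundDensity; positivity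
    have hUM : U ≤ strongChain (κ * 2 ^ N / 2) E t := by
      refine (strongOver_strongPartition _ E (P k)).le_of_strictSparse hd0 hPM
        ((sparseOn_strongPartition _ E ⊥).strict ?_)
      unfold roundDensity
      have h1 : 0 < κ * (2 ^ N / 2 ^ t) := by positivity
      have h2 : κ * 2 ^ N / 2 / 2 ^ t = κ * (2 ^ N / 2 ^ t) / 2 := by field_simp
      have h3 : (0 : ℝ) ≤ ((k % J : ℕ) + (0 : ℕ) : ℝ) / J := by positivity
      rw [h2]
      nlinarith
    have hPU : P (k + 1) ≤ U := by
      rw [hPs]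
      exact (strongOver_strongPartition _ (T k) (P k)).le_of_strictSparse
        (by unfold mergeThreshold; positivity) (le_strongPartition _ _ _) hg1
    have hU'U : U' ≤ U := by
      refine (strongOver_strongPartition _ E (P (k + 1))).le_of_strictSparse
        (by unfold roundDensity; positivity) hPU ((sparseOn_strongPartition _ E (P k)).strict ?_)
      unfold roundDensity
      refine mul_lt_mul_of_pos_left ?_ (by positivity)
      gcongr
      norm_num
    have hPU' : P (k + 1) ≤ U' := le_strongPartition _ _ _
    -- Otherwise the interval from P (k + 1) to U' is long. It is dense in E because U' is strong,
    -- yet sparse in the sample because P (k + 1) minimises there; `RoundGood` excludes this.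
    have hhalf : 2 * (numClasses (P (k + 1)) - numClasses U') ≤ numClasses (P k) - numClasses U := by
      by_contra hcon
      refine hg2 ⟨(P (k + 1), U'), ⟨le_strongPartition _ _ _, hPU', hU'U⟩, ?_, ?_, ?_⟩
      · have h1 := numClasses_anti hPU'
        have h2 := numClasses_anti ((le_strongPartition _ _ _ : P k ≤ U))
        simp only
        omega
      · exact (strongOver_strongPartition (roundDensity κ N J k 1) E (P (k + 1))).2 _ le_rfl hPU'
      · exact sparseOn_strongPartition (mergeThreshold κ J k) (T k) (P k) U' hPU'
    have hhalf' : (numClasses (P (k + 1)) - numClasses U') * 2 ^ (j + 1) ≤ Fintype.card V := by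
      refine le_trans ?_ ih2
      rw [pow_succ]
      nlinarith [Nat.mul_le_mul_right (2 ^ j) hhalf]
    refine ⟨hPU.trans hUM, ?_⟩
    by_cases hlast : j + 1 < J
    · have hdiv : (k + 1) / J = t := by
        rw [hkt, show J * t + j + 1 = j + 1 + J * t by ring, Nat.add_mul_div_left _ _ hJ0,
          Nat.div_eq_of_lt hlast, zero_add]
      have hmod : (k + 1) % J = j + 1 := by
        rw [hkt, show J * t + j + 1 = j + 1 + J * t by ring, Nat.add_mul_mod_self_left,
          Nat.mod_eq_of_lt hlast]
      have hden : roundDensity κ N J (k + 1) 0 = roundDensity κ N J k 1 := by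
        unfold roundDensity
        rw [hdiv, hmod, ← ht, ← hj]
        push_cast; ring
      rw [hden, hmod]
      exact ⟨hhalf', fun h => absurd h (by omega)⟩
    · have hjJ' : j + 1 = J := by omega
      have hkk : k + 1 = J * (t + 1) := by rw [mul_add, mul_one]; omega
      have hdiv : (k + 1) / J = t + 1 := by rw [hkk, Nat.mul_div_cancel_left _ hJ0]
      have hmod : (k + 1) % J = 0 := by rw [hkk, Nat.mul_mod_right]
      rw [hmod, hdiv]
      refine ⟨?_, fun _ => ?_⟩
      · have := numClasses_le_card (P (k + 1))
        rw [pow_zero, mul_one]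
        omega
      · have hzero : numClasses (P (k + 1)) - numClasses U' = 0 := by
          rw [hjJ'] at hhalf'
          by_contra hne
          have : 1 * 2 ^ J ≤ (numClasses (P (k + 1)) - numClasses U') * 2 ^ J :=
            Nat.mul_le_mul_right _ (by omega)
          omega
        have heq : P (k + 1) = U' := eq_of_numClasses_le hPU' (by omega)
        have hsp : SparseOn E (roundDensity κ N J k 1) U' := sparseOn_strongPartition _ E _
        -- In the last round the density has risen to 2κ 2^N / 2^t, which is the initial density of
        -- the next level.
        have hval : roundDensity κ N J k 1 = 4 * (κ * (2 ^ N / 2 ^ (t + 1))) := by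
          unfold roundDensity
          rw [← ht, ← hj]
          have h1 : ((j : ℝ) + ((1 : ℕ) : ℝ)) / J = 1 := by
            rw [div_eq_one_iff_eq hJr.ne']; exact_mod_cast hjJ'
          rw [h1, pow_succ]
          field_simp
          norm_num
        rw [heq, ← hval]
        exact hsp

end Rounds

/-! ### Probability that a single round, or a level sample, misbehaves. -/

section RoundProbability

/-- The seeds sampled at level `t`. -/
def levelSet (N t : ℕ) (a : Fin (2 ^ N)) : Prop := a.val < 2 ^ t

theorem pr_levelSet {N t : ℕ} (ht : t ≤ N) : pr (levelSet N t) = 2 ^ t / 2 ^ N := by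
  have hle : 2 ^ t ≤ 2 ^ N := Nat.pow_le_pow_right (by norm_num) ht
  have : (univ.filter (levelSet N t)).card = 2 ^ t := by
    rw [← Fintype.card_subtype, ← Nat.card_eq_fintype_card]
    have e : {a : Fin (2 ^ N) // levelSet N t a} ≃ Fin (2 ^ t) :=
      ⟨fun a => ⟨a.1.1, a.2⟩, fun b => ⟨⟨b.1, b.2.trans_le hle⟩, b.2⟩, fun a => rfl, fun b => rfl⟩
    rw [Nat.card_congr e, Nat.card_fin]
  unfold pr
  rw [this, Fintype.card_fin]
  push_cast; rfl

variable {V : Type} [Fintype V] [Nonempty V]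

theorem exp_sub_one_le {y : ℝ} (h0 : 0 ≤ y) (h1 : y ≤ 1) : Real.exp y - 1 ≤ y + y ^ 2 := by
  have := (abs_le.1 (Real.abs_exp_sub_one_sub_id_le (x := y) (by rw [abs_of_nonneg h0]; exact h1))).2
  linarith

theorem one_sub_exp_neg_ge {y : ℝ} (h0 : 0 ≤ y) (h1 : y ≤ 1) :
    y - y ^ 2 ≤ 1 - Real.exp (-y) := by
  have := (abs_le.1 (Real.abs_exp_sub_one_sub_id_le (x := -y)
    (by rw [abs_neg, abs_of_nonneg h0]; exact h1))).2
  rw [neg_sq] at this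
  linarith

theorem pr_not_roundGood_le {κ : ℝ} (hκ : 0 < κ) {N J k : ℕ} (hk : k / J ≤ N) (hJ : 0 < J)
    (E : Finset (Finset V)) (P : Setoid V) {L A : ℝ} (hL : (Fintype.card V : ℝ) ≤ Real.exp L)
    (hA : 0 ≤ A) (hβ : 8 * L + 2 * A ≤ κ / (32 * J ^ 2)) :
    pr (fun ω : Finset V → Fin (2 ^ N) =>
      ¬ RoundGood κ N J E (sample E (levelSet N (k / J)) ω) k P) ≤
      (Fintype.card V + 1) * Real.exp (-A) := by
  have hL0 : 0 ≤ L := by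
    rw [← Real.one_le_exp_iff]
    refine le_trans ?_ hL
    exact_mod_cast Fintype.card_pos
  have hJr : (1 : ℝ) ≤ J := by exact_mod_cast hJ
  have hJ0 : (0 : ℝ) < J := by linarith
  have hj : ((k % J : ℕ) : ℝ) + 1 ≤ J := by exact_mod_cast Nat.mod_lt k hJ
  have hj0 : (0 : ℝ) ≤ ((k % J : ℕ) : ℝ) := Nat.cast_nonneg _
  -- The threshold lies κ/(2J) away from both scaled densities. The gain yκ/(2J) = 4κy² exceeds the
  -- second-order loss, at most 2κy², and leaves 2κy² = κ/(32J²).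
  set y : ℝ := 1 / (8 * J) with hy
  have hy0 : 0 ≤ y := by positivity
  have hy1 : y ≤ 1 := by
    rw [hy, div_le_one (by positivity)]; linarith
  have hden : ∀ i, pr (levelSet N (k / J)) * roundDensity κ N J k i =
      κ * (1 + ((k % J : ℕ) + i : ℝ) / J) := by
    intro i
    rw [pr_levelSet hk, roundDensity]
    field_simp
  have hyJ : y * J = 1 / 8 := by rw [hy]; field_simp
  have hbeta : κ / (32 * J ^ 2) = κ * (2 * y ^ 2) := by
    rw [hy]; field_simp; norm_num
  have hgap : y * (1 / (2 * J)) = 4 * y ^ 2 := by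
    rw [hy]; field_simp; norm_num
  have hθ : mergeThreshold κ J k = κ * (1 + ((k % J : ℕ) : ℝ) / J + 1 / (2 * J)) := by
    unfold mergeThreshold; congr 1; field_simp; ring
  have hr : ((k % J : ℕ) : ℝ) / J + 1 / J ≤ 1 := by
    rw [← add_div, div_le_one hJ0]; exact hj
  have hr0 : 0 ≤ ((k % J : ℕ) : ℝ) / J := by positivity
  have hJi : 0 < 1 / (J : ℝ) := by positivity
  have h1 := pr_not_strictSparseOn_sample_le E (levelSet N (k / J))
    (strongPartition (roundDensity κ N J k 0) E P) (y := y) (θ := mergeThreshold κ J k)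
    (β := κ / (32 * J ^ 2)) hL hA (by linarith)
    (sparseOn_strongPartition (roundDensity κ N J k 0) E P) hy0 (by
      rw [hden, hθ, hbeta]
      set r := ((k % J : ℕ) : ℝ) / J with hrdef
      have e1 := exp_sub_one_le hy0 hy1
      simp only [Nat.cast_zero, add_zero, ← hrdef]
      have e2 : κ * (1 + r) * (Real.exp y - 1) ≤ κ * (1 + r) * (y + y ^ 2) :=
        mul_le_mul_of_nonneg_left e1 (by positivity)
      have e3 : y * (κ * (1 + r + 1 / (2 * J))) = κ * (1 + r) * y + κ * (4 * y ^ 2) := by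
        rw [← hgap]; ring
      have e4 : κ * (1 + r) * y ^ 2 ≤ κ * (2 * y ^ 2) := by
        have : (1 + r) * y ^ 2 ≤ 2 * y ^ 2 :=
          mul_le_mul_of_nonneg_right (by linarith) (sq_nonneg y)
        nlinarith
      nlinarith)
  have h2 := pr_exists_interval_le E (levelSet N (k / J))
    (le_strongPartition (roundDensity κ N J k 0) E P) (y := y) (θ := mergeThreshold κ J k)
    (lam := roundDensity κ N J k 1) (β := κ / (32 * J ^ 2)) hL hA hβ hy0 (by
      rw [hden, hθ, hbeta]
      set r := ((k % J : ℕ) : ℝ) / J with hrdef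
      have e1 := one_sub_exp_neg_ge hy0 hy1
      have e0 : (((k % J : ℕ) : ℝ) + ((1 : ℕ) : ℝ)) / J = r + 1 / J := by
        rw [hrdef]; push_cast; ring
      rw [e0]
      have e2 : κ * (1 + (r + 1 / J)) * (y - y ^ 2) ≤ κ * (1 + (r + 1 / J)) * (1 - Real.exp (-y)) :=
        mul_le_mul_of_nonneg_left e1 (by positivity)
      have e3 : κ * (1 + (r + 1 / J)) * y - y * (κ * (1 + r + 1 / (2 * J))) = κ * (4 * y ^ 2) := by
        rw [← hgap]; field_simp; ring
      have e4 : κ * (1 + (r + 1 / J)) * y ^ 2 ≤ κ * (2 * y ^ 2) := by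
        have : (1 + (r + 1 / J)) * y ^ 2 ≤ 2 * y ^ 2 :=
          mul_le_mul_of_nonneg_right (by linarith) (sq_nonneg y)
        nlinarith
      nlinarith)
  refine le_trans (pr_mono ?_) ((pr_or_le _ _).trans (le_trans (add_le_add h1 h2)
    (le_of_eq (by ring))))
  intro ω hω
  unfold RoundGood at hω
  rw [not_and_or, not_not] at hω
  exact hω

/-- The expected density is at most 4κ, and 4(e - 1) < 8 leaves room for the Chernoff bound with y =
1. -/
theorem pr_not_sparseOn_level_le {κ : ℝ} (hκ : 0 < κ) {N t : ℕ} (ht : t ≤ N)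
    (E : Finset (Finset V)) {P : Setoid V} (hP : SparseOn E (4 * (κ * (2 ^ N / 2 ^ t))) P)
    {L A : ℝ} (hL : (Fintype.card V : ℝ) ≤ Real.exp L)
    (hA : 0 ≤ A) (hβ : 2 * L + A ≤ κ / 10) :
    pr (fun ω : Finset V → Fin (2 ^ N) => ¬ SparseOn (sample E (levelSet N t) ω) (8 * κ) P) ≤
      Fintype.card V * Real.exp (-A) := by
  refine le_trans (pr_mono ?_) (pr_not_strictSparseOn_sample_le E (levelSet N t) P
    (y := 1) (θ := 8 * κ) (β := κ / 10) hL hA hβ hP zero_le_one ?_)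
  · intro ω hω h
    exact hω h.sparse
  · rw [pr_levelSet ht]
    have h1 : (2 : ℝ) ^ t / 2 ^ N * (4 * (κ * (2 ^ N / 2 ^ t))) = 4 * κ := by field_simp
    rw [h1]
    have := Real.exp_one_lt_d9
    nlinarith

end RoundProbability

/-! ### The decoder and its exactness on good samples. -/

section Decoder

variable {V : Type} [Fintype V] [Nonempty V] {q K : ℕ}

/-- Recover a sparse set of edges crossing `s` from the measurements `Y`. -/
def decode (U : Finset (Finset V)) (θ : ℝ) (s : Setoid V) (u : Fin K → Finset V → V → ZMod q)
    (Y : Fin K → V → ZMod q) : Finset (Finset V) :=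
  if h : ∃ z, IsSparseCut U θ s z ∧ Compatible s u Y z then h.choose else ∅

/-- The measurements of a set of edges. -/
def measure (u : Fin K → Finset V → V → ZMod q) (T : Finset (Finset V)) (i : Fin K) (v : V) :
    ZMod q := ∑ e ∈ T, coeff (u i) e v

theorem classSum_measure (s : Setoid V) (u : Fin K → Finset V → V → ZMod q)
    (T : Finset (Finset V)) (i : Fin K) (b : Quotient s) :
    classSum s (measure u T i) b = ∑ e ∈ cutEdges T s, classSum s (coeff (u i) e) b := by
  unfold measure
  rw [classSum_sum, cutEdges, Finset.sum_filter]
  refine Finset.sum_congr rfl fun e _ => ?_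
  split_ifs with h
  · rfl
  · exact classSum_coeff_eq_zero h _ _

/-- Some other sparse set of edges is compatible with the measurements of `T`. -/
def Ambiguous (U : Finset (Finset V)) (θ : ℝ) (s : Setoid V) (T : Finset (Finset V))
    (u : Fin K → Finset V → V → ZMod q) : Prop :=
  ∃ z', z' ≠ cutEdges T s ∧ IsSparseCut U θ s z' ∧ ∀ i b,
    ∑ e ∈ z', classSum s (coeff (u i) e) b = ∑ e ∈ cutEdges T s, classSum s (coeff (u i) e) b

theorem isSparseCut_cutEdges {U T : Finset (Finset V)} {θ : ℝ} {s : Setoid V} (hT : T ⊆ U)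
    (hs : SparseOn T θ s) : IsSparseCut U θ s (cutEdges T s) := by
  refine ⟨(Finset.filter_subset _ _).trans hT, fun e he => (Finset.mem_filter.1 he).2,
    fun t ht => le_trans ?_ (hs t ht)⟩
  exact_mod_cast Finset.card_le_card (Finset.filter_subset_filter _ (Finset.filter_subset _ _))

theorem decode_measure {U T : Finset (Finset V)} {θ : ℝ} {s : Setoid V}
    {u : Fin K → Finset V → V → ZMod q} (hT : T ⊆ U) (hs : SparseOn T θ s)
    (hu : ¬ Ambiguous U θ s T u) : decode U θ s u (measure u T) = cutEdges T s := by
  have hex : ∃ z, IsSparseCut U θ s z ∧ Compatible s u (measure u T) z :=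
    ⟨cutEdges T s, isSparseCut_cutEdges hT hs, fun i b => (classSum_measure s u T i b).symm⟩
  rw [decode, dif_pos hex]
  by_contra hne
  obtain ⟨h1, h2⟩ := hex.choose_spec
  exact hu ⟨_, hne, h1, fun i b => (h2 i b).trans (classSum_measure s u T i b)⟩

theorem pr_ambiguous_le [NeZero q] {U T : Finset (Finset V)} {θ : ℝ} {s : Setoid V} (hT : T ⊆ U)
    (hs : SparseOn T θ s) (hK : 2 * θ ≤ K) (hq : U.card ≤ q) :
    pr (Ambiguous (q := q) (K := K) U θ s T) ≤ 2 * (U.card / q) :=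
  pr_exists_compatible_le U s _ (isSparseCut_cutEdges hT hs) hK hq

/-- The chain of partitions computed by the decoder; the first component is the partition at the
start of the current level, relative to which the measurements are decoded. -/
def decodeChain (θ : ℕ → ℝ) (J : ℕ) (obs : ℕ → Setoid V → Finset (Finset V)) :
    ℕ → Setoid V × Setoid V
  | 0 => (⊥, ⊥)
  | k + 1 =>
    let p := decodeChain θ J obs k
    let b := if k % J = 0 then p.2 else p.1
    (b, strongPartition (θ k) (obs k b) p.2)

/-- Samples are decoded relative to the partition starting the level, because sparsity there need
not pass to coarser partitions. Edges crossing the current partition cross that one too, so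
`strongPartition_congr` applies. At multiples of `J` the first component is stale, and the second
one is used instead. -/
theorem decodeChain_eq (θ : ℕ → ℝ) {J : ℕ} (obs : ℕ → Setoid V → Finset (Finset V))
    (T : ℕ → Finset (Finset V)) {M : ℕ}
    (h : ∀ k < M, obs k (mergeChain θ T (k / J * J)) =
      cutEdges (T k) (mergeChain θ T (k / J * J))) :
    ∀ k ≤ M, (decodeChain θ J obs k).2 = mergeChain θ T k ∧
      (k % J ≠ 0 → (decodeChain θ J obs k).1 = mergeChain θ T (k / J * J)) := by
  intro k
  induction k with
  | zero => intro _; exact ⟨rfl, fun h => absurd (Nat.zero_mod J) h⟩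
  | succ k ih =>
    intro hk
    obtain ⟨ih1, ih2⟩ := ih (by omega)
    have hb : (if k % J = 0 then (decodeChain θ J obs k).2 else (decodeChain θ J obs k).1) =
        mergeChain θ T (k / J * J) := by
      split_ifs with h0
      · rw [ih1, Nat.div_mul_cancel (Nat.dvd_of_mod_eq_zero h0)]
      · exact ih2 h0
    simp only [decodeChain]
    rw [hb, ih1, h k (by omega)]
    refine ⟨?_, fun hne => ?_⟩
    · simp only [mergeChain]
      refine strongPartition_congr ?_
      have hle : mergeChain θ T (k / J * J) ≤ mergeChain θ T k :=
        mergeChain_mono θ T (Nat.div_mul_le_self k J)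
      ext e
      simp only [cutEdges, Finset.mem_filter]
      have := Cuts.mono hle (e := e)
      tauto
    · rw [Nat.succ_div_of_not_dvd fun hd => hne (Nat.mod_eq_zero_of_dvd hd)]

/-- The weights of the output: an edge crossing `Q t` but not `Q (t + 1)` is taken from the sample
`z t`. -/
def outputWeight (N : ℕ) (Q : ℕ → Setoid V) (z : ℕ → Finset (Finset V)) (e : Finset V) : ℝ :=
  ∑ t ∈ range (N + 1), if e ∈ z t ∧ (t < N → ¬ Cuts (Q (t + 1)) e) then 2 ^ N / 2 ^ t else 0

/-- The last partition crossed by `e`. -/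
def lastCut (N : ℕ) (Q : ℕ → Setoid V) (e : Finset V) : ℕ :=
  Nat.findGreatest (fun t => Cuts (Q t) e) N

/-- By monotonicity an edge crosses an initial segment of the partitions, so only the term of the
last one crossed survives, and its factor is the inverse sampling rate. -/
theorem outputWeight_eq {N : ℕ} {Q : ℕ → Setoid V} (hQ : Monotone Q) (hQ0 : Q 0 = ⊥)
    (E : Finset (Finset V)) (ω : Finset V → Fin (2 ^ N)) (e : Finset V) :
    outputWeight N Q (fun t => cutEdges (sample E (levelSet N t) ω) (Q t)) e =
      if e ∈ E ∧ Cuts ⊥ e then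
        sampleWeight (fun e => levelSet N (lastCut N Q e)) ω e else 0 := by
  unfold outputWeight
  simp only [cutEdges, sample, Finset.mem_filter]
  by_cases he : e ∈ E ∧ Cuts ⊥ e
  · rw [if_pos he]
    set τ := lastCut N Q e with hτ
    have hτN : τ ≤ N := Nat.findGreatest_le N
    have hcut : Cuts (Q τ) e :=
      Nat.findGreatest_spec (P := fun t => Cuts (Q t) e) (Nat.zero_le N) (by rw [hQ0]; exact he.2)
    have hnot : ∀ t, τ < t → t ≤ N → ¬ Cuts (Q t) e := fun t h1 h2 =>
      Nat.findGreatest_is_greatest h1 h2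
    rw [Finset.sum_eq_single τ]
    · unfold sampleWeight
      rw [pr_levelSet hτN, inv_div]
      refine if_congr ?_ rfl rfl
      constructor
      · rintro ⟨⟨⟨-, h⟩, -⟩, -⟩; exact h
      · intro h
        exact ⟨⟨⟨he.1, h⟩, hcut⟩, fun hlt => hnot _ (Nat.lt_succ_self τ) hlt⟩
    · intro t ht hne
      rw [if_neg]
      rintro ⟨⟨-, h1⟩, h2⟩
      have htN : t ≤ N := Nat.lt_succ_iff.1 (Finset.mem_range.1 ht)
      rcases lt_or_gt_of_ne hne with hlt | hgt
      · exact h2 (by omega) (hcut.mono (hQ hlt))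
      · exact hnot t hgt htN h1
    · intro h
      exact absurd (Finset.mem_range.2 (by omega)) h
  · rw [if_neg he]
    refine Finset.sum_eq_zero fun t _ => if_neg ?_
    rintro ⟨⟨⟨h1, -⟩, h2⟩, -⟩
    exact he ⟨h1, h2.mono bot_le⟩

/-- The decoder. Measurements `Sum.inl k` are those of the sample for the `k`-th merging round,
`Sum.inr t` those of the sample of level `t` for the output. -/
def recoverWeights (U : Finset (Finset V)) (κ : ℝ) (N J : ℕ)
    (u : Fin (N * J) ⊕ Fin (N + 1) → Fin K → Finset V → V → ZMod q)
    (Y : Fin (N * J) ⊕ Fin (N + 1) → Fin K → V → ZMod q) : Finset V → ℝ :=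
  let Q : ℕ → Setoid V := fun t => (decodeChain (mergeThreshold κ J) J (fun k b =>
    if h : k < N * J then decode U (8 * κ) b (u (Sum.inl ⟨k, h⟩)) (Y (Sum.inl ⟨k, h⟩)) else ∅)
      (t * J)).2
  outputWeight N Q fun t =>
    if h : t < N + 1 then decode U (8 * κ) (Q t) (u (Sum.inr ⟨t, h⟩)) (Y (Sum.inr ⟨t, h⟩)) else ∅

end Decoder

/-! ### Combining the random choices. -/

section Success

variable {V : Type} [Fintype V] [Nonempty V] {q K : ℕ}

/-- The random seeds of the samples for merging, the sample for the output, and the coefficients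
of the measurements. -/
abbrev SketchSeed (V : Type) (q K N J : ℕ) : Type :=
  (Fin (N * J) → Finset V → Fin (2 ^ N)) × (Finset V → Fin (2 ^ N)) ×
    (Fin (N * J) ⊕ Fin (N + 1) → Fin K → Finset V → V → ZMod q)

/-- The samples for merging, indexed by all natural numbers. -/
def mergeSamples {N J : ℕ} (E : Finset (Finset V)) (x : Fin (N * J) → Finset V → Fin (2 ^ N))
    (k : ℕ) : Finset (Finset V) :=
  if h : k < N * J then sample E (levelSet N (k / J)) (x ⟨k, h⟩) else ∅

/-- All samples. -/
def allSamples {N J : ℕ} (E : Finset (Finset V)) (x : Fin (N * J) → Finset V → Fin (2 ^ N))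
    (x' : Finset V → Fin (2 ^ N)) : Fin (N * J) ⊕ Fin (N + 1) → Finset (Finset V)
  | Sum.inl k => sample E (levelSet N (k / J)) (x k)
  | Sum.inr t => sample E (levelSet N t) x'

/-- The partition relative to which a sample is decoded. -/
def decodePartition {N J : ℕ} (κ : ℝ) (T : ℕ → Finset (Finset V)) :
    Fin (N * J) ⊕ Fin (N + 1) → Setoid V
  | Sum.inl k => mergeChain (mergeThreshold κ J) T (k / J * J)
  | Sum.inr t => mergeChain (mergeThreshold κ J) T (t * J)

/-- The samples for merging behave as they should. -/
def MergeGood {N J : ℕ} (κ : ℝ) (E : Finset (Finset V))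
    (x : Fin (N * J) → Finset V → Fin (2 ^ N)) : Prop :=
  ∀ k : Fin (N * J),
    RoundGood κ N J E (mergeSamples E x k) k
      (mergeChain (mergeThreshold κ J) (mergeSamples E x) k) ∧
    (SparseOn E (4 * (κ * (2 ^ N / 2 ^ (k.val / J))))
        (mergeChain (mergeThreshold κ J) (mergeSamples E x) (k / J * J)) →
      SparseOn (mergeSamples E x k) (8 * κ)
        (mergeChain (mergeThreshold κ J) (mergeSamples E x) (k / J * J)))

/-- The partition entering round k depends on earlier samples only, so sample k is fresh for it
despite the adaptivity. -/
theorem mergeChain_update {N J : ℕ} (κ : ℝ) (E : Finset (Finset V))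
    (x : Fin (N * J) → Finset V → Fin (2 ^ N)) (k : Fin (N * J)) (a : Finset V → Fin (2 ^ N))
    {i : ℕ} (hi : i ≤ k) :
    mergeChain (mergeThreshold κ J) (mergeSamples E (Function.update x k a)) i =
      mergeChain (mergeThreshold κ J) (mergeSamples E x) i := by
  refine mergeChain_congr _ fun l hl => ?_
  unfold mergeSamples
  split_ifs with h
  · rw [Function.update_of_ne]
    intro heq
    have := congrArg Fin.val heq
    simp only at this
    omega
  · rfl

theorem pr_not_mergeGood_le {N J : ℕ} {κ : ℝ} (hκ : 0 < κ) (hJ : 0 < J) (E : Finset (Finset V))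
    {L A : ℝ} (hL : (Fintype.card V : ℝ) ≤ Real.exp L) (hA : 0 ≤ A)
    (hβ : 8 * L + 2 * A ≤ κ / (32 * J ^ 2)) :
    pr (fun x : Fin (N * J) → Finset V → Fin (2 ^ N) => ¬ MergeGood κ E x) ≤
      (N * J) * ((2 * Fintype.card V + 1) * Real.exp (-A)) := by
  have hL0 : 0 ≤ L := by
    rw [← Real.one_le_exp_iff]
    refine le_trans ?_ hL
    exact_mod_cast Fintype.card_pos
  have hJr : (1 : ℝ) ≤ J := by exact_mod_cast hJ
  have hβ' : 2 * L + A ≤ κ / 10 := by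
    have : κ / (32 * J ^ 2) ≤ κ / 10 := by
      refine div_le_div_of_nonneg_left hκ.le (by norm_num) ?_
      nlinarith
    linarith
  have hround : ∀ k : Fin (N * J), pr (fun x : Fin (N * J) → Finset V → Fin (2 ^ N) =>
      ¬ (RoundGood κ N J E (mergeSamples E x k) k
        (mergeChain (mergeThreshold κ J) (mergeSamples E x) k) ∧
      (SparseOn E (4 * (κ * (2 ^ N / 2 ^ (k.val / J))))
          (mergeChain (mergeThreshold κ J) (mergeSamples E x) (k / J * J)) →
        SparseOn (mergeSamples E x k) (8 * κ)
          (mergeChain (mergeThreshold κ J) (mergeSamples E x) (k / J * J))))) ≤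
      (2 * Fintype.card V + 1) * Real.exp (-A) := by
    intro k
    have hkN : k.val / J ≤ N := (Nat.div_lt_of_lt_mul (lt_of_lt_of_eq k.2 (Nat.mul_comm N J))).le
    refine pr_pi_le k (by positivity) fun x => ?_
    set P := mergeChain (mergeThreshold κ J) (mergeSamples E x) k with hP
    set P' := mergeChain (mergeThreshold κ J) (mergeSamples E x) (k / J * J) with hP'
    have hsamp : ∀ a, mergeSamples E (Function.update x k a) k =
        sample E (levelSet N (k / J)) a := by
      intro a
      unfold mergeSamples
      rw [dif_pos k.2]
      simp
    have h1 := pr_not_roundGood_le hκ hkN hJ E P hL hA hβ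
    have h2 : pr (fun a : Finset V → Fin (2 ^ N) =>
        ¬ (SparseOn E (4 * (κ * (2 ^ N / 2 ^ (k.val / J)))) P' →
          SparseOn (sample E (levelSet N (k / J)) a) (8 * κ) P')) ≤
        Fintype.card V * Real.exp (-A) := by
      by_cases hs : SparseOn E (4 * (κ * (2 ^ N / 2 ^ (k.val / J)))) P'
      · refine le_trans (pr_mono ?_) (pr_not_sparseOn_level_le hκ hkN E hs hL hA hβ')
        intro a ha h
        exact ha fun _ => h
      · refine le_trans (le_of_eq (pr_eq_zero fun a ha => ha fun h => absurd h hs)) (by positivity)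
    refine le_trans (pr_mono ?_) ((pr_or_le _ _).trans (le_trans (add_le_add h1 h2)
      (le_of_eq (by ring))))
    intro a ha
    rw [mergeChain_update κ E x k a le_rfl,
      mergeChain_update κ E x k a (Nat.div_mul_le_self _ _), hsamp, not_and_or] at ha
    exact ha
  calc _ ≤ pr (fun x : Fin (N * J) → Finset V → Fin (2 ^ N) =>
        ∃ k ∈ (Finset.univ : Finset (Fin (N * J))), ¬ (RoundGood κ N J E (mergeSamples E x k) k
        (mergeChain (mergeThreshold κ J) (mergeSamples E x) k) ∧
      (SparseOn E (4 * (κ * (2 ^ N / 2 ^ (k.val / J))))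
          (mergeChain (mergeThreshold κ J) (mergeSamples E x) (k / J * J)) →
        SparseOn (mergeSamples E x k) (8 * κ)
          (mergeChain (mergeThreshold κ J) (mergeSamples E x) (k / J * J))))) := by
        refine pr_mono fun x hx => ?_
        unfold MergeGood at hx
        rw [not_forall] at hx
        obtain ⟨k, hk⟩ := hx
        exact ⟨k, Finset.mem_univ _, hk⟩
    _ ≤ ∑ k : Fin (N * J), (2 * Fintype.card V + 1) * Real.exp (-A) :=
        (pr_exists_le _ _).trans (Finset.sum_le_sum fun k _ => hround k)
    _ = _ := by simp

/-- The sample for the output behaves as it should. -/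
def OutputGood {N : ℕ} (κ ε : ℝ) (E : Finset (Finset V)) (Q : ℕ → Setoid V)
    (x : Finset V → Fin (2 ^ N)) : Prop :=
  (∀ t ≤ N, SparseOn (sample E (levelSet N t) x) (8 * κ) (Q t)) ∧
  ∀ s : Setoid V, |∑ e ∈ cutEdges E s,
    (sampleWeight (fun e => levelSet N (lastCut N Q e)) x e - 1)| ≤ ε * (cutEdges E s).card

theorem pr_not_outputGood_le {N : ℕ} {κ ε : ℝ} (hκ : 0 < κ) (hε : 0 < ε) (hε1 : ε ≤ 1)
    (E : Finset (Finset V)) {Q : ℕ → Setoid V}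
    (hsparse : ∀ t ≤ N, SparseOn E (4 * (κ * (2 ^ N / 2 ^ t))) (Q t))
    (hQ : ∀ t < N, Q (t + 1) ≤ strongChain (κ * 2 ^ N / 2) E t)
    {L A : ℝ} (hL : (Fintype.card V : ℝ) ≤ Real.exp L) (hA : 0 ≤ A)
    (hβ : 6 * L + 2 * A + 2 ≤ ε ^ 2 * κ / 32) :
    pr (fun x : Finset V → Fin (2 ^ N) => ¬ OutputGood κ ε E Q x) ≤
      (N + 1) * (3 * (Fintype.card V * Real.exp (-A))) := by
  have hL0 : 0 ≤ L := by
    rw [← Real.one_le_exp_iff]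
    refine le_trans ?_ hL
    exact_mod_cast Fintype.card_pos
  have hβ' : 2 * L + A ≤ κ / 10 := by
    have : ε ^ 2 * κ ≤ 1 * κ := mul_le_mul_of_nonneg_right (by nlinarith) hκ.le
    linarith
  have h1 : pr (fun x : Finset V → Fin (2 ^ N) => ∃ t ∈ Finset.range (N + 1),
      ¬ SparseOn (sample E (levelSet N t) x) (8 * κ) (Q t)) ≤
      (N + 1) * (Fintype.card V * Real.exp (-A)) := by
    refine (pr_exists_le _ _).trans ((Finset.sum_le_sum fun t ht => ?_).trans
      (le_of_eq (by simp : ∑ t ∈ Finset.range (N + 1),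
        (Fintype.card V * Real.exp (-A) : ℝ) = _)))
    have htN : t ≤ N := Nat.lt_succ_iff.1 (Finset.mem_range.1 ht)
    exact pr_not_sparseOn_level_le hκ htN E (hsparse t htN) hL hA hβ'
  -- An edge last cut at τ < N lies in a class of Q (τ + 1), hence in a component of strength c /
  -- 2^τ, and its inverse rate is R / 2^τ. If τ = N it is always kept.
  have h2 := pr_exists_bad_cut_le E (fun e => levelSet N (lastCut N Q e)) (c := κ * 2 ^ N / 2)
    (R := 2 ^ N) N (by positivity) (by positivity) hε hε1 hL hA (by
      have : κ * 2 ^ N / 2 / 2 ^ N = κ / 2 := by field_simp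
      rw [this]; linarith) (by
      intro e heE he
      have hτN : lastCut N Q e ≤ N := Nat.findGreatest_le N
      rcases eq_or_lt_of_le hτN with hτ | hτ
      · left
        intro a
        rw [hτ]
        exact a.2
      · right
        refine ⟨lastCut N Q e, hτN, ?_, ?_, ?_⟩
        · have hnot : ¬ Cuts (Q (lastCut N Q e + 1)) e :=
            Nat.findGreatest_is_greatest (P := fun t => Cuts (Q t) e) (Nat.lt_succ_self _) hτ
          exact fun h => hnot (h.mono (hQ _ hτ))
        · rw [pr_levelSet hτN]; positivity
        · rw [pr_levelSet hτN, inv_div])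
  refine le_trans (pr_mono ?_) ((pr_or_le _ _).trans (le_trans (add_le_add h1 h2)
    (le_of_eq (by ring))))
  intro x hx
  unfold OutputGood at hx
  rw [not_and_or] at hx
  rcases hx with hx | hx
  · left
    push Not at hx
    obtain ⟨t, ht, h⟩ := hx
    exact ⟨t, Finset.mem_range.2 (by omega), h⟩
  · right
    push Not at hx
    exact hx

/-- What the decoder has to achieve. -/
def IsGoodOutput (E : Finset (Finset V)) (ε : ℝ) (w : Finset V → ℝ) : Prop :=
  (∀ e, 0 ≤ w e) ∧ (∀ e, w e ≠ 0 → e ∈ E) ∧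
  ∀ s : Setoid V, |∑ e ∈ cutEdges univ s, w e - (cutEdges E s).card| ≤ ε * (cutEdges E s).card

/-- This is the deterministic part: every decoding is exact, so the decoder reproduces the true
chain and outputs the inverse-probability weights. -/
theorem isGoodOutput_recoverWeights {N J : ℕ} {κ ε : ℝ}
    {U E : Finset (Finset V)} (hEU : E ⊆ U) (x : Fin (N * J) → Finset V → Fin (2 ^ N))
    (x' : Finset V → Fin (2 ^ N)) (u : Fin (N * J) ⊕ Fin (N + 1) → Fin K → Finset V → V → ZMod q)
    (hsparse : ∀ i, SparseOn (allSamples E x x' i) (8 * κ)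
      (decodePartition κ (mergeSamples E x) i))
    (hgood : OutputGood κ ε E (fun t => mergeChain (mergeThreshold κ J) (mergeSamples E x) (t * J))
      x')
    (hu : ∀ i, ¬ Ambiguous U (8 * κ) (decodePartition κ (mergeSamples E x) i)
      (allSamples E x x' i) (u i)) :
    IsGoodOutput E ε (recoverWeights U κ N J u fun i => measure (u i) (allSamples E x x' i)) := by
  have hsub : ∀ i, allSamples E x x' i ⊆ U := by
    rintro (k | t)
    · exact (Finset.filter_subset _ _).trans hEU
    · exact (Finset.filter_subset _ _).trans hEU
  have hdec : ∀ i, decode U (8 * κ) (decodePartition κ (mergeSamples E x) i) (u i)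
      (measure (u i) (allSamples E x x' i)) =
      cutEdges (allSamples E x x' i) (decodePartition κ (mergeSamples E x) i) :=
    fun i => decode_measure (hsub i) (hsparse i) (hu i)
  set Q : ℕ → Setoid V := fun t =>
    mergeChain (mergeThreshold κ J) (mergeSamples E x) (t * J) with hQ
  have hQm : Monotone Q := fun a b h =>
    mergeChain_mono _ _ (Nat.mul_le_mul_right J h)
  have hQ0 : Q 0 = ⊥ := by simp [hQ, mergeChain]
  have hchain := decodeChain_eq (mergeThreshold κ J) (fun k b =>
    if h : k < N * J then decode U (8 * κ) b (u (Sum.inl ⟨k, h⟩))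
      (measure (u (Sum.inl ⟨k, h⟩)) (allSamples E x x' (Sum.inl ⟨k, h⟩))) else ∅)
    (mergeSamples E x) (M := N * J) (by
      intro k hk
      rw [dif_pos hk]
      have := hdec (Sum.inl ⟨k, hk⟩)
      simp only [decodePartition] at this
      rw [this]
      simp only [allSamples, mergeSamples, dif_pos hk])
  have hw : recoverWeights U κ N J u (fun i => measure (u i) (allSamples E x x' i)) =
      outputWeight N Q fun t => cutEdges (sample E (levelSet N t) x') (Q t) := by
    funext e
    simp only [recoverWeights, outputWeight]
    refine Finset.sum_congr rfl fun t ht => ?_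
    have htN : t < N + 1 := Finset.mem_range.1 ht
    have hQt : ∀ t ≤ N, (decodeChain (mergeThreshold κ J) J (fun k b =>
        if h : k < N * J then decode U (8 * κ) b (u (Sum.inl ⟨k, h⟩))
          (measure (u (Sum.inl ⟨k, h⟩)) (allSamples E x x' (Sum.inl ⟨k, h⟩))) else ∅)
        (t * J)).2 = Q t := fun t ht => (hchain _ (Nat.mul_le_mul_right J ht)).1
    have h1 := hdec (Sum.inr ⟨t, htN⟩)
    simp only [decodePartition] at h1
    rw [dif_pos htN, hQt t (by omega), h1]
    refine if_congr (and_congr Iff.rfl ?_) rfl rfl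
    refine forall_congr' fun hlt => ?_
    rw [hQt (t + 1) hlt]
  rw [hw]
  have hval := outputWeight_eq hQm hQ0 E x'
  refine ⟨fun e => ?_, fun e he => ?_, fun s => ?_⟩
  · rw [hval]
    unfold sampleWeight
    split_ifs
    · exact inv_nonneg.2 (pr_nonneg _)
    · exact le_rfl
    · exact le_rfl
  · rw [hval] at he
    by_contra hE
    exact he (if_neg fun h => hE h.1)
  · have h1 : ∑ e ∈ cutEdges univ s, outputWeight N Q
        (fun t => cutEdges (sample E (levelSet N t) x') (Q t)) e - (cutEdges E s).card =
        ∑ e ∈ cutEdges E s, (sampleWeight (fun e => levelSet N (lastCut N Q e)) x' e - 1) := by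
      rw [Finset.sum_sub_distrib, Finset.sum_const, nsmul_eq_mul, mul_one]
      congr 1
      have hsub : cutEdges E s ⊆ cutEdges univ s :=
        Finset.filter_subset_filter _ (Finset.subset_univ E)
      rw [← Finset.sum_subset hsub]
      · refine Finset.sum_congr rfl fun e he => ?_
        rw [hval, if_pos ⟨(Finset.mem_filter.1 he).1, (Finset.mem_filter.1 he).2.mono bot_le⟩]
      · intro e he hne
        rw [hval, if_neg]
        rintro ⟨h, -⟩
        exact hne (Finset.mem_filter.2 ⟨h, (Finset.mem_filter.1 he).2⟩)
    rw [h1]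
    exact hgood.2 s

/-- The randomness is exposed in the order merging samples, output sample, code. The true partitions
do not depend on the code, so ambiguity is bounded at one fixed partition per sample, with no union
over partitions. -/
theorem pr_not_isGoodOutput_le [NeZero q] {N J : ℕ} {κ ε : ℝ} (hκ : 0 < κ) (hε : 0 < ε)
    (hε1 : ε ≤ 1) (hJ : Fintype.card V < 2 ^ J) {U E : Finset (Finset V)} (hEU : E ⊆ U)
    (hE : (E.card : ℝ) ≤ 4 * κ * 2 ^ N) (hK : 2 * (8 * κ) ≤ K) (hq : U.card ≤ q)
    {L A : ℝ} (hL : (Fintype.card V : ℝ) ≤ Real.exp L) (hA : 0 ≤ A)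
    (hβ : 8 * L + 2 * A ≤ κ / (32 * J ^ 2)) (hβ' : 6 * L + 2 * A + 2 ≤ ε ^ 2 * κ / 32) :
    pr (fun ω : SketchSeed V q K N J => ¬ IsGoodOutput E ε
      (recoverWeights U κ N J ω.2.2 fun i => measure (ω.2.2 i) (allSamples E ω.1 ω.2.1 i))) ≤
      (N * J) * ((2 * Fintype.card V + 1) * Real.exp (-A)) +
      ((N + 1) * (3 * (Fintype.card V * Real.exp (-A))) +
      (N * J + (N + 1)) * (2 * (U.card / q))) := by
  have hJ0 : 0 < J := by
    rcases Nat.eq_zero_or_pos J with rfl | h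
    · have := Fintype.card_pos (α := V); omega
    · exact h
  set Q : (Fin (N * J) → Finset V → Fin (2 ^ N)) → ℕ → Setoid V := fun x t =>
    mergeChain (mergeThreshold κ J) (mergeSamples E x) (t * J) with hQ
  have hinv : ∀ x : Fin (N * J) → Finset V → Fin (2 ^ N), MergeGood κ E x →
      (∀ t ≤ N, SparseOn E (4 * (κ * (2 ^ N / 2 ^ t))) (Q x t)) ∧
      (∀ t < N, Q x (t + 1) ≤ strongChain (κ * 2 ^ N / 2) E t) ∧
      ∀ k : Fin (N * J), SparseOn (mergeSamples E x k) (8 * κ) (Q x (k / J)) := by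
    intro x hx
    have h := mergeChain_invariant hκ hJ hE (mergeSamples E x) (M := N * J)
      (fun k hk => (hx ⟨k, hk⟩).1)
    have h1 : ∀ t ≤ N, SparseOn E (4 * (κ * (2 ^ N / 2 ^ t))) (Q x t) := by
      intro t ht
      have := (h (t * J) (Nat.mul_le_mul_right J ht)).2.2 (Nat.mul_mod_left t J)
      rwa [Nat.mul_div_cancel t hJ0] at this
    refine ⟨h1, fun t ht => ?_, fun k => (hx k).2 (h1 _ ?_)⟩
    · have := (h ((t + 1) * J) (Nat.mul_le_mul_right J ht)).1
      have hdiv : ((t + 1) * J - 1) / J = t := by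
        rw [add_mul, one_mul, Nat.add_sub_assoc hJ0, add_comm, Nat.add_mul_div_right _ _ hJ0,
          Nat.div_eq_of_lt (by omega), zero_add]
      rwa [hdiv] at this
    · exact (Nat.div_lt_of_lt_mul (lt_of_lt_of_eq k.2 (Nat.mul_comm N J))).le
  have hsp : ∀ x : Fin (N * J) → Finset V → Fin (2 ^ N), MergeGood κ E x →
      ∀ x' : Finset V → Fin (2 ^ N), OutputGood κ ε E (Q x) x' →
      ∀ i, SparseOn (allSamples E x x' i) (8 * κ) (decodePartition κ (mergeSamples E x) i) := by
    rintro x hx x' hx' (k | t)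
    · have := (hinv x hx).2.2 k
      simp only [mergeSamples, dif_pos k.2] at this
      exact this
    · exact hx'.1 t (Nat.lt_succ_iff.1 t.2)
  have hb1 : pr (fun ω : SketchSeed V q K N J => ¬ MergeGood κ E ω.1) ≤
      (N * J) * ((2 * Fintype.card V + 1) * Real.exp (-A)) :=
    pr_prod_le' (by positivity) fun _ => pr_not_mergeGood_le hκ hJ0 E hL hA hβ
  have hb2 : pr (fun ω : SketchSeed V q K N J => MergeGood κ E ω.1 ∧
      ¬ OutputGood κ ε E (Q ω.1) ω.2.1) ≤ (N + 1) * (3 * (Fintype.card V * Real.exp (-A))) := by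
    refine pr_prod_le (by positivity) fun x => pr_prod_le' (by positivity) fun u => ?_
    by_cases hx : MergeGood κ E x
    · obtain ⟨h1, h2, -⟩ := hinv x hx
      refine le_trans (pr_mono fun x' h => h.2) (pr_not_outputGood_le (Q := Q x) hκ hε hε1 E
        h1 h2 hL hA hβ')
    · exact le_trans (le_of_eq (pr_eq_zero fun x' h => hx h.1)) (by positivity)
  have hb3 : pr (fun ω : SketchSeed V q K N J => MergeGood κ E ω.1 ∧
      OutputGood κ ε E (Q ω.1) ω.2.1 ∧ ∃ i ∈ (Finset.univ : Finset (Fin (N * J) ⊕ Fin (N + 1))),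
        Ambiguous U (8 * κ) (decodePartition κ (mergeSamples E ω.1) i)
          (allSamples E ω.1 ω.2.1 i) (ω.2.2 i)) ≤ (N * J + (N + 1)) * (2 * (U.card / q)) := by
    refine pr_prod_le (by positivity) fun x => pr_prod_le (by positivity) fun x' => ?_
    by_cases hx : MergeGood κ E x ∧ OutputGood κ ε E (Q x) x'
    · have hs := hsp x hx.1 x' hx.2
      refine le_trans (pr_mono fun u h => h.2.2) ((pr_exists_le _ _).trans
        ((Finset.sum_le_sum fun i _ => ?_).trans (le_of_eq (by simp :
          ∑ i : Fin (N * J) ⊕ Fin (N + 1), (2 * (U.card / q) : ℝ) = _))))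
      refine pr_pi_le i (by positivity) fun u => ?_
      simp only [Function.update_self]
      refine pr_ambiguous_le ?_ (hs i) hK hq
      rcases i with k | t
      · exact (Finset.filter_subset _ _).trans hEU
      · exact (Finset.filter_subset _ _).trans hEU
    · exact le_trans (le_of_eq (pr_eq_zero fun u h => hx ⟨h.1, h.2.1⟩)) (by positivity)
  refine le_trans (pr_mono ?_) ((pr_or_le _ _).trans (add_le_add hb1
    ((pr_or_le _ _).trans (add_le_add hb2 hb3))))
  rintro ⟨x, x', u⟩ hω
  by_cases h1 : MergeGood κ E x
  · by_cases h2 : OutputGood κ ε E (Q x) x'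
    · right; right
      refine ⟨h1, h2, ?_⟩
      by_contra hcon
      push Not at hcon
      exact hω (isGoodOutput_recoverWeights hEU x x' u (hsp x h1 x' h2) h2
        fun i => hcon i (Finset.mem_univ i))
    · exact Or.inr (Or.inl ⟨h1, h2⟩)
  · exact Or.inl h1

end Success

/-! ### The integer matrix: residues as entries, reduction mod q. -/

section Entries

variable {V : Type} [Fintype V] [Nonempty V] {q K N J : ℕ}

/-- The measurements: one for each sample, each code word and each vertex. -/
abbrev SketchRow (V : Type) (K N J : ℕ) : Type := (Fin (N * J) ⊕ Fin (N + 1)) × Fin K × V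

/-- The uniform distribution on seeds. -/
def seedLaw (V : Type) [Fintype V] (q K N J : ℕ) [NeZero q] : PMF (SketchSeed V q K N J) :=
  PMF.uniformOfFintype _

theorem toReal_uniformOfFintype {Ω : Type} [Fintype Ω] [Nonempty Ω] (P : Ω → Prop) :
    ((PMF.uniformOfFintype Ω).toOuterMeasure {ω | P ω}).toReal = pr P := by
  rw [PMF.toOuterMeasure_uniformOfFintype_apply, ENNReal.toReal_div, pr]
  simp only [ENNReal.toReal_natCast, Set.coe_ofPred, Fintype.card_subtype]

theorem one_sub_le_seedLaw [NeZero q] {P : SketchSeed V q K N J → Prop} {δ : ℝ}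
    (h : pr (fun ω => ¬ P ω) ≤ δ) :
    1 - δ ≤ ((seedLaw V q K N J).toOuterMeasure {ω | P ω}).toReal := by
  rw [seedLaw, toReal_uniformOfFintype]
  linarith [pr_add_pr_not P]

/-- The entries of the sketching matrix. -/
def sketchEntry (ω : SketchSeed V q K N J) (j : SketchRow V K N J) (e : Finset V) : ℤ :=
  if e ∈ allSamples univ ω.1 ω.2.1 j.1 then ((coeff (ω.2.2 j.1 j.2.1) e j.2.2).val : ℤ) else 0

theorem mem_allSamples {E : Finset (Finset V)} (ω : SketchSeed V q K N J)
    (i : Fin (N * J) ⊕ Fin (N + 1)) (e : Finset V) :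
    e ∈ allSamples E ω.1 ω.2.1 i ↔ e ∈ E ∧ e ∈ allSamples univ ω.1 ω.2.1 i := by
  rcases i with k | t <;> simp [allSamples, sample]

theorem sum_sketchEntry {E : Finset (Finset V)} {x : Finset V → ℤ} (h1 : ∀ e ∈ E, x e = 1)
    (h0 : ∀ e ∉ E, x e = 0) (ω : SketchSeed V q K N J) (j : SketchRow V K N J) :
    ∑ e, sketchEntry ω j e * x e = ∑ e ∈ allSamples E ω.1 ω.2.1 j.1,
      ((coeff (ω.2.2 j.1 j.2.1) e j.2.2).val : ℤ) := by
  rw [← Finset.sum_subset (Finset.subset_univ (allSamples E ω.1 ω.2.1 j.1))]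
  · refine Finset.sum_congr rfl fun e he => ?_
    have h := (mem_allSamples ω j.1 e).1 he
    rw [sketchEntry, if_pos h.2, h1 e h.1, mul_one]
  · intro e _ he
    by_cases hE : e ∈ E
    · rw [sketchEntry, if_neg fun h => he ((mem_allSamples ω j.1 e).2 ⟨hE, h⟩), zero_mul]
    · rw [h0 e hE, mul_zero]

theorem abs_sum_sketchEntry_lt [NeZero q] {E : Finset (Finset V)} {x : Finset V → ℤ}
    (h1 : ∀ e ∈ E, x e = 1) (h0 : ∀ e ∉ E, x e = 0) (ω : SketchSeed V q K N J)
    (j : SketchRow V K N J) {a : ℕ} (ha : 0 < a) (hE : E.card ≤ a) :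
    |∑ e, sketchEntry ω j e * x e| < a * q := by
  rw [sum_sketchEntry h1 h0, abs_of_nonneg (Finset.sum_nonneg fun _ _ => Int.natCast_nonneg _)]
  have hsub : allSamples E ω.1 ω.2.1 j.1 ⊆ E := fun e he => ((mem_allSamples ω j.1 e).1 he).1
  have hq : 0 < q := Nat.pos_of_ne_zero (NeZero.ne q)
  have hle : ∑ e ∈ allSamples E ω.1 ω.2.1 j.1, (coeff (ω.2.2 j.1 j.2.1) e j.2.2).val ≤
      a * (q - 1) := by
    refine (Finset.sum_le_card_nsmul _ _ (q - 1) fun e _ => ?_).trans ?_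
    · exact Nat.le_sub_one_of_lt (ZMod.val_lt _)
    · exact Nat.mul_le_mul_right _ ((Finset.card_le_card hsub).trans hE)
  have hlt : a * (q - 1) < a * q := Nat.mul_lt_mul_of_pos_left (by omega) ha
  exact_mod_cast hle.trans_lt hlt

theorem cast_sum_sketchEntry [NeZero q] {E : Finset (Finset V)} {x : Finset V → ℤ}
    (h1 : ∀ e ∈ E, x e = 1) (h0 : ∀ e ∉ E, x e = 0) (ω : SketchSeed V q K N J)
    (i : Fin (N * J) ⊕ Fin (N + 1)) (a : Fin K) (v : V) :
    ((∑ e, sketchEntry ω (i, a, v) e * x e : ℤ) : ZMod q) =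
      measure (ω.2.2 i) (allSamples E ω.1 ω.2.1 i) a v := by
  rw [sum_sketchEntry h1 h0]
  push_cast
  simp only [ZMod.natCast_zmod_val, measure]

end Entries

/-! ### The sketch as a structure, and translation to k-cuts. -/

section Sketch

variable {n : ℕ}

/-- The sketch with given parameters; `U` is the set of admissible edges and `w` the width of all
registers. -/
def linearSketch (n q K N J w : ℕ) [Nonempty (Fin n)] [NeZero q] (κ : ℝ)
    (U : Finset (Finset (Fin n))) :
    RandomizedLinearSketch n where
  Seed := SketchSeed (Fin n) q K N J
  law := seedLaw (Fin n) q K N J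
  rows := Fintype.card (SketchRow (Fin n) K N J)
  matrix ω j e := sketchEntry ω ((Fintype.equivFin (SketchRow (Fin n) K N J)).symm j) e
  width _ := w
  recover ω y := recoverWeights U κ N J ω.2.2 fun i a v =>
    ((y (Fintype.equivFin (SketchRow (Fin n) K N J) (i, a, v)) : ℤ) : ZMod q)

theorem bits_linearSketch [Nonempty (Fin n)] (q K N J w : ℕ) [NeZero q] (κ : ℝ)
    (U : Finset (Finset (Fin n))) :
    (linearSketch n q K N J w κ U).bits = (N * J + (N + 1)) * (K * n) * (w + 1) := by
  have h : Fintype.card (SketchRow (Fin n) K N J) = (N * J + (N + 1)) * (K * n) := by simp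
  rw [← h]
  simp only [RandomizedLinearSketch.bits, linearSketch, Finset.sum_const, smul_eq_mul]
  exact congrArg (· * (w + 1)) (Finset.card_fin _)

theorem toVec_of_mem {H : Hypergraph (Fin n)} : ∀ e ∈ edges H, toVec H e = 1 :=
  fun _ he => if_pos he

theorem toVec_of_notMem {H : Hypergraph (Fin n)} : ∀ e ∉ edges H, toVec H e = 0 :=
  fun _ he => if_neg he

theorem fits_linearSketch [Nonempty (Fin n)] {q K N J w : ℕ} [NeZero q] {κ : ℝ}
    {U : Finset (Finset (Fin n))} {H : Hypergraph (Fin n)} {a : ℕ} (ha : 0 < a)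
    (hH : (edges H).card ≤ a) (hw : a * q ≤ 2 ^ w) : (linearSketch n q K N J w κ U).Fits H :=
  fun ω j => (abs_sum_sketchEntry_lt toVec_of_mem toVec_of_notMem ω
    ((Fintype.equivFin (SketchRow (Fin n) K N J)).symm j) ha hH).trans_le (by exact_mod_cast hw)

theorem sketch_linearSketch [Nonempty (Fin n)] (q K N J w : ℕ) [NeZero q] (κ : ℝ)
    (U : Finset (Finset (Fin n))) (H : Hypergraph (Fin n)) (ω : SketchSeed (Fin n) q K N J)
    (j : Fin (Fintype.card (SketchRow (Fin n) K N J))) :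
    (linearSketch n q K N J w κ U).sketch ω H j = ∑ e,
      sketchEntry ω ((Fintype.equivFin (SketchRow (Fin n) K N J)).symm j) e * toVec H e := rfl

theorem recover_linearSketch [Nonempty (Fin n)] (q K N J w : ℕ) [NeZero q] (κ : ℝ)
    (U : Finset (Finset (Fin n))) (ω : SketchSeed (Fin n) q K N J)
    (y : Fin (Fintype.card (SketchRow (Fin n) K N J)) → ℤ) :
    (linearSketch n q K N J w κ U).recover ω y = recoverWeights U κ N J ω.2.2 fun i a v =>
      ((y (Fintype.equivFin (SketchRow (Fin n) K N J) (i, a, v)) : ℤ) : ZMod q) := rfl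

theorem output_linearSketch [Nonempty (Fin n)] (q K N J w : ℕ) [NeZero q] (κ : ℝ)
    (U : Finset (Finset (Fin n))) (H : Hypergraph (Fin n)) (ω : SketchSeed (Fin n) q K N J) :
    (linearSketch n q K N J w κ U).output ω H = recoverWeights U κ N J ω.2.2 fun i =>
      measure (ω.2.2 i) (allSamples (edges H) ω.1 ω.2.1 i) := by
  refine (recover_linearSketch q K N J w κ U ω
    ((linearSketch n q K N J w κ U).sketch ω H)).trans ?_
  congr 1
  funext i a v
  rw [sketch_linearSketch, Equiv.symm_apply_apply]
  exact cast_sum_sketchEntry toVec_of_mem toVec_of_notMem ω i a v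

theorem successProb_linearSketch [Nonempty (Fin n)] (q K N J w : ℕ) [NeZero q] (κ : ℝ)
    (U : Finset (Finset (Fin n))) (H : Hypergraph (Fin n)) (good : (Finset (Fin n) → ℝ) → Prop) :
    (linearSketch n q K N J w κ U).successProb H good =
      ((seedLaw (Fin n) q K N J).toOuterMeasure {ω | good (recoverWeights U κ N J ω.2.2 fun i =>
        measure (ω.2.2 i) (allSamples (edges H) ω.1 ω.2.1 i))}).toReal :=
  congrArg (fun s : Set (SketchSeed (Fin n) q K N J) =>
    ((seedLaw (Fin n) q K N J).toOuterMeasure s).toReal)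
    (Set.ext fun ω => iff_of_eq (congrArg good (output_linearSketch q K N J w κ U H ω)))

/-- The hypothesis 0 < k matters for the empty hyperedge, which must lie in some part. -/
theorem crosses_iff {k : ℕ} (hk : 0 < k) (f : Fin n → Fin k) (e : Finset (Fin n)) :
    Crosses f e ↔ Cuts (Setoid.ker f) e := by
  rw [Cuts, contract_le_iff, Crosses, ← not_exists, not_iff_not]
  constructor
  · rintro ⟨i, hi⟩ x hx y hy
    exact (hi x hx).trans (hi y hy).symm
  · intro h
    rcases e.eq_empty_or_nonempty with rfl | ⟨x, hx⟩
    · exact ⟨⟨0, hk⟩, by simp⟩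
    · exact ⟨f x, fun v hv => h v hv x hx⟩

theorem IsGoodOutput.preservesCuts {H : Hypergraph (Fin n)} {ε : ℝ} {w : Finset (Fin n) → ℝ}
    (h : IsGoodOutput (edges H) ε w) {k : ℕ} (hk : 0 < k) : PreservesCuts k ε H w := by
  intro f _
  have h1 : cutSize H f = (cutEdges (edges H) (Setoid.ker f)).card := by
    unfold cutSize cutEdges
    congr 1
    ext e
    simp only [Finset.mem_filter, crosses_iff hk]
  have h2 : cutWeight w f = ∑ e ∈ cutEdges univ (Setoid.ker f), w e := by
    unfold cutWeight cutEdges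
    congr 1
    ext e
    simp only [Finset.mem_filter, crosses_iff hk]
  have h3 := abs_le.1 (h.2.2 (Setoid.ker f))
  rw [h1, h2]
  constructor <;> nlinarith [h3.1, h3.2]

theorem IsGoodOutput.isCutSparsifier {H : Hypergraph (Fin n)} {ε : ℝ} {w : Finset (Fin n) → ℝ}
    (h : IsGoodOutput (edges H) ε w) : IsCutSparsifier ε H w :=
  ⟨⟨h.1, h.2.1⟩, h.preservesCuts two_pos⟩

/-- The number of sets of at most `r` vertices. -/
theorem card_filter_card_le (n r : ℕ) :
    ((univ : Finset (Finset (Fin n))).filter fun e => e.card ≤ r).card ≤ (n + 1) ^ r := by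
  have hsurj : ((univ : Finset (Finset (Fin n))).filter fun e => e.card ≤ r) ⊆
      (univ : Finset (Fin r → Option (Fin n))).image fun g =>
        univ.filter fun v => ∃ i, g i = some v := by
    intro e he
    have hr : e.card ≤ r := (Finset.mem_filter.1 he).2
    refine Finset.mem_image.2 ⟨fun i => if h : i.val < e.card then
      some (e.equivFin.symm ⟨i, h⟩) else none, Finset.mem_univ _, ?_⟩
    ext v
    simp only [Finset.mem_filter, Finset.mem_univ, true_and]
    constructor
    · rintro ⟨i, hi⟩
      split_ifs at hi with h
      rw [Option.some.injEq] at hi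
      rw [← hi]
      exact Subtype.prop _
    · intro hv
      refine ⟨⟨e.equivFin ⟨v, hv⟩, (Fin.is_lt _).trans_le hr⟩, ?_⟩
      simp
  refine (Finset.card_le_card hsurj).trans (Finset.card_image_le.trans ?_)
  simp

/-- The sketch without rows. -/
def emptySketch (n : ℕ) : RandomizedLinearSketch n where
  Seed := Unit
  law := PMF.pure ()
  rows := 0
  matrix _ j := j.elim0
  width j := j.elim0
  recover _ _ _ := 0

theorem not_cuts_of_card_le_one {V : Type} {s : Setoid V} {e : Finset V} (h : e.card ≤ 1) :
    ¬ Cuts s e := by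
  rw [Cuts, not_not, contract_le_iff]
  intro x hx y hy
  rw [Finset.card_le_one.1 h x hx y hy]

theorem isGoodOutput_zero {E : Finset (Finset (Fin n))} {ε : ℝ} (h : ∀ e ∈ E, e.card ≤ 1) :
    IsGoodOutput E ε fun _ => 0 := by
  refine ⟨fun _ => le_rfl, fun e he => absurd rfl he, fun s => ?_⟩
  have : cutEdges E s = ∅ := Finset.filter_eq_empty_iff.2 fun e he => not_cuts_of_card_le_one (h e he)
  simp [this]

theorem successProb_emptySketch (H : Hypergraph (Fin n)) {good : (Finset (Fin n) → ℝ) → Prop}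
    (h : good fun _ => 0) : (emptySketch n).successProb H good = 1 := by
  have : {ω | good ((emptySketch n).output ω H)} = Set.univ := Set.eq_univ_of_forall fun _ => h
  rw [RandomizedLinearSketch.successProb, this, (PMF.toOuterMeasure_apply_eq_one_iff _ _).2
    (Set.subset_univ _), ENNReal.toReal_one]

end Sketch

/-! ### Numerical estimates. -/

section Parameters

theorem log_add_one_le {n : ℕ} (hn : 2 ≤ n) : ((Nat.log 2 n + 1 : ℕ) : ℝ) ≤ 3 * Real.log n := by
  have h2 := Real.log_two_gt_d9
  have h1 : (Nat.log 2 n : ℝ) * Real.log 2 ≤ Real.log n := by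
    rw [← Real.log_pow]
    refine Real.log_le_log (by positivity) ?_
    exact_mod_cast Nat.pow_log_le_self 2 (by omega)
  have h3 : Real.log 2 ≤ Real.log n := Real.log_le_log two_pos (by exact_mod_cast hn)
  push_cast
  nlinarith [(Nat.log 2 n).cast_nonneg (α := ℝ)]

theorem clog_le {m : ℕ} (hm : 2 ≤ m) : (Nat.clog 2 m : ℝ) ≤ 3 * Real.log m := by
  have h2 := Real.log_two_gt_d9
  have h0 : 1 ≤ Nat.clog 2 m := Nat.clog_pos (by norm_num) hm
  have h1 : ((Nat.clog 2 m - 1 : ℕ) : ℝ) * Real.log 2 ≤ Real.log m := by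
    rw [← Real.log_pow]
    refine Real.log_le_log (by positivity) ?_
    exact_mod_cast (Nat.pow_pred_clog_lt_self (by norm_num) (by omega)).le
  have h3 : Real.log 2 ≤ Real.log m := Real.log_le_log two_pos (by exact_mod_cast hm)
  rw [Nat.cast_sub h0] at h1
  push_cast at h1
  have h4 : (1 : ℝ) ≤ Nat.clog 2 m := by exact_mod_cast h0
  nlinarith

theorem failure_le {n N J : ℕ} (hn : 2 ≤ n) (hN : N ≤ n) (hJ : J ≤ n) {δ η : ℝ}
    (hδ0 : 0 ≤ δ) (hη0 : 0 ≤ η) (hδ : δ * (n : ℝ) ^ 13 ≤ 1) (hη : η * (n : ℝ) ^ 13 ≤ 1) :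
    (N * J) * ((2 * n + 1) * δ) + ((N + 1) * (3 * (n * δ)) + (N * J + (N + 1)) * (2 * η)) ≤
      4 / (n : ℝ) ^ 8 := by
  have hn' : (2 : ℝ) ≤ n := by exact_mod_cast hn
  have hN' : (N : ℝ) ≤ n := by exact_mod_cast hN
  have hJ' : (J : ℝ) ≤ n := by exact_mod_cast hJ
  set x : ℝ := (n : ℝ)
  have hNJ : (N * J : ℝ) ≤ x * x := mul_le_mul hN' hJ' (by positivity) (by positivity)
  have hx2 : 2 * x ≤ x * x := by nlinarith
  have h1 : (N * J : ℝ) * ((2 * x + 1) * δ) ≤ x * x * (x * x * 2 * δ) := by gcongr; nlinarith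
  have h2 : ((N : ℝ) + 1) * (3 * (x * δ)) ≤ x * x * (3 * (x * δ)) := by gcongr; nlinarith
  have h3 : ((N : ℝ) * J + (N + 1)) * (2 * η) ≤ (x * x + x * x) * (2 * η) := by
    gcongr; nlinarith
  rw [le_div_iff₀ (by positivity)]
  have e1 : x * x * (x * x * 2 * δ) * x ^ 8 = 2 * (δ * x ^ 12) := by ring
  have e2 : x * x * (3 * (x * δ)) * x ^ 8 = 3 * (δ * x ^ 11) := by ring
  have e3 : (x * x + x * x) * (2 * η) * x ^ 8 = 4 * (η * x ^ 10) := by ring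
  have d1 : δ * x ^ 12 * 2 ≤ 1 := by
    refine le_trans ?_ hδ
    rw [pow_succ x 12, ← mul_assoc]; gcongr
  have d2 : δ * x ^ 11 * 4 ≤ 1 := by
    refine le_trans ?_ hδ
    rw [pow_add x 11 2, ← mul_assoc]; gcongr; nlinarith
  have d3 : η * x ^ 10 * 8 ≤ 1 := by
    refine le_trans ?_ hη
    rw [pow_add x 10 3, ← mul_assoc]; gcongr
    calc (8 : ℝ) = 2 ^ 3 := by norm_num
      _ ≤ x ^ 3 := by gcongr
  have := mul_le_mul_of_nonneg_right (add_le_add h1 (add_le_add h2 h3)) (by positivity : 0 ≤ x ^ 8)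
  linarith

theorem bits_le {n r m N Λ K : ℕ} {ε : ℝ} (hn : 2 ≤ n) (hr : 2 ≤ r) (hm : 2 ≤ m) (hε : 0 < ε)
    (hε1 : ε < 1) (hN1 : 1 ≤ N) (hN : (N : ℝ) ≤ 3 * Real.log m) (hΛ2 : 2 ≤ Λ)
    (hΛ : (Λ : ℝ) ≤ 3 * Real.log n) (hK : (K : ℝ) ≤ 17424 * Λ ^ 3 / ε ^ 2) :
    (((N * Λ + (N + 1)) * (K * n) * ((2 * (Λ * r) + 13 * Λ) + 1) : ℕ) : ℝ) ≤
      softO (76212576 * 3) 5 ((n : ℝ) * r * Real.log m / ε ^ 2) := by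
  have hn' : (2 : ℝ) ≤ n := by exact_mod_cast hn
  have hr' : (2 : ℝ) ≤ r := by exact_mod_cast hr
  have hN1' : (1 : ℝ) ≤ N := by exact_mod_cast hN1
  have hΛ2' : (2 : ℝ) ≤ Λ := by exact_mod_cast hΛ2
  have hlm : 0.69 ≤ Real.log m := by
    have := Real.log_two_gt_d9
    have h3 : Real.log 2 ≤ Real.log m := Real.log_le_log two_pos (by exact_mod_cast hm)
    linarith
  set X : ℝ := (n : ℝ) * r * Real.log m / ε ^ 2 with hX
  -- Since r log m ≥ 2 · 0.69 > 1 and ε < 1, powers of log n are absorbed into powers of log (2 +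
  -- X).
  have hnX : (n : ℝ) ≤ X := by
    rw [hX, le_div_iff₀ (by positivity), mul_assoc]
    refine mul_le_mul_of_nonneg_left ?_ (by positivity)
    nlinarith
  have hlog : Real.log n ≤ Real.log (2 + X) := Real.log_le_log (by linarith) (by linarith)
  have hΛℓ : (Λ : ℝ) ≤ 3 * Real.log (2 + X) := by linarith
  have h1 : (N : ℝ) * Λ + (N + 1) ≤ 2 * N * Λ := by nlinarith
  have h2 : 2 * ((Λ : ℝ) * r) + 13 * Λ + 1 ≤ 9 * (Λ * r) := by nlinarith
  push_cast
  calc ((N : ℝ) * Λ + (N + 1)) * (K * n) * (2 * ((Λ : ℝ) * r) + 13 * Λ + 1)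
      ≤ (2 * (3 * Real.log m) * Λ) * (17424 * Λ ^ 3 / ε ^ 2 * n) * (9 * (Λ * r)) := by
        gcongr
        refine h1.trans ?_
        gcongr
    _ = 940896 * X * Λ ^ 5 := by rw [hX]; ring
    _ ≤ 940896 * X * (3 * Real.log (2 + X)) ^ 5 := by
        have : 0 ≤ X := by linarith
        gcongr
    _ = _ := by unfold softO; ring

end Parameters

/-! ### Choice of parameters and the theorem. -/

section Main

theorem RandomizedLinearSketch.successProb_mono {n : ℕ} (S : RandomizedLinearSketch n)
    (H : Hypergraph (Fin n)) {P Q : (Finset (Fin n) → ℝ) → Prop} (h : ∀ w, P w → Q w) :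
    S.successProb H P ≤ S.successProb H Q := by
  refine ENNReal.toReal_mono (ne_top_of_le_ne_top ENNReal.one_ne_top ?_)
    (MeasureTheory.measure_mono fun ω hω => h _ hω)
  exact (MeasureTheory.measure_mono (Set.subset_univ _)).trans
    (le_of_eq ((PMF.toOuterMeasure_apply_eq_one_iff _ _).2 (Set.subset_univ _)))

theorem exists_linearSketch {n m r : ℕ} {ε : ℝ} (hn : 2 ≤ n) (hr : 2 ≤ r) (hm : 2 ≤ m)
    (hε : 0 < ε) (hε1 : ε < 1) : ∃ S : RandomizedLinearSketch n,
      (S.bits : ℝ) ≤ softO (76212576 * 3) 5 ((n : ℝ) * r * Real.log m / ε ^ 2) ∧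
      ∀ H : Hypergraph (Fin n), IsBounded m r H → S.Fits H ∧
        1 - 4 / (n : ℝ) ^ 8 ≤ S.successProb H (IsGoodOutput (edges H) ε) := by
  have : Nonempty (Fin n) := ⟨⟨0, by omega⟩⟩
  obtain ⟨Λ, hΛ⟩ : ∃ Λ : ℕ, Λ = Nat.log 2 n + 1 := ⟨_, rfl⟩
  have hnΛ : n < 2 ^ Λ := hΛ ▸ Nat.lt_pow_succ_log_self (by norm_num) n
  have hΛ2 : 2 ≤ Λ := by
    have := Nat.log_pos (b := 2) (by norm_num) hn
    omega
  have hΛn : Λ ≤ n := hΛ ▸ Nat.log_lt_self 2 (by omega)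
  -- With J = L = Λ and A = 13Λ the round condition reads 34Λ · 32Λ² = 1088Λ³ ≤ κ; the factor 1/ε²
  -- serves the output sample.
  obtain ⟨κ, hκ⟩ : ∃ κ : ℕ, κ = ⌈1088 * (Λ : ℝ) ^ 3 / ε ^ 2⌉₊ := ⟨_, rfl⟩
  -- The minimum with 2^n keeps N ≤ n for the failure bound, and 2^N still bounds the number of
  -- hyperedges.
  obtain ⟨N, hN⟩ : ∃ N : ℕ, N = Nat.clog 2 (min m (2 ^ n)) := ⟨_, rfl⟩
  set U : Finset (Finset (Fin n)) := univ.filter fun e => e.card ≤ r with hU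
  -- There are at most (n+1)^r ≤ 2^(Λr) admissible edges; the further factor 2^(13Λ) ≥ n^13 makes
  -- ambiguity unlikely.
  obtain ⟨q, hq⟩ : ∃ q : ℕ, q = 2 ^ (Λ * r + 13 * Λ) := ⟨_, rfl⟩
  have : NeZero q := ⟨by rw [hq]; positivity⟩
  have hmin : 2 ≤ min m (2 ^ n) := le_min hm (Nat.le_self_pow (by omega) 2)
  have hN1 : 1 ≤ N := hN ▸ Nat.clog_pos (by norm_num) hmin
  have hNn : N ≤ n := hN ▸ Nat.clog_le_of_le_pow (min_le_right _ _)
  have hNm : (N : ℝ) ≤ 3 * Real.log m :=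
    le_trans (Nat.cast_le.2 (hN ▸ Nat.clog_mono_right 2 (min_le_left _ _))) (clog_le hm)
  have hUc : U.card ≤ 2 ^ (Λ * r) := by
    rw [pow_mul]
    exact (card_filter_card_le n r).trans (Nat.pow_le_pow_left hnΛ r)
  have hΛ1 : (1 : ℝ) ≤ Λ := by exact_mod_cast (by omega : 1 ≤ Λ)
  have hκ1 : 1088 * (Λ : ℝ) ^ 3 / ε ^ 2 ≤ κ := hκ ▸ Nat.le_ceil _
  have hκε : 1088 * (Λ : ℝ) ^ 3 ≤ ε ^ 2 * κ := by
    rw [mul_comm (ε ^ 2)]; exact (div_le_iff₀ (by positivity)).1 hκ1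
  have hκ2 : (κ : ℝ) ≤ 1089 * Λ ^ 3 / ε ^ 2 := by
    rw [hκ]
    refine (Nat.ceil_lt_add_one (by positivity)).le.trans ?_
    have : 1 ≤ (Λ : ℝ) ^ 3 / ε ^ 2 := by
      rw [one_le_div (by positivity)]
      exact (pow_le_one₀ hε.le hε1.le).trans (one_le_pow₀ hΛ1)
    have h2 : 1089 * (Λ : ℝ) ^ 3 / ε ^ 2 = 1088 * (Λ : ℝ) ^ 3 / ε ^ 2 + Λ ^ 3 / ε ^ 2 := by ring
    linarith
  have hκ3 : 1088 * (Λ : ℝ) ^ 3 ≤ κ := by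
    refine hκε.trans (mul_le_of_le_one_left (Nat.cast_nonneg _) ?_)
    exact pow_le_one₀ hε.le hε1.le
  have hκ0 : (1 : ℝ) ≤ κ := by nlinarith [one_le_pow₀ hΛ1 (n := 3)]
  -- The multiplicity 16κ is twice the density 8κ at which samples are decoded; the width
  -- accommodates 2^(Λr) entries below q.
  refine ⟨linearSketch n q (16 * κ) N Λ (2 * (Λ * r) + 13 * Λ) κ U, ?_, fun H hH => ⟨?_, ?_⟩⟩
  · rw [bits_linearSketch]
    refine bits_le hn hr hm hε hε1 hN1 hNm hΛ2 (hΛ ▸ log_add_one_le hn) ?_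
    push_cast
    refine (mul_le_mul_of_nonneg_left hκ2 (by norm_num)).trans (le_of_eq (by ring))
  · have hEU : edges H ⊆ U := fun e he => Finset.mem_filter.2 ⟨Finset.mem_univ _, hH.2.2 e he⟩
    refine fits_linearSketch (a := 2 ^ (Λ * r)) (by positivity)
      ((Finset.card_le_card hEU).trans hUc) (le_of_eq ?_)
    rw [hq, ← pow_add]
    ring_nf
  · have hEU : edges H ⊆ U := fun e he => Finset.mem_filter.2 ⟨Finset.mem_univ _, hH.2.2 e he⟩
    have hEc : ((edges H).card : ℝ) ≤ 4 * κ * 2 ^ N := by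
      have h1 : (edges H).card ≤ 2 ^ N := by
        refine le_trans (le_min hH.2.1 ?_) (hN ▸ Nat.le_pow_clog (by norm_num) _)
        refine (Finset.card_le_univ _).trans (le_of_eq ?_)
        simp
      have h2 : ((edges H).card : ℝ) ≤ 2 ^ N := by exact_mod_cast h1
      refine h2.trans (le_mul_of_one_le_left (by positivity) (by linarith))
    have hexp : (n : ℝ) ≤ Real.exp Λ := by
      have h1 : (n : ℝ) ≤ 2 ^ Λ := by exact_mod_cast hnΛ.le
      refine h1.trans ?_
      rw [← mul_one (Λ : ℝ), Real.exp_nat_mul]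
      gcongr
      linarith [Real.add_one_le_exp (1 : ℝ)]
    have hpr := pr_not_isGoodOutput_le (V := Fin n) (q := q) (K := 16 * κ) (N := N) (J := Λ)
      (κ := κ) (ε := ε) (by linarith) hε hε1.le (by rwa [Fintype.card_fin]) hEU hEc
      (by push_cast; linarith) (hUc.trans (hq ▸ Nat.pow_le_pow_right (by norm_num) (by omega)))
      (L := Λ) (A := 13 * Λ) (by rwa [Fintype.card_fin]) (by positivity)
      (by
        rw [le_div_iff₀ (by positivity)]
        refine le_trans (le_of_eq ?_) hκ3
        ring)
      (by nlinarith [one_le_pow₀ hΛ1 (n := 2)])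
    rw [Fintype.card_fin] at hpr
    have hfail := failure_le (N := N) (J := Λ) hn hNn hΛn (δ := Real.exp (-(13 * Λ)))
      (η := U.card / q) (by positivity) (by positivity) (by
        calc Real.exp (-(13 * Λ)) * (n : ℝ) ^ 13 ≤ Real.exp (-(13 * Λ)) * Real.exp Λ ^ 13 := by
              gcongr
          _ = 1 := by rw [← Real.exp_nat_mul, ← Real.exp_add]; norm_num) (by
        rw [div_mul_eq_mul_div, hq]
        push_cast
        rw [div_le_one (by positivity), pow_add, mul_comm 13 Λ, pow_mul 2 Λ 13]
        gcongr
        · exact_mod_cast hUc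
        · exact_mod_cast hnΛ.le)
    rw [successProb_linearSketch]
    exact one_sub_le_seedLaw (hpr.trans hfail)

end Main

end HypergraphSketch

end

theorem theorem1 :
    ∃ (C : ℝ) (c : ℕ), 0 < C ∧
      ∀ (n m r : ℕ) (ε : ℝ), 2 ≤ m → 0 < ε → ε < 1 →
        ∃ S : HypergraphSketch.RandomizedLinearSketch n,
          (S.bits : ℝ) ≤ HypergraphSketch.softO C c ((n : ℝ) * r * Real.log m / ε ^ 2) ∧
          ∀ H : Hypergraph (Fin n), HypergraphSketch.IsBounded m r H →
            S.Fits H ∧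
            1 - 4 / (n : ℝ) ^ 8 ≤
              S.successProb H (fun w =>
                HypergraphSketch.IsCutSparsifier ε H w ∧
                ∀ k : ℕ, 2 ≤ k → k ≤ n → HypergraphSketch.PreservesCuts k ε H w) := by
  refine ⟨76212576 * 3, 5, by norm_num, fun n m r ε hm hε hε1 => ?_⟩
  by_cases h : 2 ≤ n ∧ 2 ≤ r
  · obtain ⟨S, hbits, hS⟩ := HypergraphSketch.exists_linearSketch h.1 h.2 hm hε hε1
    refine ⟨S, hbits, fun H hH => ⟨(hS H hH).1, (hS H hH).2.trans ?_⟩⟩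
    exact HypergraphSketch.RandomizedLinearSketch.successProb_mono S H fun w hw =>
      ⟨hw.isCutSparsifier, fun k hk _ => hw.preservesCuts (by omega)⟩
  -- If n ≤ 1 or r ≤ 1, every hyperedge has at most one vertex and crosses nothing, so zero weights
  -- always succeed. For n = 0 the term 4 / 0 is 0, so certain success is really required.
  · refine ⟨HypergraphSketch.emptySketch n, ?_, fun H hH => ⟨fun _ j => j.elim0, ?_⟩⟩
    · have hlog : 0 ≤ Real.log m := Real.log_natCast_nonneg m
      have hX : 0 ≤ (n : ℝ) * r * Real.log m / ε ^ 2 := by positivity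
      have hlog' := Real.log_nonneg (show 1 ≤ 2 + (n : ℝ) * r * Real.log m / ε ^ 2 by linarith)
      have hbits : (HypergraphSketch.emptySketch n).bits = 0 := rfl
      rw [hbits, HypergraphSketch.softO, Nat.cast_zero]
      positivity
    · have hw : HypergraphSketch.IsGoodOutput (HypergraphSketch.edges H) ε fun _ => 0 :=
        HypergraphSketch.isGoodOutput_zero fun e he => by
          have h1 := hH.2.2 e he
          have h2 := e.card_le_univ
          rw [Fintype.card_fin] at h2
          omega
      rw [HypergraphSketch.successProb_emptySketch H
        ⟨hw.isCutSparsifier, fun k hk _ => hw.preservesCuts (by omega)⟩]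
      exact sub_le_self _ (by positivity)
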